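/- **Setting.** Let $\mathfrak g=V_1\oplus\dots\oplus V_k$ be a finite-dimensional real Lie algebra, stratified of step $k$: $[V_1,V_j]=V_{j+1}$ for $1\le j<k$ and $[V_1,V_k]=\{0\}$. Fix a basis $b_1,\dots,b_m$ of $\mathfrak g$ adapted to the stratification, let $\sigma_i$ be the index of the stratum containing $b_i$, and let $\mathbb G$ be the corresponding Carnot group in exponential coordinates: $\mathbb G=\mathbb R^m$, where $x$ stands for $\exp(\sum_i x_ib_i)$, with the product given by the Baker–Campbell–Hausdorff formula, so that $x^{-1}=-x$. Write $x^{(j)}=(x_i)_{\sigma_i=j}$, let $\|\cdot\|$ be the Euclidean norm, and put $$|x|_{\mathbb G}=\Big(\sum_{j=1}^k\|x^{(j)}\|^{2k!/j}\Big)^{1/(2k!)},\qquad \overline{B_\varepsilon(x)}=\{y:\ |y^{-1}\cdot x|_{\mathbb G}\le\varepsilon\}.$$ Let $X_i$ be the left-invariant vector field equal to $\partial_i$ at $0$, put $\nabla_{V_1}\phi=(X_i\phi)_{\sigma_i=1}$ and $D^{2,*}_{V_1}\phi=\big(\tfrac12(X_iX_j+X_jX_i)\phi\big)_{\sigma_i=\sigma_j=1}$,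 and, where $\nabla_{V_1}\phi\ne0$, $$\Delta^N_{p,\mathbb G}\phi=|\nabla_{V_1}\phi|^{2-p}\sum_{\sigma_i=1}X_i\big(|\nabla_{V_1}\phi|^{p-2}X_i\phi\big)\ (p<\infty),\qquad \Delta^N_{\infty,\mathbb G}\phi=\Big\langle D^{2,*}_{V_1}\phi\,\tfrac{\nabla_{V_1}\phi}{|\nabla_{V_1}\phi|},\tfrac{\nabla_{V_1}\phi}{|\nabla_{V_1}\phi|}\Big\rangle .$$ For $f$ continuous near $x$ and small $\varepsilon>0$, let $\mu_p(\varepsilon,f)(x)$ be the unique minimizer $\lambda\in\mathbb R$ of $\|f-\lambda\|_{L^p(\overline{B_\varepsilon(x)})}$ (Lebesgue measure). Let $\Omega\subset\mathbb G$ be open and $u:\Omega\to\mathbb R$ continuous. Strict minima and maxima below are local. * $u$ is a *viscosity solution* of $\Delta^N_{p,\mathbb G}u=0$ in $\Omega$ if, for every $x\in\Omega$ and every $\phi\in C^2(\Omega)$ with $\nabla_{V_1}\phi(x)\ne0$: $\Delta^N_{p,\mathbb G}\phi(x)\le0$ whenever $u-\phi$ has a strict minimum at $x$, and $\Delta^N_{p,\mathbb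 G}\phi(x)\ge0$ whenever $u-\phi$ has a strict maximum at $x$. * $u(x)=\mu_p(\varepsilon,u)(x)+o(\varepsilon^2)$ as $\varepsilon\to0^+$ *in the viscosity sense* at $x$ if, for every $\phi$ of class $C^2$ in a neighbourhood of $x$ with $\phi(x)=u(x)$ and $\nabla_{V_1}\phi(x)\neq0$: $\phi(x)\ge\mu_p(\varepsilon,\phi)(x)+o(\varepsilon^2)$ whenever $u-\phi$ has a strict minimum at $x$, and $\phi(x)\le\mu_p(\varepsilon,\phi)(x)+o(\varepsilon^2)$ whenever $u-\phi$ has a strict maximum at $x$. **Theorem 1.1.** Let $1<p\le\infty$, let $\Omega\subset\mathbb G$ be open and let $u$ be a continuous real-valued function on $\Omega$. Then $u$ is a viscosity solution of $\Delta^N_{p,\mathbb G}u=0$ in $\Omega$ if and only if, for every $x\in\Omega$, $u(x)=\mu_p(\varepsilon,u)(x)+o(\varepsilon^2)$ as $\varepsilon\to0^+$ in the viscosity sense. -/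

import Mathlib

open Filter Topology MeasureTheory Asymptotics
open scoped ENNReal

noncomputable section

/-- The subspace `V_j` spanned by those basis vectors whose homogeneity `σ i` is `j`. -/
def stratum {𝔤 : Type*} [LieRing 𝔤] [LieAlgebra ℝ 𝔤] {m : ℕ}
    (b : Module.Basis (Fin m) ℝ 𝔤) (σ : Fin m → ℕ) (j : ℕ) : Submodule ℝ 𝔤 :=
  Submodule.span ℝ (b '' {i | σ i = j})

/-- The subspace `[V, W]` spanned by all brackets `[x, y]` with `x ∈ V` and `y ∈ W`. -/
def bracketSpan {𝔤 : Type*} [LieRing 𝔤] [LieAlgebra ℝ 𝔤] (V W : Submodule ℝ 𝔤) :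
    Submodule ℝ 𝔤 :=
  Submodule.span ℝ {z | ∃ x ∈ V, ∃ y ∈ W, ⁅x, y⁆ = z}

/-- A Carnot group of dimension `m` and step `k` with Lie algebra `𝔤`, in exponential coordinates:
a stratification `𝔤 = V_1 ⊕ ⋯ ⊕ V_k` of `𝔤`, that is `[V_1, V_j] = V_{j+1}` for `1 ≤ j < k` and
`[V_1, V_k] = 0`, together with a basis of `𝔤` adapted to it. The homogeneity `σ i` is the index of
the stratum that contains the basis vector `basis i`; since `basis` is a basis, the sum of the
strata is direct and equal to `𝔤`.

The group itself is `ℝ^m = (Fin m → ℝ)`, where the point `(x_1, …, x_m)` stands for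
`exp (∑ i, x_i • basis i)`, with the Baker-Campbell-Hausdorff product `CarnotGroup.mul` below. -/
structure CarnotGroup (𝔤 : Type*) [LieRing 𝔤] [LieAlgebra ℝ 𝔤] (m k : ℕ) where
  basis : Module.Basis (Fin m) ℝ 𝔤
  σ : Fin m → ℕ
  one_le_σ : ∀ i, 1 ≤ σ i
  σ_le : ∀ i, σ i ≤ k
  bracket_stratum : ∀ j, 1 ≤ j → j < k →
    bracketSpan (stratum basis σ 1) (stratum basis σ j) = stratum basis σ (j + 1)
  bracket_stratum_last : bracketSpan (stratum basis σ 1) (stratum basis σ k) = ⊥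

/-- `e^{ad x}` in a Lie algebra that is nilpotent of step `k`; there `(ad x)^j = 0` for `j ≥ k`, so
that the exponential series is this finite sum. -/
def expAd {𝔤 : Type*} [LieRing 𝔤] [LieAlgebra ℝ 𝔤] (k : ℕ) (x : 𝔤) : Module.End ℝ 𝔤 :=
  ∑ j ∈ Finset.range (k + 1), ((j.factorial : ℝ)⁻¹) • (LieAlgebra.ad ℝ 𝔤 x) ^ j

/-- The power series `g(z) = z log z / (z - 1) = 1 + ∑_{n ≥ 1} (-1)^(n+1) / (n (n+1)) (z - 1)^n` at an
endomorphism `T` with `(T - 1)^j = 0` for `j > k`. -/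
def bchSeries {𝔤 : Type*} [LieRing 𝔤] [LieAlgebra ℝ 𝔤] (k : ℕ) (T : Module.End ℝ 𝔤) :
    Module.End ℝ 𝔤 :=
  1 + ∑ n ∈ Finset.Icc 1 k, ((-1 : ℝ) ^ (n + 1) / (n * (n + 1))) • (T - 1) ^ n

namespace CarnotGroup

variable {𝔤 : Type*} [LieRing 𝔤] [LieAlgebra ℝ 𝔤] {m k : ℕ} (G : CarnotGroup 𝔤 m k)

/-- The element `∑ i, x_i • basis i` of the Lie algebra with coordinates `x`. -/
def toLie (x : Fin m → ℝ) : 𝔤 := G.basis.equivFun.symm x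

/-- The group law `x · y = log (exp x exp y)`, by the Baker-Campbell-Hausdorff formula in integral
form, `log (exp x exp y) = x + ∫_0^1 g(e^{ad x} e^{t ad y}) y dt` with `g(z) = z log z / (z - 1)`. -/
def mul (x y : Fin m → ℝ) : Fin m → ℝ :=
  x + ∫ t in (0 : ℝ)..1, G.basis.equivFun
    (bchSeries k (expAd k (G.toLie x) * expAd k (t • G.toLie y)) (G.toLie y))

/-- The group inverse; in exponential coordinates `(exp x)⁻¹ = exp (-x)`. -/
def inv (_G : CarnotGroup 𝔤 m k) (x : Fin m → ℝ) : Fin m → ℝ := -x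

/-- The Euclidean norm `‖x^(j)‖` of the coordinates of `x` in the `j`-th stratum. -/
def layerNorm (x : Fin m → ℝ) (j : ℕ) : ℝ :=
  √(∑ i with G.σ i = j, x i ^ 2)

/-- The pseudonorm `|x| = (∑_{j=1}^k ‖x^(j)‖^(2 k! / j))^(1 / (2 k!))`. The division of natural
numbers is exact, since `j` divides `k!`. -/
def pnorm (x : Fin m → ℝ) : ℝ :=
  (∑ j ∈ Finset.Icc 1 k, G.layerNorm x j ^ (2 * k.factorial / j)) ^ (1 / (2 * (k.factorial : ℝ)))

/-- The closed pseudoball of radius `r` centred at `x`. -/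
def closedPBall (x : Fin m → ℝ) (r : ℝ) : Set (Fin m → ℝ) :=
  {y | G.pnorm (G.mul (G.inv y) x) ≤ r}

/-- The Jacobian basis: `X_i(x)` is the Jacobian of the left translation `y ↦ x · y` at `0`, applied
to the `i`-th standard basis vector. -/
def field (i : Fin m) (x : Fin m → ℝ) : Fin m → ℝ :=
  fderiv ℝ (G.mul x) 0 (Pi.single i 1)

/-- The derivative `X_i f` of a function along the vector field `X_i`. -/
def X (i : Fin m) (f : (Fin m → ℝ) → ℝ) (x : Fin m → ℝ) : ℝ :=
  fderiv ℝ f x (G.field i x)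

/-- The indices of the horizontal directions, which span `V_1`. -/
def horizontal : Finset (Fin m) := {i | G.σ i = 1}

/-- The length `|∇_{V_1} f(x)|` of the horizontal gradient. -/
def gradNorm (f : (Fin m → ℝ) → ℝ) (x : Fin m → ℝ) : ℝ :=
  √(∑ i ∈ G.horizontal, G.X i f x ^ 2)

/-- The entries `(X_i X_j f + X_j X_i f) / 2` of the symmetrized horizontal Hessian. -/
def symHess (f : (Fin m → ℝ) → ℝ) (x : Fin m → ℝ) (i j : Fin m) : ℝ :=
  (G.X i (G.X j f) x + G.X j (G.X i f) x) / 2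

/-- The subelliptic normalized `p`-Laplacian at a point where the horizontal gradient of `f` does
not vanish: `div_{V_1}(|∇_{V_1} f|^(p-2) ∇_{V_1} f) / |∇_{V_1} f|^(p-2)` for `p < ∞`, and the
symmetrized horizontal Hessian applied twice to `∇_{V_1} f / |∇_{V_1} f|` for `p = ∞`. -/
def normLaplacian (p : ℝ≥0∞) (f : (Fin m → ℝ) → ℝ) (x : Fin m → ℝ) : ℝ :=
  if p = ∞ then
    ∑ i ∈ G.horizontal, ∑ j ∈ G.horizontal,
      G.symHess f x i j * (G.X i f x / G.gradNorm f x) * (G.X j f x / G.gradNorm f x)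
  else
    (∑ i ∈ G.horizontal, G.X i (fun y => G.gradNorm f y ^ (p.toReal - 2) * G.X i f y) x) /
      G.gradNorm f x ^ (p.toReal - 2)

end CarnotGroup

/-- `f` has a strict local minimum at `x`. -/
def IsStrictLocalMin {m : ℕ} (f : (Fin m → ℝ) → ℝ) (x : Fin m → ℝ) : Prop :=
  ∀ᶠ y in 𝓝[≠] x, f x < f y

/-- `f` has a strict local maximum at `x`. -/
def IsStrictLocalMax {m : ℕ} (f : (Fin m → ℝ) → ℝ) (x : Fin m → ℝ) : Prop :=
  ∀ᶠ y in 𝓝[≠] x, f y < f x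

namespace CarnotGroup

variable {𝔤 : Type*} [LieRing 𝔤] [LieAlgebra ℝ 𝔤] {m k : ℕ} (G : CarnotGroup 𝔤 m k)

/-- Viscosity supersolutions of the normalized `p`-Laplace equation in `Ω`. -/
def IsViscositySupersolution (p : ℝ≥0∞) (Ω : Set (Fin m → ℝ)) (u : (Fin m → ℝ) → ℝ) : Prop :=
  LowerSemicontinuousOn u Ω ∧
    ∀ x ∈ Ω, ∀ φ : (Fin m → ℝ) → ℝ, ContDiffOn ℝ 2 φ Ω → G.gradNorm φ x ≠ 0 →
      IsStrictLocalMin (fun y => u y - φ y) x → G.normLaplacian p φ x ≤ 0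

/-- Viscosity subsolutions of the normalized `p`-Laplace equation in `Ω`. -/
def IsViscositySubsolution (p : ℝ≥0∞) (Ω : Set (Fin m → ℝ)) (u : (Fin m → ℝ) → ℝ) : Prop :=
  UpperSemicontinuousOn u Ω ∧
    ∀ x ∈ Ω, ∀ φ : (Fin m → ℝ) → ℝ, ContDiffOn ℝ 2 φ Ω → G.gradNorm φ x ≠ 0 →
      IsStrictLocalMax (fun y => u y - φ y) x → 0 ≤ G.normLaplacian p φ x

/-- Viscosity solutions of the normalized `p`-Laplace equation in `Ω`. -/
def IsViscositySolution (p : ℝ≥0∞) (Ω : Set (Fin m → ℝ)) (u : (Fin m → ℝ) → ℝ) : Prop :=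
  ContinuousOn u Ω ∧ G.IsViscositySupersolution p Ω u ∧ G.IsViscositySubsolution p Ω u

/-- `c = μ_p(ε, f)(x)`: the number `c` is the unique minimizer of `c' ↦ ‖f - c'‖` in `L^p` of the
closed pseudoball of radius `ε` centred at `x`, with respect to Lebesgue measure. -/
def IsMu (p : ℝ≥0∞) (ε : ℝ) (f : (Fin m → ℝ) → ℝ) (x : Fin m → ℝ) (c : ℝ) : Prop :=
  ∀ c' : ℝ, c' ≠ c →
    eLpNorm (fun y => f y - c) p (volume.restrict (G.closedPBall x ε)) <
      eLpNorm (fun y => f y - c') p (volume.restrict (G.closedPBall x ε))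

/-- `u(x) = μ_p(ε, u)(x) + o(ε^2)` as `ε → 0+` in the viscosity sense at the point `x`: for each
admissible test function `φ`, the number `M ε = μ_p(ε, φ)(x)` is well defined for all small `ε > 0`
and `φ(x) ≥ M ε + o(ε^2)`, respectively `φ(x) ≤ M ε + o(ε^2)`. -/
def AsymptoticMeanValue (p : ℝ≥0∞) (u : (Fin m → ℝ) → ℝ) (x : Fin m → ℝ) : Prop :=
  (∀ U : Set (Fin m → ℝ), IsOpen U → x ∈ U → ∀ φ : (Fin m → ℝ) → ℝ, ContDiffOn ℝ 2 φ U →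
    IsStrictLocalMin (fun y => u y - φ y) x → u x = φ x → G.gradNorm φ x ≠ 0 →
    ∃ M r : ℝ → ℝ, (∀ᶠ ε in 𝓝[>] 0, G.IsMu p ε φ x (M ε)) ∧
      r =o[𝓝[>] 0] (fun ε : ℝ => ε ^ 2) ∧ ∀ᶠ ε in 𝓝[>] 0, M ε + r ε ≤ φ x) ∧
  (∀ U : Set (Fin m → ℝ), IsOpen U → x ∈ U → ∀ φ : (Fin m → ℝ) → ℝ, ContDiffOn ℝ 2 φ U →
    IsStrictLocalMax (fun y => u y - φ y) x → u x = φ x → G.gradNorm φ x ≠ 0 →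
    ∃ M r : ℝ → ℝ, (∀ᶠ ε in 𝓝[>] 0, G.IsMu p ε φ x (M ε)) ∧
      r =o[𝓝[>] 0] (fun ε : ℝ => ε ^ 2) ∧ ∀ᶠ ε in 𝓝[>] 0, φ x ≤ M ε + r ε)

end CarnotGroup

end

/-! Everything rests on one expansion, `exists_isMu_expansion`: if the horizontal gradient of a `C²`
function `φ` does not vanish at `x`, then `μ_p(ε, φ)(x) = φ(x) + c ε² Δ φ(x) + o(ε²)`, where `Δ` is
the normalized `p`-Laplacian and `c > 0`. After division by `ε²`, an inequality between `φ(x)` and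
`μ_p(ε, φ)(x)` up to `o(ε²)` is the same as a sign of `Δ φ(x)`, so the two notions of viscosity
solution test the same condition.

For the expansion, pull back to the unit pseudoball by `w ↦ x · δ_ε w`. Left translations preserve
Lebesgue measure and dilations multiply it by a constant, so the minimizer is unchanged
(`isMu_iff`). A homogeneous Taylor formula (`expansion`) gives `φ(x · δ_ε w) = φ(x) + ε L(w) + ε²
Q(w) + o(ε²)` uniformly in `w`, with `L` the horizontal gradient as a linear form, and `Q` the
second-stratum derivatives plus half of the symmetrized horizontal Hessian.

If `p < ∞`, the minimizer is the zero of `c ↦ ∫ ψ(g - c)` with `ψ(t) = |t|^(p-2) t`. As `∫ ψ(L) = 0`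
by oddness, linearizing `ψ` at `L` gives the coefficient `∫ |L|^(p-2) Q / ∫ |L|^(p-2)` of `ε²`
(`isLittleO_of_integral_signedPow_eq_zero`). The weight is integrable because `p - 2 > -1`.
Reflections preserving the pseudoball determine the moments of `|L|^(p-2)` (`integral_moment`):
second-stratum terms drop out, and the Hessian is contracted with a multiple of `I + (p-2) a ⊗ a /
|a|²`, where `a` is the gradient.

If `p = ∞`, the minimizer is the mid-range. `L` has a unique maximum point `w₀` on the pseudoball
and its minimum at `-w₀`, so the terms of order `ε` cancel and `(Q(w₀) + Q(-w₀)) / 2` remains.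

The group structure has to be extracted from the integral form of the Baker-Campbell-Hausdorff
formula. The Lie algebra is represented faithfully by nilpotent operators, where exponential and
logarithm are polynomials. There the integrand is the derivative of `t ↦ log (e^x e^(ty))`, so the
product becomes composition of exponentials (`mul_eq_and_rep`, `expRep_mul`); associativity,
smoothness and compatibility with dilations follow. -/

noncomputable section

/-! ### Truncated exponential and logarithm as polynomials -/

namespace TruncatedSeries

open Polynomial

/-- The exponential series truncated after degree `N`. -/
def expPoly (N : ℕ) : ℝ[X] := ∑ j ∈ Finset.range (N + 1), C ((j.factorial : ℝ)⁻¹) * X ^ j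

/-- The series `log (1 + X)` truncated after degree `N`. -/
def logPoly (N : ℕ) : ℝ[X] := ∑ n ∈ Finset.range N, C ((-1 : ℝ) ^ n / (n + 1)) * X ^ (n + 1)

/-- The series `log (1 + X) / X` truncated after degree `N`. -/
def logQuotPoly (N : ℕ) : ℝ[X] := ∑ n ∈ Finset.range (N + 1), C ((-1 : ℝ) ^ n / (n + 1)) * X ^ n

/-- The series `(exp X - 1) / X` truncated after degree `N`. -/
def expQuotPoly (N : ℕ) : ℝ[X] :=
  ∑ j ∈ Finset.range (N + 1), C (((j + 1).factorial : ℝ)⁻¹) * X ^ j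

/-- The series `(1 + X) log (1 + X) / X` truncated after degree `N`. -/
def bchPoly (N : ℕ) : ℝ[X] :=
  1 + ∑ n ∈ Finset.Icc 1 N, C ((-1 : ℝ) ^ (n + 1) / (n * (n + 1))) * X ^ n

theorem X_mul_logQuotPoly (N : ℕ) : X * logQuotPoly N = logPoly (N + 1) := by
  simp only [logQuotPoly, logPoly, Finset.mul_sum]
  refine Finset.sum_congr rfl fun n _ => ?_
  ring

theorem X_mul_expQuotPoly (N : ℕ) : X * expQuotPoly N = expPoly (N + 1) - 1 := by
  rw [expPoly, Finset.sum_range_succ']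
  simp only [expQuotPoly, Finset.mul_sum]
  simp only [pow_zero, Nat.factorial_zero, Nat.cast_one, inv_one, C_1, mul_one, add_sub_cancel_right]
  refine Finset.sum_congr rfl fun n _ => ?_
  ring

/-- The product of `1 + X` with the truncated quotient has one surplus top term, which vanishes on
elements whose power `N + 1` is zero. -/
theorem bchPoly_eq (N : ℕ) :
    bchPoly N = (1 + X) * logQuotPoly N - C ((-1 : ℝ) ^ N / (N + 1)) * X ^ (N + 1) := by
  induction N with
  | zero => simp [bchPoly, logQuotPoly]
  | succ N ih =>
    have h1 : bchPoly (N + 1) = bchPoly N +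
        C ((-1 : ℝ) ^ (N + 1 + 1) / ((N + 1 : ℕ) * ((N + 1 : ℕ) + 1))) * X ^ (N + 1) := by
      rw [bchPoly, bchPoly, Finset.sum_Icc_succ_top (by omega), ← add_assoc]
    have h2 : logQuotPoly (N + 1) = logQuotPoly N +
        C ((-1 : ℝ) ^ (N + 1) / ((N + 1 : ℕ) + 1)) * X ^ (N + 1) := by
      rw [logQuotPoly, logQuotPoly, Finset.sum_range_succ]
    have h3 : ((-1 : ℝ) ^ (N + 1 + 1) / ((N + 1 : ℕ) * ((N + 1 : ℕ) + 1))) =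
        (-1 : ℝ) ^ (N + 1) / ((N + 1 : ℕ) + 1) + (-1 : ℝ) ^ N / (N + 1) := by
      have : (N : ℝ) + 1 ≠ 0 := by positivity
      have : (N : ℝ) + 1 + 1 ≠ 0 := by positivity
      push_cast
      field_simp
      ring
    rw [h1, h2, h3, ih, C_add]
    ring

theorem expPoly_succ (N : ℕ) :
    expPoly (N + 1) = expPoly N + C (((N + 1).factorial : ℝ)⁻¹) * X ^ (N + 1) := by
  rw [expPoly, expPoly, Finset.sum_range_succ]

theorem logPoly_succ (N : ℕ) :
    logPoly (N + 1) = logPoly N + C ((-1 : ℝ) ^ N / (N + 1)) * X ^ (N + 1) := by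
  rw [logPoly, logPoly, Finset.sum_range_succ]

theorem derivative_expPoly_succ (N : ℕ) : derivative (expPoly (N + 1)) = expPoly N := by
  rw [expPoly, Finset.sum_range_succ']
  simp only [derivative_add, derivative_sum, derivative_C_mul, derivative_X_pow, expPoly]
  simp only [Nat.cast_zero, C_0, zero_mul, mul_zero, add_zero]
  refine Finset.sum_congr rfl fun n _ => ?_
  rw [Nat.factorial_succ, ← mul_assoc, ← C_mul]
  congr 2
  have : (n : ℝ) + 1 ≠ 0 := by positivity
  push_cast
  field_simp

/-- The derivative is a finite geometric sum in `-X`; the power `(-X)^N` is the truncation error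
carried through the composition identities. -/
theorem one_add_X_mul_derivative_logPoly (N : ℕ) :
    (1 + X) * derivative (logPoly N) = 1 - (-X) ^ N := by
  induction N with
  | zero => simp [logPoly]
  | succ N ih =>
    have h : ((-1 : ℝ) ^ N / (N + 1)) * (N + 1 : ℕ) = (-1) ^ N := by
      have : (N : ℝ) + 1 ≠ 0 := by positivity
      push_cast
      field_simp
    rw [logPoly_succ, derivative_add, mul_add, ih, derivative_C_mul, derivative_X_pow, ← mul_assoc,
      ← mul_assoc]
    simp only [Nat.add_sub_cancel]
    rw [mul_assoc (1 + X), ← C_mul, h, neg_pow (X : ℝ[X]) N, neg_pow (X : ℝ[X]) (N + 1)]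
    simp only [map_pow, map_neg, map_one]
    ring

theorem coeff_zero_expPoly (N : ℕ) : (expPoly N).coeff 0 = 1 := by
  simp [expPoly, coeff_X_pow]

theorem coeff_zero_logPoly (N : ℕ) : (logPoly N).coeff 0 = 0 := by
  simp [logPoly, coeff_X_pow]

theorem X_pow_succ_dvd_of_derivative {p : ℝ[X]} {n : ℕ} (h0 : p.coeff 0 = 0)
    (h : X ^ n ∣ derivative p) : X ^ (n + 1) ∣ p := by
  rw [X_pow_dvd_iff] at h ⊢
  intro d hd
  cases d with
  | zero => exact h0
  | succ d =>
    have := h d (by omega)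
    rw [coeff_derivative] at this
    have h2 : (d : ℝ) + 1 ≠ 0 := by positivity
    simpa [h2] using this

theorem X_pow_dvd_of_dvd_mul {p q : ℝ[X]} {n : ℕ} (hq : q.coeff 0 ≠ 0) (h : X ^ n ∣ q * p) :
    X ^ n ∣ p := by
  have : IsCoprime (X ^ n) q := by
    refine IsCoprime.pow_left ((irreducible_X.coprime_iff_not_dvd).2 ?_)
    rwa [X_dvd_iff]
  exact this.dvd_of_dvd_mul_left h

theorem X_dvd_expPoly_sub_one (N : ℕ) : X ∣ expPoly N - 1 := by
  rw [X_dvd_iff, coeff_sub, coeff_zero_expPoly]; simp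

theorem X_dvd_logPoly (N : ℕ) : X ∣ logPoly N := by
  rw [X_dvd_iff, coeff_zero_logPoly]

theorem comp_coeff_zero {p q : ℝ[X]} (hq : X ∣ q) : (p.comp q).coeff 0 = p.coeff 0 := by
  rw [coeff_zero_eq_eval_zero, eval_comp, ← coeff_zero_eq_eval_zero q, X_dvd_iff.1 hq,
    ← coeff_zero_eq_eval_zero]

/-- Differentiate. With `E` the truncation of `exp X - 1`, both `E' = 1 + E` and `(1 + E) log'(1 +
E) = 1` hold up to high powers of `X`. Hence `1 + E` times the derivative of the difference is
divisible by a power of `X`, and `1 + E` is coprime to `X`. -/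
theorem logPoly_comp_expPoly (N : ℕ) :
    X ^ (N + 1) ∣ (logPoly N).comp (expPoly N - 1) - X := by
  cases N with
  | zero => simp [logPoly]
  | succ N =>
  set E := expPoly (N + 1) - 1 with hE
  have hE0 : X ∣ E := X_dvd_expPoly_sub_one _
  have hE' : derivative E = 1 + E - C (((N + 1).factorial : ℝ)⁻¹) * X ^ (N + 1) := by
    rw [hE, derivative_sub, derivative_expPoly_succ, derivative_one, expPoly_succ]; ring
  refine X_pow_succ_dvd_of_derivative ?_ ?_
  · rw [coeff_sub, comp_coeff_zero hE0, coeff_zero_logPoly]; simp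
  · refine X_pow_dvd_of_dvd_mul (q := 1 + E) ?_ ?_
    · simp [X_dvd_iff.1 hE0]
    · have h1 : (1 + E) * (derivative (logPoly (N + 1))).comp E = 1 - (-E) ^ (N + 1) := by
        have := congrArg (fun p => p.comp E) (one_add_X_mul_derivative_logPoly (N + 1))
        simpa using this
      have h2 : (1 + E) * derivative ((logPoly (N + 1)).comp E - X) =
          - ((-E) ^ (N + 1) * derivative E) - C (((N + 1).factorial : ℝ)⁻¹) * X ^ (N + 1) := by
        rw [derivative_sub, derivative_comp, derivative_X]
        linear_combination derivative E * h1 + hE'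
      rw [h2]
      refine dvd_sub ?_ (dvd_mul_left _ _)
      refine (Dvd.dvd.mul_right ?_ _).neg_right
      exact pow_dvd_pow_of_dvd hE0.neg_right _

/-- The equation `(1 + X) h' = h` with `h(0) = 0` has only the zero solution: each power of `X`
dividing `h` divides `h'` too, and integration gains one more. -/
theorem X_pow_succ_dvd_of_ode {h : ℝ[X]} {N : ℕ} (h0 : h.coeff 0 = 0)
    (hd : X ^ N ∣ (1 + X) * derivative h - h) : X ^ (N + 1) ∣ h := by
  have key : ∀ j ≤ N, X ^ (j + 1) ∣ h := by
    intro j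
    induction j with
    | zero => intro _; simpa [X_dvd_iff] using h0
    | succ j ih =>
      intro hj
      refine X_pow_succ_dvd_of_derivative h0 (X_pow_dvd_of_dvd_mul (q := 1 + X) (by simp) ?_)
      have := dvd_add ((pow_dvd_pow X hj).trans hd) (ih (by omega))
      simpa using this
  exact key N le_rfl

/-- Up to truncation errors, `exp (log (1 + X))` and `1 + X` solve the same equation `(1 + X) h' =
h` with the same initial value. -/
theorem expPoly_comp_logPoly (N : ℕ) :
    X ^ (N + 1) ∣ (expPoly N).comp (logPoly N) - (1 + X) := by
  cases N with
  | zero => simp [logPoly, expPoly]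
  | succ N =>
  set L := logPoly (N + 1) with hL
  have hL0 : X ∣ L := X_dvd_logPoly _
  refine X_pow_succ_dvd_of_ode ?_ ?_
  · rw [coeff_sub, comp_coeff_zero hL0, coeff_zero_expPoly]; simp
  · have h1 : (expPoly (N + 1)).comp L =
        (expPoly N).comp L + C (((N + 1).factorial : ℝ)⁻¹) * L ^ (N + 1) := by
      rw [expPoly_succ]; simp
    have h2 : (1 + X) * derivative ((expPoly (N + 1)).comp L - (1 + X)) -
        ((expPoly (N + 1)).comp L - (1 + X)) =
        - (-X) ^ (N + 1) * (expPoly N).comp L - C (((N + 1).factorial : ℝ)⁻¹) * L ^ (N + 1) := by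
      rw [derivative_sub, derivative_comp, derivative_expPoly_succ, derivative_add, derivative_X,
        derivative_one]
      linear_combination (expPoly N).comp L * one_add_X_mul_derivative_logPoly (N + 1) - h1
    rw [h2]
    refine dvd_sub (Dvd.dvd.mul_right ?_ _) (Dvd.dvd.mul_left (pow_dvd_pow_of_dvd hL0 _) _)
    exact (pow_dvd_pow_of_dvd (dvd_refl (X : ℝ[X])).neg_right _).neg_right

/-- One factor `X` is cancelled from `log (exp X) = X`. Evaluated at `ad Z`, this inverts the
operator `(e^(ad Z) - 1) / ad Z` that occurs in the derivative of `e^Z`. -/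
theorem logQuotPoly_comp_mul_expQuotPoly (N : ℕ) :
    X ^ (N + 1) ∣ (logQuotPoly N).comp (expPoly (N + 1) - 1) * expQuotPoly N - 1 := by
  have h := logPoly_comp_expPoly (N + 1)
  rw [← X_mul_logQuotPoly, mul_comp, X_comp, pow_succ'] at h
  have h2 : (expPoly (N + 1) - 1) * (logQuotPoly N).comp (expPoly (N + 1) - 1) - X =
      X * ((logQuotPoly N).comp (expPoly (N + 1) - 1) * expQuotPoly N - 1) := by
    linear_combination -(logQuotPoly N).comp (expPoly (N + 1) - 1) * X_mul_expQuotPoly N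
  rw [h2] at h
  exact (mul_dvd_mul_iff_left X_ne_zero).1 h

theorem aeval_eq_of_dvd_sub {A : Type*} [Ring A] [Algebra ℝ A] {a : A} {n : ℕ} (ha : a ^ n = 0)
    {p q : ℝ[X]} (h : X ^ n ∣ p - q) : aeval a p = aeval a q := by
  obtain ⟨r, hr⟩ := h
  rw [← sub_eq_zero, ← map_sub, hr]
  simp [ha]

end TruncatedSeries

end

/-! ### Exponentials of nilpotent elements and the Baker-Campbell-Hausdorff derivative -/

noncomputable section

namespace TruncatedSeries

open Polynomial

section Ring

variable {A : Type*} [Ring A] [Algebra ℝ A]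

theorem aeval_expPoly (a : A) (N : ℕ) :
    aeval a (expPoly N) = ∑ j ∈ Finset.range (N + 1), ((j.factorial : ℝ)⁻¹) • a ^ j := by
  simp [expPoly, Algebra.smul_def]

theorem aeval_expQuotPoly (a : A) (N : ℕ) :
    aeval a (expQuotPoly N) =
      ∑ j ∈ Finset.range (N + 1), (((j + 1).factorial : ℝ)⁻¹) • a ^ j := by
  simp [expQuotPoly, Algebra.smul_def]

theorem aeval_expPoly_congr {a : A} {n N M : ℕ} (ha : a ^ n = 0) (hN : n ≤ N + 1)
    (hM : n ≤ M + 1) : aeval a (expPoly N) = aeval a (expPoly M) := by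
  have key : ∀ N, n ≤ N + 1 →
      aeval a (expPoly N) = ∑ j ∈ Finset.range n, ((j.factorial : ℝ)⁻¹) • a ^ j := by
    intro N hN
    rw [aeval_expPoly]
    refine (Finset.sum_subset (Finset.range_mono hN) fun j _ hj => ?_).symm
    rw [pow_eq_zero_of_le (by simpa using hj) ha, smul_zero]
  rw [key N hN, key M hM]

/-- The triangular sum misses only pairs with `i + j ≥ N`, and for those `i ≥ a` or `j ≥ b`. -/
theorem sum_antidiagonal_eq_mul {A : Type*} [Ring A] {f g : ℕ → A} {a b N : ℕ} (hf : ∀ i, a ≤ i → f i = 0)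
    (hg : ∀ j, b ≤ j → g j = 0) (h : a + b ≤ N + 1) :
    ∑ n ∈ Finset.range N, ∑ ij ∈ Finset.HasAntidiagonal.antidiagonal n, f ij.1 * g ij.2 =
      (∑ i ∈ Finset.range N, f i) * ∑ j ∈ Finset.range N, g j := by
  rw [Finset.sum_mul_sum, ← Finset.sum_product', Finset.sum_sigma']
  have h1 : ∑ ij ∈ Finset.range N ×ˢ Finset.range N, f ij.1 * g ij.2 =
      ∑ ij ∈ (Finset.range N ×ˢ Finset.range N).filter (fun ij => ij.1 + ij.2 < N),
        f ij.1 * g ij.2 := by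
    refine (Finset.sum_subset (Finset.filter_subset _ _) fun ij hij hn => ?_).symm
    simp only [Finset.mem_filter, hij, true_and, not_lt] at hn
    rcases le_or_gt a ij.1 with h3 | h3
    · rw [hf _ h3, zero_mul]
    · rw [hg _ (by omega), mul_zero]
  rw [h1]
  refine Finset.sum_bij' (fun s _ => s.2) (fun ij _ => ⟨ij.1 + ij.2, ij⟩) ?_ ?_ ?_ ?_ ?_
  · rintro ⟨n, i, j⟩ h
    simp only [Finset.mem_sigma, Finset.mem_range, Finset.HasAntidiagonal.mem_antidiagonal] at h
    simp only [Finset.mem_filter, Finset.mem_product, Finset.mem_range]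
    omega
  · rintro ⟨i, j⟩ h
    simp only [Finset.mem_filter, Finset.mem_product, Finset.mem_range] at h
    simp [h.2]
  · rintro ⟨n, i, j⟩ h
    simp only [Finset.mem_sigma, Finset.mem_range, Finset.HasAntidiagonal.mem_antidiagonal] at h
    obtain ⟨_, rfl⟩ := h
    rfl
  · rintro ⟨i, j⟩ _
    rfl
  · rintro ⟨n, i, j⟩ _
    rfl

/-- The commutator `M ↦ Z M - M Z`. -/
def adOp (Z : A) : Module.End ℝ A := LinearMap.mulLeft ℝ Z - LinearMap.mulRight ℝ Z

theorem adOp_apply (Z M : A) : adOp Z M = Z * M - M * Z := rfl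

theorem adOp_smul (t : ℝ) (Z : A) : adOp (t • Z) = t • adOp Z := by
  ext M
  simp [adOp_apply, smul_sub]

theorem adOp_pow_eq_zero {Z : A} {n : ℕ} (hZ : Z ^ n = 0) : adOp Z ^ (2 * n) = 0 := by
  rw [adOp, sub_eq_add_neg]
  refine Commute.add_pow_eq_zero_of_add_le_succ_of_pow_eq_zero (m := n) (n := n)
    (k := 2 * n) (LinearMap.commute_mulLeft_right (R := ℝ) Z Z).neg_right ?_ ?_ (by omega)
  · rw [LinearMap.pow_mulLeft, hZ, LinearMap.mulLeft_zero_eq_zero]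
  · rw [neg_pow (LinearMap.mulRight ℝ Z), LinearMap.pow_mulRight, hZ, LinearMap.mulRight_zero_eq_zero, mul_zero]

theorem mul_adOp_pow (Z M : A) (i : ℕ) :
    Z * (adOp Z ^ i) M = (adOp Z ^ (i + 1)) M + (adOp Z ^ i) M * Z := by
  rw [pow_succ', Module.End.mul_apply, adOp_apply, sub_add_cancel]

theorem mul_smul_adOp_pow (Z M : A) (i j : ℕ) (c d : ℝ) :
    Z * ((c • (adOp Z ^ i) M) * (d • Z ^ j)) =
      (c • (adOp Z ^ (i + 1)) M) * (d • Z ^ j) + (c • (adOp Z ^ i) M) * (d • Z ^ (j + 1)) := by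
  rw [← mul_assoc, mul_smul_comm c Z, mul_adOp_pow, smul_add, add_mul, pow_succ' Z j]
  simp only [smul_mul_assoc, mul_smul_comm, mul_assoc]

theorem inv_factorial_smul {E : Type*} [AddCommGroup E] [Module ℝ E] (n : ℕ) (v : E) :
    ((n.factorial : ℝ)⁻¹) • v = ((n : ℝ) + 1) • (((n + 1).factorial : ℝ)⁻¹) • v := by
  rw [smul_smul, Nat.factorial_succ]
  congr 1
  have : (n : ℝ) + 1 ≠ 0 := by positivity
  push_cast
  field_simp

theorem smul_cancel_succ {E : Type*} [AddCommGroup E] [Module ℝ E] {n : ℕ} {v w : E}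
    (h : ((n : ℝ) + 1) • v = ((n : ℝ) + 1) • w) : v = w :=
  smul_right_injective E (by positivity : (n : ℝ) + 1 ≠ 0) h

/-- Weighted Pascal identity for sums over antidiagonals. -/
theorem sum_antidiagonal_weight {E : Type*} [AddCommGroup E] [Module ℝ E] (F : ℕ → ℕ → E) (n : ℕ) :
    ∑ ij ∈ Finset.HasAntidiagonal.antidiagonal n,
      (((ij.1 : ℝ) + 1) • F (ij.1 + 1) ij.2 + ((ij.2 : ℝ) + 1) • F ij.1 (ij.2 + 1)) =
    ((n : ℝ) + 1) • ∑ ij ∈ Finset.HasAntidiagonal.antidiagonal (n + 1), F ij.1 ij.2 := by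
  have h1 : ∑ ij ∈ Finset.HasAntidiagonal.antidiagonal (n + 1), (ij.1 : ℝ) • F ij.1 ij.2 =
      ∑ ij ∈ Finset.HasAntidiagonal.antidiagonal n, ((ij.1 : ℝ) + 1) • F (ij.1 + 1) ij.2 := by
    rw [Finset.Nat.sum_antidiagonal_succ]
    simp
  have h2 : ∑ ij ∈ Finset.HasAntidiagonal.antidiagonal (n + 1), (ij.2 : ℝ) • F ij.1 ij.2 =
      ∑ ij ∈ Finset.HasAntidiagonal.antidiagonal n, ((ij.2 : ℝ) + 1) • F ij.1 (ij.2 + 1) := by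
    rw [Finset.Nat.sum_antidiagonal_succ']
    simp
  rw [Finset.sum_add_distrib, ← h1, ← h2, ← Finset.sum_add_distrib, Finset.smul_sum]
  refine Finset.sum_congr rfl fun ij hij => ?_
  rw [← add_smul]
  congr 1
  exact_mod_cast Finset.HasAntidiagonal.mem_antidiagonal.1 hij

/-- Left multiplication by `Z` is the sum of the commuting operators `ad Z` and right multiplication
by `Z`; this is the binomial theorem for that sum, in divided powers. -/
theorem divPow_mul (Z M : A) (n : ℕ) :
    ((n.factorial : ℝ)⁻¹) • (Z ^ n * M) = ∑ ij ∈ Finset.HasAntidiagonal.antidiagonal n,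
      (((ij.1.factorial : ℝ)⁻¹) • (adOp Z ^ ij.1) M) * (((ij.2.factorial : ℝ)⁻¹) • Z ^ ij.2) := by
  induction n with
  | zero => simp
  | succ n ih =>
    refine smul_cancel_succ (n := n) ?_
    rw [← inv_factorial_smul, pow_succ', mul_assoc, ← mul_smul_comm, ih,
      ← sum_antidiagonal_weight (fun i j => (((i.factorial : ℝ)⁻¹) • (adOp Z ^ i) M) *
        (((j.factorial : ℝ)⁻¹) • Z ^ j)), Finset.mul_sum]
    refine Finset.sum_congr rfl fun ij _ => ?_
    obtain ⟨i, j⟩ := ij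
    simp only
    rw [mul_smul_adOp_pow, inv_factorial_smul i ((adOp Z ^ (i + 1)) M),
      inv_factorial_smul j (Z ^ (j + 1)), smul_mul_assoc ((i : ℝ) + 1), mul_smul_comm ((j : ℝ) + 1)]

/-- This is `e^Z M e^(-Z) = e^(ad Z) M` without the inverse. The bound `3 n` makes the truncated
Cauchy product exact, since `(ad Z)^(2n) = 0` and `Z^n = 0`. -/
theorem exp_mul {Z : A} {n N : ℕ} (hZ : Z ^ n = 0) (hN : 3 * n ≤ N) (M : A) :
    aeval Z (expPoly N) * M = (aeval (adOp Z) (expPoly N)) M * aeval Z (expPoly N) := by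
  have h := sum_antidiagonal_eq_mul (N := N + 1) (a := 2 * n) (b := n)
    (f := fun i => ((i.factorial : ℝ)⁻¹) • (adOp Z ^ i) M)
    (g := fun j => ((j.factorial : ℝ)⁻¹) • Z ^ j) ?_ ?_ (by omega)
  · rw [aeval_expPoly, aeval_expPoly, LinearMap.sum_apply]
    simp only [LinearMap.smul_apply]
    rw [← h, Finset.sum_mul]
    refine Finset.sum_congr rfl fun i _ => ?_
    rw [smul_mul_assoc, divPow_mul]
  · intro i hi
    simp [pow_eq_zero_of_le hi (adOp_pow_eq_zero hZ)]
  · intro i hi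
    simp [pow_eq_zero_of_le hi hZ]

end Ring

section Normed

variable {A : Type*} [NormedRing A] [NormedAlgebra ℝ A]

/-- Product rule for `Z · Z^(n+1)`, with the factors `Z` to the left of `W` commuted past it, which
turns them into powers of `ad Z` acting on `W`. -/
theorem hasDerivAt_divPow {Z : ℝ → A} {W : A} {t : ℝ} (h : HasDerivAt Z W t) (n : ℕ) :
    HasDerivAt (fun s => (((n + 1).factorial : ℝ)⁻¹) • Z s ^ (n + 1))
      (∑ ij ∈ Finset.HasAntidiagonal.antidiagonal n,
        ((((ij.1 + 1).factorial : ℝ)⁻¹) • (adOp (Z t) ^ ij.1) W) * (((ij.2.factorial : ℝ)⁻¹) • Z t ^ ij.2)) t := by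
  induction n with
  | zero => simpa using h
  | succ n ih =>
    have h2 := (h.mul ih).const_smul (((n : ℝ) + 1 + 1)⁻¹)
    have hne : (n : ℝ) + 1 + 1 ≠ 0 := by positivity
    convert! h2 using 1
    · ext s
      change _ = ((n : ℝ) + 1 + 1)⁻¹ • (Z s * ((((n + 1).factorial : ℝ)⁻¹) • Z s ^ (n + 1)))
      rw [mul_smul_comm, ← pow_succ', smul_smul, Nat.factorial_succ (n + 1)]
      push_cast
      rw [mul_inv]
    · refine smul_right_injective A hne ?_
      beta_reduce
      rw [smul_inv_smul₀ hne]
      have key := sum_antidiagonal_weight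
        (fun i j => ((((i + 1).factorial : ℝ)⁻¹) • (adOp (Z t) ^ i) W) *
        (((j.factorial : ℝ)⁻¹) • Z t ^ j)) n
      rw [add_smul, one_smul, ← key, Finset.Nat.sum_antidiagonal_succ, add_left_comm,
        ← Finset.sum_add_distrib, Finset.mul_sum]
      congr 1
      · simp
      · refine Finset.sum_congr rfl fun ij _ => ?_
        obtain ⟨i, j⟩ := ij
        have h3 : (((i + 1).factorial : ℝ)⁻¹) • (adOp (Z t) ^ (i + 1)) W =
            ((i : ℝ) + 1 + 1) • (((i + 1 + 1).factorial : ℝ)⁻¹) • (adOp (Z t) ^ (i + 1)) W := by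
          exact_mod_cast inv_factorial_smul (i + 1) ((adOp (Z t) ^ (i + 1)) W)
        simp only
        rw [mul_smul_adOp_pow, h3, inv_factorial_smul j (Z t ^ (j + 1)),
          smul_mul_assoc ((i : ℝ) + 1 + 1), mul_smul_comm ((j : ℝ) + 1), add_smul _ (1 : ℝ), one_smul]
        module

/-- Summing the divided powers gives a Cauchy product: the derivative of `e^Z` is `((e^(ad Z) - 1) /
ad Z) W · e^Z`. -/
theorem hasDerivAt_exp {Z : ℝ → A} {W : A} {t : ℝ} {n N : ℕ} (h : HasDerivAt Z W t)
    (hZ : Z t ^ n = 0) (hN : 3 * n ≤ N) :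
    HasDerivAt (fun s => aeval (Z s) (expPoly (N + 1)))
      ((aeval (adOp (Z t)) (expQuotPoly N)) W * aeval (Z t) (expPoly N)) t := by
  have h1 : (fun s => aeval (Z s) (expPoly (N + 1))) = fun s =>
      ∑ j ∈ Finset.range (N + 1), (((j + 1).factorial : ℝ)⁻¹) • Z s ^ (j + 1) + 1 := by
    ext s
    rw [aeval_expPoly, Finset.sum_range_succ']
    simp
  have h2 : (aeval (adOp (Z t)) (expQuotPoly N)) W * aeval (Z t) (expPoly N) =
      ∑ j ∈ Finset.range (N + 1), ∑ ij ∈ Finset.HasAntidiagonal.antidiagonal j,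
        ((((ij.1 + 1).factorial : ℝ)⁻¹) • (adOp (Z t) ^ ij.1) W) *
          (((ij.2.factorial : ℝ)⁻¹) • Z t ^ ij.2) := by
    rw [sum_antidiagonal_eq_mul (N := N + 1) (a := 2 * n) (b := n)
      (f := fun i => (((i + 1).factorial : ℝ)⁻¹) • (adOp (Z t) ^ i) W)
      (g := fun j => ((j.factorial : ℝ)⁻¹) • Z t ^ j) ?_ ?_ (by omega), aeval_expPoly,
      aeval_expQuotPoly, LinearMap.sum_apply]
    · rfl
    · intro i hi
      simp [pow_eq_zero_of_le hi (adOp_pow_eq_zero hZ)]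
    · intro i hi
      simp [pow_eq_zero_of_le hi hZ]
  rw [h1, h2]
  exact (HasDerivAt.fun_sum fun j _ => hasDerivAt_divPow h j).add_const 1

theorem hasDerivAt_exp_smul {Y : A} {n N : ℕ} (hY : Y ^ n = 0) (hN : n ≤ N) (t : ℝ) :
    HasDerivAt (fun s : ℝ => aeval (s • Y) (expPoly N)) (aeval (t • Y) (expPoly N) * Y) t := by
  obtain _ | N := N
  · obtain rfl : n = 0 := by omega
    have : Subsingleton A := subsingleton_of_zero_eq_one (by simpa using hY.symm)
    rw [Subsingleton.elim (aeval (t • Y) (expPoly 0) * Y) 0]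
    exact (hasDerivAt_const t (0 : A)).congr_of_eventuallyEq
      (.of_forall fun _ => Subsingleton.elim _ _)
  have h1 : (fun s : ℝ => aeval (s • Y) (expPoly (N + 1))) = fun s =>
      ∑ j ∈ Finset.range (N + 1), s ^ (j + 1) • (((j + 1).factorial : ℝ)⁻¹) • Y ^ (j + 1) + 1 := by
    ext s
    rw [aeval_expPoly, Finset.sum_range_succ']
    simp only [_root_.smul_pow, smul_comm (s ^ _)]
    simp
  have h3 : aeval (t • Y) (expPoly (N + 1)) = aeval (t • Y) (expPoly N) :=
    aeval_expPoly_congr (n := n) (by rw [_root_.smul_pow, hY, smul_zero]) (by omega) (by omega)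
  have h2 : aeval (t • Y) (expPoly N) * Y = ∑ j ∈ Finset.range (N + 1),
      (((j + 1 : ℕ) : ℝ) * t ^ j) • (((j + 1).factorial : ℝ)⁻¹) • Y ^ (j + 1) := by
    rw [aeval_expPoly, Finset.sum_mul]
    refine Finset.sum_congr rfl fun j _ => ?_
    rw [inv_factorial_smul, _root_.smul_pow, smul_mul_assoc, smul_mul_assoc, smul_mul_assoc, ← pow_succ,
      mul_smul, smul_comm (t ^ j)]
    push_cast
    rfl
  rw [h1, h3, h2]
  refine (HasDerivAt.fun_sum fun j _ => ?_).add_const 1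
  simpa using (hasDerivAt_pow (j + 1) t).smul_const
    ((((j + 1).factorial : ℝ)⁻¹) • Y ^ (j + 1))

end Normed

section Nilpotent

variable {A : Type*} [Ring A] [Algebra ℝ A] {J : NonUnitalSubalgebra ℝ A}

theorem aeval_mem {a : A} (ha : a ∈ J) {p : ℝ[X]} (hp : p.coeff 0 = 0) : aeval a p ∈ J := by
  rw [aeval_eq_sum_range]
  refine sum_mem fun i hi' => ?_
  clear hi'
  rcases Nat.eq_zero_or_pos i with rfl | hi
  · simp [hp]
  · refine J.toSubmodule.smul_mem _ ?_
    change a ^ i ∈ J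
    obtain ⟨j, rfl⟩ : ∃ j, i = j + 1 := ⟨i - 1, by omega⟩
    clear hi
    induction j with
    | zero => simpa using ha
    | succ j ih => rw [pow_succ]; exact mul_mem ih ha

theorem exp_sub_one_mem {a : A} (ha : a ∈ J) (N : ℕ) : aeval a (expPoly N) - 1 ∈ J := by
  have := aeval_mem ha (p := expPoly N - 1) (by simp [coeff_zero_expPoly])
  simpa using this

theorem log_mem {a : A} (ha : a ∈ J) (N : ℕ) : aeval a (logPoly N) ∈ J :=
  aeval_mem ha (coeff_zero_logPoly N)

theorem log_exp {a : A} {n N : ℕ} (ha : a ^ n = 0) (hN : n ≤ N + 1) :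
    aeval (aeval a (expPoly N) - 1) (logPoly N) = a := by
  have := aeval_eq_of_dvd_sub ha ((pow_dvd_pow X hN).trans (logPoly_comp_expPoly N))
  simpa [aeval_comp] using this

theorem exp_log {a : A} {n N : ℕ} (ha : a ^ n = 0) (hN : n ≤ N + 1) :
    aeval (aeval a (logPoly N)) (expPoly N) = 1 + a := by
  have := aeval_eq_of_dvd_sub ha ((pow_dvd_pow X hN).trans (expPoly_comp_logPoly N))
  simpa [aeval_comp] using this

theorem mul_sub_one_mem {u v : A} (hu : u - 1 ∈ J) (hv : v - 1 ∈ J) : u * v - 1 ∈ J := by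
  have : u * v - 1 = (u - 1) * (v - 1) + (u - 1) + (v - 1) := by noncomm_ring
  rw [this]
  exact add_mem (add_mem (mul_mem hu hv) hu) hv

end Nilpotent

section BCH

variable {A : Type*} [NormedRing A] [NormedAlgebra ℝ A] {J : NonUnitalSubalgebra ℝ A}

/-- The derivative of `t ↦ log (e^X e^{tY})` for `X` and `Y` in a nilpotent algebra. -/
theorem hasDerivAt_log_exp_mul_exp {K N : ℕ} (hJ : ∀ a ∈ J, a ^ K = 0) (hN : 3 * K ≤ N) {x y : A}
    (hx : x ∈ J) (hy : y ∈ J) (t : ℝ) :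
    HasDerivAt (fun s : ℝ =>
        aeval (aeval x (expPoly N) * aeval (s • y) (expPoly N) - 1) (logPoly N))
      ((aeval (aeval (adOp x) (expPoly N) * aeval (t • adOp y) (expPoly N) - 1) (bchPoly N)) y)
      t := by
  set U : ℝ → A := fun s => aeval x (expPoly N) * aeval (s • y) (expPoly N) with hU
  set Z : ℝ → A := fun s => aeval (U s - 1) (logPoly N) with hZ
  have hUJ : ∀ s, U s - 1 ∈ J := fun s =>
    mul_sub_one_mem (exp_sub_one_mem hx N) (exp_sub_one_mem (J.toSubmodule.smul_mem s hy) N)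
  have hZJ : ∀ s, Z s ∈ J := fun s => log_mem (hUJ s) N
  have hU' : HasDerivAt U (U t * y) t := by
    have := (hasDerivAt_exp_smul (hJ y hy) (by omega : K ≤ N) t).const_mul (aeval x (expPoly N))
    simpa only [hU, mul_assoc] using this
  -- `Z` is a polynomial in `U`, hence differentiable. Its derivative `W` is found by
  -- differentiating `e^Z = U`.
  obtain ⟨W, hW⟩ : ∃ W, HasDerivAt Z W t := by
    have : DifferentiableAt ℝ Z t := by
      simp only [hZ, logPoly, map_sum, map_mul, aeval_C, map_pow, aeval_X]
      refine DifferentiableAt.fun_sum fun i _ => ?_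
      exact (((hU'.differentiableAt.sub_const 1).pow _).const_mul _)
    exact ⟨_, this.hasDerivAt⟩
  have hexp : ∀ s, aeval (Z s) (expPoly N) = U s := fun s => by
    rw [hZ]
    simp only
    rw [exp_log (hJ _ (hUJ s)) (by omega)]
    abel
  have hexp' : ∀ s, aeval (Z s) (expPoly (N + 1)) = U s := fun s => by
    rw [← hexp, aeval_expPoly_congr (M := N) (hJ _ (hZJ s)) (by omega) (by omega)]
  have hunit : IsUnit (U t) := by
    have := (show IsNilpotent (U t - 1) from ⟨K, hJ _ (hUJ t)⟩).isUnit_one_add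
    simpa using this
  set T := aeval (adOp x) (expPoly N) * aeval (t • adOp y) (expPoly N) with hT
  have hUM : ∀ M, U t * M = T M * U t := fun M => by
    rw [hU, hT]
    simp only
    rw [mul_assoc, exp_mul (n := K) (hJ _ (J.toSubmodule.smul_mem t hy)) hN, ← mul_assoc, exp_mul (hJ _ hx) hN,
      adOp_smul, mul_assoc]
    rfl
  -- Both operators are conjugation by `U t = e^(Z t)`, and `U t` can be cancelled because it is a
  -- unit.
  have hTexp : aeval (adOp (Z t)) (expPoly N) = T := by
    ext M
    have h1 := exp_mul (hJ _ (hZJ t)) hN M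
    rw [hexp, hUM] at h1
    exact (hunit.mul_right_cancel h1).symm
  have hnil := adOp_pow_eq_zero (hJ _ (hZJ t))
  -- Compare two derivatives of `U`: one through `e^Z`, the other equal to `U y = (T y) U`.
  have hkap : (aeval (adOp (Z t)) (expQuotPoly N)) W = T y := by
    have h1 := hasDerivAt_exp hW (hJ _ (hZJ t)) hN
    simp only [hexp', hexp] at h1
    have h2 := h1.unique hU'
    rw [hUM] at h2
    exact hunit.mul_right_cancel h2
  have hlam : aeval (T - 1) (logQuotPoly N) * aeval (adOp (Z t)) (expQuotPoly N) = 1 := by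
    have h1 := aeval_eq_of_dvd_sub hnil ((pow_dvd_pow X (by omega)).trans
      (logQuotPoly_comp_mul_expQuotPoly N))
    rw [map_mul, aeval_comp, map_sub, map_one,
      aeval_expPoly_congr hnil (by omega : 2 * K ≤ N + 1 + 1) (by omega : 2 * K ≤ N + 1),
      hTexp] at h1
    exact h1
  -- `T - 1 = e^(ad Z) - 1` is a multiple of the nilpotent `ad Z` by a commuting factor.
  have hTnil : (T - 1) ^ (N + 1) = 0 := by
    obtain ⟨q, hq⟩ := X_dvd_expPoly_sub_one N
    have h1 : T - 1 = adOp (Z t) * aeval (adOp (Z t)) q := by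
      have := congrArg (aeval (adOp (Z t))) hq
      rwa [map_sub, map_one, hTexp, map_mul, aeval_X] at this
    have hcomm : Commute (adOp (Z t)) (aeval (adOp (Z t)) q) := by
      have := (Polynomial.aeval (adOp (Z t))).map_mul X q
      rw [Commute, SemiconjBy]
      nth_rewrite 1 [← aeval_X (R := ℝ) (adOp (Z t))]
      nth_rewrite 4 [← aeval_X (R := ℝ) (adOp (Z t))]
      rw [← map_mul, ← map_mul, mul_comm]
    rw [h1, hcomm.mul_pow, pow_eq_zero_of_le (by omega) hnil, zero_mul]
  have hbch : aeval (T - 1) (bchPoly N) = aeval (T - 1) (logQuotPoly N) * T := by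
    rw [bchPoly_eq, mul_comm (1 + X)]
    simp [hTnil]
  convert hW using 1
  rw [hbch, Module.End.mul_apply, ← hkap, ← Module.End.mul_apply, hlam, Module.End.one_apply]

end BCH

end TruncatedSeries

end

/-! ### Grading, derivations and filtration of the Lie algebra -/

noncomputable section

/-- The operators that raise the degree of a decreasing filtration by at least one. -/
def raisingOperators {V : Type*} [AddCommGroup V] [Module ℝ V] (F : ℕ → Submodule ℝ V)
    (hF : Antitone F) : NonUnitalSubalgebra ℝ (Module.End ℝ V) where
  carrier := {a | ∀ j, ∀ v ∈ F j, a v ∈ F (j + 1)}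
  add_mem' ha hb j v hv := (F (j + 1)).add_mem (ha j v hv) (hb j v hv)
  zero_mem' j _ _ := (F (j + 1)).zero_mem
  mul_mem' ha hb j v hv := hF (Nat.le_succ (j + 1)) (ha (j + 1) _ (hb j v hv))
  smul_mem' c _ ha j v hv := (F (j + 1)).smul_mem c (ha j v hv)

theorem raisingOperators_pow_eq_zero {V : Type*} [AddCommGroup V] [Module ℝ V]
    {F : ℕ → Submodule ℝ V} {hF : Antitone F} {n : ℕ} (h0 : F 0 = ⊤) (hn : F n = ⊥)
    {a : Module.End ℝ V} (ha : a ∈ raisingOperators F hF) : a ^ n = 0 := by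
  have key : ∀ j v, (a ^ j) v ∈ F j := by
    intro j
    induction j with
    | zero => intro v; rw [h0]; trivial
    | succ j ih => intro v; rw [pow_succ', Module.End.mul_apply]; exact ha j _ (ih v)
  ext v
  have := key n v
  rw [hn] at this
  simpa using this

theorem comp_aeval_of_comp_eq {V W : Type*} [AddCommGroup V] [Module ℝ V] [AddCommGroup W]
    [Module ℝ W] {f : V →ₗ[ℝ] W} {a : Module.End ℝ V} {b : Module.End ℝ W}
    (h : ∀ v, f (a v) = b (f v)) (p : Polynomial ℝ) (v : V) :
    f (Polynomial.aeval a p v) = Polynomial.aeval b p (f v) := by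
  have hpow : ∀ n v, f ((a ^ n) v) = (b ^ n) (f v) := by
    intro n
    induction n with
    | zero => intro v; simp
    | succ n ih => intro v; rw [pow_succ, pow_succ, Module.End.mul_apply, ih, h]; rfl
  rw [Polynomial.aeval_eq_sum_range, Polynomial.aeval_eq_sum_range, LinearMap.sum_apply,
    LinearMap.sum_apply, map_sum]
  refine Finset.sum_congr rfl fun n _ => ?_
  rw [LinearMap.smul_apply, LinearMap.smul_apply, map_smul, hpow]

namespace CarnotGroup

open TruncatedSeries Polynomial

variable {𝔤 : Type*} [LieRing 𝔤] [LieAlgebra ℝ 𝔤] {m k : ℕ} (G : CarnotGroup 𝔤 m k)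

theorem stratum_eq_bot {j : ℕ} (hj : k < j) : stratum G.basis G.σ j = ⊥ := by
  have : {i | G.σ i = j} = ∅ := by
    ext i
    have := G.σ_le i
    simp only [Set.mem_ofPred_eq, Set.mem_empty_iff_false, iff_false]
    omega
  rw [stratum, this]
  simp

theorem basis_mem_stratum (i : Fin m) : G.basis i ∈ stratum G.basis G.σ (G.σ i) :=
  Submodule.subset_span ⟨i, rfl, rfl⟩

theorem lie_mem_stratum_one {j : ℕ} (hj : 1 ≤ j) {x y : 𝔤} (hx : x ∈ stratum G.basis G.σ 1)
    (hy : y ∈ stratum G.basis G.σ j) : ⁅x, y⁆ ∈ stratum G.basis G.σ (j + 1) := by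
  have hmem : ⁅x, y⁆ ∈ bracketSpan (stratum G.basis G.σ 1) (stratum G.basis G.σ j) :=
    Submodule.subset_span ⟨x, hx, y, hy, rfl⟩
  rcases lt_trichotomy j k with h | rfl | h
  · rwa [G.bracket_stratum j hj h] at hmem
  · rw [G.bracket_stratum_last, Submodule.mem_bot] at hmem
    rw [hmem]
    exact Submodule.zero_mem _
  · rw [G.stratum_eq_bot h, Submodule.mem_bot] at hy
    rw [hy, lie_zero]
    exact Submodule.zero_mem _

/-- Induction on `i`: the stratum `i + 1` is spanned by brackets `[a, c]` with `a` horizontal, and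
`[[a, c], y] = [a, [c, y]] - [c, [a, y]]` by the Jacobi identity. -/
theorem lie_mem_stratum {i j : ℕ} (hi : 1 ≤ i) (hj : 1 ≤ j) {x y : 𝔤}
    (hx : x ∈ stratum G.basis G.σ i) (hy : y ∈ stratum G.basis G.σ j) :
    ⁅x, y⁆ ∈ stratum G.basis G.σ (i + j) := by
  induction i, hi using Nat.le_induction generalizing j x y with
  | base => rw [add_comm]; exact G.lie_mem_stratum_one hj hx hy
  | succ i hi ih =>
    rcases lt_or_ge i k with h | h
    · rw [← G.bracket_stratum i hi h, bracketSpan] at hx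
      induction hx using Submodule.span_induction with
      | mem z hz =>
        obtain ⟨a, ha, c, hc, rfl⟩ := hz
        rw [lie_lie]
        refine Submodule.sub_mem _ ?_ ?_
        · have := G.lie_mem_stratum_one (by omega) ha (ih hj hc hy)
          rwa [show i + 1 + j = i + j + 1 by omega]
        · have := ih (by omega) hc (G.lie_mem_stratum_one hj ha hy)
          rwa [show i + 1 + j = i + (j + 1) by omega]
      | zero => rw [zero_lie]; exact Submodule.zero_mem _
      | add a b _ _ ha hb => rw [add_lie]; exact Submodule.add_mem _ ha hb
      | smul c a _ ha => rw [smul_lie]; exact Submodule.smul_mem _ c ha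
    · rw [G.stratum_eq_bot (by omega), Submodule.mem_bot] at hx
      rw [hx, zero_lie]
      exact Submodule.zero_mem _

theorem repr_eq_zero_of_mem_stratum {j : ℕ} {x : 𝔤} (hx : x ∈ stratum G.basis G.σ j) {i : Fin m}
    (hi : G.σ i ≠ j) : G.basis.equivFun x i = 0 := by
  rw [stratum, G.basis.mem_span_image] at hx
  by_contra h
  exact hi (hx (by simpa using h))

/-- The endomorphism of the Lie algebra that is diagonal in the adapted basis. -/
def diag (c : Fin m → ℝ) : Module.End ℝ 𝔤 :=
  G.basis.equivFun.symm.toLinearMap ∘ₗ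
    (LinearMap.pi fun i => c i • LinearMap.proj i) ∘ₗ G.basis.equivFun.toLinearMap

theorem equivFun_diag (c : Fin m → ℝ) (x : 𝔤) (i : Fin m) :
    G.basis.equivFun (G.diag c x) i = c i * G.basis.equivFun x i := by
  simp only [diag, LinearMap.comp_apply, LinearEquiv.coe_coe, LinearEquiv.apply_symm_apply]
  rfl

theorem diag_of_mem_stratum {c : Fin m → ℝ} {r : ℝ} {j : ℕ} (hc : ∀ i, G.σ i = j → c i = r) {x : 𝔤}
    (hx : x ∈ stratum G.basis G.σ j) : G.diag c x = r • x := by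
  refine G.basis.equivFun.injective (funext fun i => ?_)
  rw [equivFun_diag, map_smul, Pi.smul_apply, smul_eq_mul]
  by_cases h : G.σ i = j
  · rw [hc i h]
  · rw [G.repr_eq_zero_of_mem_stratum hx h, mul_zero, mul_zero]

theorem lie_basis_mem (i j : Fin m) :
    ⁅G.basis i, G.basis j⁆ ∈ stratum G.basis G.σ (G.σ i + G.σ j) :=
  G.lie_mem_stratum (G.one_le_σ i) (G.one_le_σ j) (G.basis_mem_stratum i) (G.basis_mem_stratum j)

/-- The Euler derivation, which multiplies the stratum `j` by `j`. -/
def euler : Module.End ℝ 𝔤 := G.diag fun i => (G.σ i : ℝ)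

theorem euler_of_mem {j : ℕ} {x : 𝔤} (hx : x ∈ stratum G.basis G.σ j) :
    G.euler x = (j : ℝ) • x :=
  G.diag_of_mem_stratum (fun i hi => by rw [hi]) hx

/-- The dilation of the Lie algebra, which multiplies the stratum `j` by `t ^ j`. -/
def dilLie (t : ℝ) : Module.End ℝ 𝔤 := G.diag fun i => t ^ G.σ i

theorem dilLie_of_mem (t : ℝ) {j : ℕ} {x : 𝔤} (hx : x ∈ stratum G.basis G.σ j) :
    G.dilLie t x = t ^ j • x :=
  G.diag_of_mem_stratum (fun i hi => by rw [hi]) hx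

/-- The Lie bracket as a bilinear map. -/
def lieBilin (𝔤 : Type*) [LieRing 𝔤] [LieAlgebra ℝ 𝔤] : 𝔤 →ₗ[ℝ] 𝔤 →ₗ[ℝ] 𝔤 :=
  LinearMap.mk₂ ℝ (fun x y => ⁅x, y⁆) add_lie smul_lie lie_add lie_smul

theorem bilin_ext {B C : 𝔤 →ₗ[ℝ] 𝔤 →ₗ[ℝ] 𝔤}
    (h : ∀ i j, B (G.basis i) (G.basis j) = C (G.basis i) (G.basis j)) (x y : 𝔤) :
    B x y = C x y := by
  have : B = C := G.basis.ext fun i => G.basis.ext fun j => h i j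
  rw [this]

/-- Degrees add under the bracket, so the identity holds on basis vectors and extends bilinearly. -/
theorem euler_lie (x y : 𝔤) : G.euler ⁅x, y⁆ = ⁅G.euler x, y⁆ + ⁅x, G.euler y⁆ := by
  refine G.bilin_ext (B := (lieBilin 𝔤).compr₂ G.euler)
    (C := (lieBilin 𝔤).compl₁₂ G.euler LinearMap.id +
      (lieBilin 𝔤).compl₁₂ LinearMap.id G.euler) (fun i j => ?_) x y
  change G.euler ⁅G.basis i, G.basis j⁆ =
    ⁅G.euler (G.basis i), G.basis j⁆ + ⁅G.basis i, G.euler (G.basis j)⁆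
  rw [G.euler_of_mem (G.lie_basis_mem i j), G.euler_of_mem (G.basis_mem_stratum i),
    G.euler_of_mem (G.basis_mem_stratum j), smul_lie, lie_smul, ← add_smul, Nat.cast_add]

theorem dilLie_lie (t : ℝ) (x y : 𝔤) : G.dilLie t ⁅x, y⁆ = ⁅G.dilLie t x, G.dilLie t y⁆ := by
  refine G.bilin_ext (B := (lieBilin 𝔤).compr₂ (G.dilLie t))
    (C := (lieBilin 𝔤).compl₁₂ (G.dilLie t) (G.dilLie t)) (fun i j => ?_) x y
  change G.dilLie t ⁅G.basis i, G.basis j⁆ = ⁅G.dilLie t (G.basis i), G.dilLie t (G.basis j)⁆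
  rw [G.dilLie_of_mem t (G.lie_basis_mem i j), G.dilLie_of_mem t (G.basis_mem_stratum i),
    G.dilLie_of_mem t (G.basis_mem_stratum j), smul_lie, lie_smul, smul_smul, pow_add]

/-- The subspace of the Lie algebra of elements of degree at least `j`. -/
def lieFil (j : ℕ) : Submodule ℝ 𝔤 where
  carrier := {x | ∀ i, G.σ i < j → G.basis.equivFun x i = 0}
  add_mem' hx hy i hi := by rw [map_add, Pi.add_apply, hx i hi, hy i hi, add_zero]
  zero_mem' i _ := by simp
  smul_mem' c x hx i hi := by rw [map_smul, Pi.smul_apply, hx i hi, smul_zero]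

theorem lieFil_antitone : Antitone G.lieFil := fun _ _ hij _ hx i hi => hx i (hi.trans_le hij)

theorem lieFil_zero : G.lieFil 0 = ⊤ := by
  ext x
  simp [lieFil]

theorem lieFil_last : G.lieFil (k + 1) = ⊥ := by
  ext x
  simp only [Submodule.mem_bot]
  constructor
  · intro hx
    refine G.basis.equivFun.injective (funext fun i => ?_)
    rw [hx i (Nat.lt_succ_of_le (G.σ_le i))]
    simp
  · rintro rfl
    exact Submodule.zero_mem _

theorem lie_mem_lieFil (x : 𝔤) {y : 𝔤} {j : ℕ} (hy : y ∈ G.lieFil j) :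
    ⁅x, y⁆ ∈ G.lieFil (j + 1) := by
  rw [← G.basis.sum_equivFun x, ← G.basis.sum_equivFun y, sum_lie]
  refine Submodule.sum_mem _ fun a _ => ?_
  rw [lie_sum]
  refine Submodule.sum_mem _ fun b _ => ?_
  rw [smul_lie, lie_smul]
  refine Submodule.smul_mem _ _ ?_
  by_cases hb : G.σ b < j
  · rw [hy b hb, zero_smul]
    exact Submodule.zero_mem _
  · refine Submodule.smul_mem _ _ fun i hi => ?_
    refine G.repr_eq_zero_of_mem_stratum (G.lie_basis_mem a b) ?_
    have := G.one_le_σ a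
    omega

theorem ad_mem (x : 𝔤) : LieAlgebra.ad ℝ 𝔤 x ∈ raisingOperators G.lieFil G.lieFil_antitone :=
  fun _ _ hv => G.lie_mem_lieFil x hv

theorem lie_raising_pow {a : Module.End ℝ 𝔤}
    (ha : a ∈ raisingOperators G.lieFil G.lieFil_antitone) : a ^ (k + 1) = 0 :=
  raisingOperators_pow_eq_zero G.lieFil_zero G.lieFil_last ha

theorem expAd_eq (n : ℕ) (x : 𝔤) : expAd n x = aeval (LieAlgebra.ad ℝ 𝔤 x) (expPoly n) :=
  (aeval_expPoly _ _).symm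

theorem bchSeries_eq (n : ℕ) (T : Module.End ℝ 𝔤) :
    bchSeries n T = aeval (T - 1) (bchPoly n) := by
  simp [bchSeries, bchPoly, Algebra.smul_def]

theorem aeval_bchPoly_congr {A : Type*} [Ring A] [Algebra ℝ A] {a : A} {n N : ℕ}
    (ha : a ^ (n + 1) = 0) (hN : n ≤ N) : aeval a (bchPoly N) = aeval a (bchPoly n) := by
  simp only [bchPoly, map_add, map_one, map_sum, map_mul, map_pow, aeval_X, aeval_C]
  congr 1
  refine (Finset.sum_subset (Finset.Icc_subset_Icc_right hN) fun i hi hi' => ?_).symm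
  rw [pow_eq_zero_of_le (by simp only [Finset.mem_Icc] at hi hi'; omega) ha, mul_zero]

end CarnotGroup

end

/-! ### A faithful nilpotent representation and the group law -/

noncomputable section

namespace CarnotGroup

open TruncatedSeries Polynomial

variable {𝔤 : Type*} [LieRing 𝔤] [LieAlgebra ℝ 𝔤] {m k : ℕ} (G : CarnotGroup 𝔤 m k)

/-- The adjoint action of the Lie algebra on its extension by the Euler derivation. -/
def repLin : 𝔤 →ₗ[ℝ] Module.End ℝ ((Fin m → ℝ) × ℝ) :=
  LinearMap.mk₂ ℝ (fun z v => (G.basis.equivFun (⁅z, G.toLie v.1⁆ - v.2 • G.euler z), 0))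
    (fun z w v => by
      rw [add_lie, map_add, smul_add, add_sub_add_comm, map_add, Prod.mk_add_mk, add_zero])
    (fun c z v => by
      rw [smul_lie, map_smul, smul_comm, ← smul_sub, map_smul, Prod.smul_mk, smul_zero])
    (fun z v w => by
      simp only [toLie, Prod.fst_add, Prod.snd_add]
      rw [map_add, lie_add, add_smul, add_sub_add_comm, map_add, Prod.mk_add_mk, add_zero])
    (fun c z v => by
      simp only [toLie, Prod.smul_fst, Prod.smul_snd]
      rw [map_smul, lie_smul, smul_assoc, ← smul_sub, map_smul, Prod.smul_mk, smul_zero])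

/-- The same representation, by continuous linear operators. -/
def rep : 𝔤 →ₗ[ℝ] ((Fin m → ℝ) × ℝ) →L[ℝ] ((Fin m → ℝ) × ℝ) :=
  LinearMap.toContinuousLinearMap.toLinearMap ∘ₗ G.repLin

theorem rep_apply (z : 𝔤) (v : (Fin m → ℝ) × ℝ) :
    G.rep z v = (G.basis.equivFun (⁅z, G.toLie v.1⁆ - v.2 • G.euler z), 0) := rfl

theorem toLie_equivFun (z : 𝔤) : G.toLie (G.basis.equivFun z) = z :=
  G.basis.equivFun.symm_apply_apply z

theorem equivFun_toLie (x : Fin m → ℝ) : G.basis.equivFun (G.toLie x) = x :=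
  G.basis.equivFun.apply_symm_apply x

/-- On the first component this is the Jacobi identity; on the added line it is the derivation
property of `euler`. -/
theorem rep_lie (z w : 𝔤) : G.rep ⁅z, w⁆ = adOp (G.rep z) (G.rep w) := by
  refine ContinuousLinearMap.ext fun v => ?_
  rw [adOp_apply]
  change G.rep ⁅z, w⁆ v = G.rep z (G.rep w v) - G.rep w (G.rep z v)
  simp only [rep_apply, toLie_equivFun, zero_smul, sub_zero, Prod.mk_sub_mk, ← map_sub]
  rw [euler_lie, lie_sub, lie_sub, lie_smul, lie_smul, lie_lie, ← lie_skew w (G.euler z)]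
  congr 2
  module

/-- A continuous linear left inverse of the representation, in coordinates. -/
def coordOfRep : (((Fin m → ℝ) × ℝ) →L[ℝ] ((Fin m → ℝ) × ℝ)) →L[ℝ] (Fin m → ℝ) :=
  (ContinuousLinearMap.pi fun i => (-(G.σ i : ℝ)⁻¹) • ContinuousLinearMap.proj i) ∘L
    ContinuousLinearMap.fst ℝ (Fin m → ℝ) ℝ ∘L
      ContinuousLinearMap.apply ℝ ((Fin m → ℝ) × ℝ) ((0 : Fin m → ℝ), (1 : ℝ))

/-- The adjoint representation alone would lose the centre. The added vector `(0, 1)` is mapped to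
`-euler z`, whose coordinates are those of `z` times `-σ i ≠ 0`, so `z` can be read off. -/
theorem coordOfRep_rep (z : 𝔤) : G.coordOfRep (G.rep z) = G.basis.equivFun z := by
  ext i
  have hσ : (G.σ i : ℝ) ≠ 0 := by
    have := G.one_le_σ i
    positivity
  change (-(G.σ i : ℝ)⁻¹) * (G.rep z (0, 1)).1 i = _
  rw [rep_apply]
  simp only [toLie, map_zero, lie_zero, one_smul, zero_sub, map_neg, Pi.neg_apply]
  rw [euler, equivFun_diag]
  field_simp

theorem rep_injective : Function.Injective G.rep := fun z w h =>
  G.basis.equivFun.injective (by rw [← coordOfRep_rep, h, coordOfRep_rep])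

/-- The degree filtration of the space of the representation. -/
def repFil (j : ℕ) : Submodule ℝ ((Fin m → ℝ) × ℝ) where
  carrier := {v | (1 ≤ j → v.2 = 0) ∧ G.toLie v.1 ∈ G.lieFil j}
  add_mem' hv hw := by
    refine ⟨fun h => by rw [Prod.snd_add, hv.1 h, hw.1 h, add_zero], ?_⟩
    rw [Prod.fst_add, toLie, map_add]
    exact Submodule.add_mem _ hv.2 hw.2
  zero_mem' := ⟨fun _ => rfl, by
    rw [Prod.fst_zero, toLie, map_zero]
    exact Submodule.zero_mem _⟩
  smul_mem' c v hv := by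
    refine ⟨fun h => by rw [Prod.smul_snd, hv.1 h, smul_zero], ?_⟩
    rw [Prod.smul_fst, toLie, map_smul]
    exact Submodule.smul_mem _ _ hv.2

theorem repFil_antitone : Antitone G.repFil :=
  fun _ _ hij _ hv => ⟨fun h => hv.1 (h.trans hij), G.lieFil_antitone hij hv.2⟩

theorem repFil_zero : G.repFil 0 = ⊤ := by
  ext v
  simp [repFil, lieFil_zero]

theorem repFil_last : G.repFil (k + 1) = ⊥ := by
  ext v
  simp only [Submodule.mem_bot]
  constructor
  · rintro ⟨h1, h2⟩
    rw [lieFil_last, Submodule.mem_bot, toLie, LinearEquiv.map_eq_zero_iff] at h2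
    exact Prod.ext h2 (h1 (by omega))
  · rintro rfl
    exact Submodule.zero_mem _

/-- The degree raising continuous operators on the space of the representation. -/
def repRaising : NonUnitalSubalgebra ℝ (((Fin m → ℝ) × ℝ) →L[ℝ] ((Fin m → ℝ) × ℝ)) where
  carrier := {a | a.toLinearMap ∈ raisingOperators G.repFil G.repFil_antitone}
  add_mem' {a b} ha hb :=
    (raisingOperators G.repFil G.repFil_antitone).add_mem (x := a.toLinearMap)
      (y := b.toLinearMap) ha hb
  zero_mem' := (raisingOperators G.repFil G.repFil_antitone).zero_mem
  mul_mem' {a b} ha hb :=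
    (raisingOperators G.repFil G.repFil_antitone).mul_mem (x := a.toLinearMap)
      (y := b.toLinearMap) ha hb
  smul_mem' c a ha := (raisingOperators G.repFil G.repFil_antitone).smul_mem'
    c (x := a.toLinearMap) ha

/-- The added line has degree `0` and all of `𝔤` has degree at least `1`, so the Euler term raises
the degree as the bracket does. -/
theorem rep_mem (z : 𝔤) : G.rep z ∈ G.repRaising := by
  change (G.rep z).toLinearMap ∈ raisingOperators G.repFil G.repFil_antitone
  intro j v hv
  refine ⟨fun _ => rfl, ?_⟩
  change G.toLie (G.basis.equivFun _) ∈ _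
  rw [toLie_equivFun]
  refine Submodule.sub_mem _ (G.lie_mem_lieFil z hv.2) ?_
  rcases Nat.eq_zero_or_pos j with rfl | hj
  · intro i hi
    have := G.one_le_σ i
    omega
  · rw [hv.1 hj, zero_smul]
    exact Submodule.zero_mem _

theorem repRaising_pow {a : ((Fin m → ℝ) × ℝ) →L[ℝ] ((Fin m → ℝ) × ℝ)} (ha : a ∈ G.repRaising) :
    a ^ (k + 1) = 0 := by
  have h := raisingOperators_pow_eq_zero (hF := G.repFil_antitone) G.repFil_zero G.repFil_last
    (show a.toLinearMap ∈ _ from ha)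
  have h2 : (ContinuousLinearMap.toLinearMapRingHom (R₁ := ℝ) (M₁ := (Fin m → ℝ) × ℝ) a) ^ (k + 1) =
    0 := h
  rw [← map_pow] at h2
  exact ContinuousLinearMap.coe_injective h2

/-- The exponential of an operator of the representation. -/
def expRep (z : 𝔤) : ((Fin m → ℝ) × ℝ) →L[ℝ] ((Fin m → ℝ) × ℝ) :=
  aeval (G.rep z) (expPoly (3 * (k + 1)))

/-- The logarithm of a unipotent operator, in the form of a polynomial. -/
def logOp (k : ℕ) (a : ((Fin m → ℝ) × ℝ) →L[ℝ] ((Fin m → ℝ) × ℝ)) :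
    ((Fin m → ℝ) × ℝ) →L[ℝ] ((Fin m → ℝ) × ℝ) :=
  aeval (a - 1) (logPoly (3 * (k + 1)))

theorem logOp_expRep (z : 𝔤) : logOp k (G.expRep z) = G.rep z :=
  log_exp (G.repRaising_pow (G.rep_mem z)) (by omega)

theorem expRep_injective : Function.Injective G.expRep := fun z w h =>
  G.rep_injective (by rw [← logOp_expRep, h, logOp_expRep])

/-- The integrand of the Baker-Campbell-Hausdorff formula. -/
def bchIntegrand (x y : 𝔤) (t : ℝ) : 𝔤 := bchSeries k (expAd k x * expAd k (t • y)) y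

/-- The representation intertwines `ad z` with the commutator by `rep z`. Lengthening the series
from `k` to `3 (k + 1)` terms is harmless, since degree raising operators of `𝔤` have zero power `k
+ 1`; the longer length is what `exp_mul` needs for nilpotency index `k + 1`. -/
theorem rep_bchIntegrand (x y : 𝔤) (t : ℝ) :
    G.rep (bchIntegrand (k := k) x y t) =
      (aeval (aeval (adOp (G.rep x)) (expPoly (3 * (k + 1))) *
        aeval (t • adOp (G.rep y)) (expPoly (3 * (k + 1))) - 1) (bchPoly (3 * (k + 1))))
        (G.rep y) := by
  have hT : ∀ x, expAd k x - 1 ∈ raisingOperators G.lieFil G.lieFil_antitone := fun x => by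
    rw [expAd_eq]
    exact exp_sub_one_mem (G.ad_mem x) k
  have hexp : ∀ x v, G.rep (expAd k x v) =
      (aeval (adOp (G.rep x)) (expPoly (3 * (k + 1)))) (G.rep v) := fun x v => by
    rw [expAd_eq, aeval_expPoly_congr (M := 3 * (k + 1)) (G.lie_raising_pow (G.ad_mem x)) le_rfl
      (by omega)]
    exact comp_aeval_of_comp_eq (fun v => G.rep_lie x v) _ v
  rw [bchIntegrand, bchSeries_eq, ← aeval_bchPoly_congr (N := 3 * (k + 1))
    (G.lie_raising_pow (mul_sub_one_mem (hT x) (hT (t • y)))) (by omega)]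
  refine comp_aeval_of_comp_eq (fun v => ?_) _ y
  rw [LinearMap.sub_apply, map_sub, Module.End.mul_apply, hexp, hexp, map_smul, adOp_smul]
  rfl

theorem contDiff_aeval {A : Type*} [NormedRing A] [NormedAlgebra ℝ A] {E : Type*}
    [NormedAddCommGroup E] [NormedSpace ℝ E] {f : E → A} {n : WithTop ℕ∞} (hf : ContDiff ℝ n f)
    (p : ℝ[X]) : ContDiff ℝ n fun x => aeval (f x) p := by
  simp only [aeval_eq_sum_range]
  exact ContDiff.sum fun i _ => (hf.pow i).const_smul (p.coeff i)

/-- Fundamental theorem of calculus for `t ↦ log (e^x e^(ty))`, whose derivative is the image of the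
integrand in `mul`. -/
theorem mul_eq_and_rep (x y : Fin m → ℝ) :
    G.mul x y = G.coordOfRep (logOp k (G.expRep (G.toLie x) * G.expRep (G.toLie y))) ∧
    G.rep (G.toLie (G.mul x y)) = logOp k (G.expRep (G.toLie x) * G.expRep (G.toLie y)) := by
  set z := G.toLie x with hz
  set w := G.toLie y with hw
  set Z : ℝ → ((Fin m → ℝ) × ℝ) →L[ℝ] ((Fin m → ℝ) × ℝ) :=
    fun s => logOp k (G.expRep z * G.expRep (s • w)) with hZ
  have hderiv : ∀ t, HasDerivAt Z (G.rep (bchIntegrand (k := k) z w t)) t := fun t => by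
    rw [rep_bchIntegrand]
    have := hasDerivAt_log_exp_mul_exp (fun a ha => G.repRaising_pow ha) le_rfl (G.rep_mem z)
      (G.rep_mem w) t
    simpa only [hZ, logOp, expRep, map_smul] using this
  have hsmooth : ContDiff ℝ 1 Z := by
    refine contDiff_aeval ?_ _
    refine ContDiff.sub (contDiff_const.mul ?_) contDiff_const
    refine contDiff_aeval ?_ _
    simp only [map_smul]
    exact contDiff_id.smul contDiff_const
  have hcont : Continuous fun t => G.rep (bchIntegrand (k := k) z w t) := by
    have h1 : deriv Z = fun t => G.rep (bchIntegrand (k := k) z w t) :=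
      funext fun t => (hderiv t).deriv
    rw [← h1]
    exact hsmooth.continuous_deriv_one
  have hint : ∫ t in (0 : ℝ)..1, G.rep (bchIntegrand (k := k) z w t) = Z 1 - Z 0 :=
    intervalIntegral.integral_eq_sub_of_hasDerivAt (fun t _ => hderiv t)
      (hcont.intervalIntegrable 0 1)
  have hZ0 : Z 0 = G.rep z := by
    have h1 : G.expRep (0 : 𝔤) = 1 := by
      rw [expRep, map_zero, aeval_expPoly, Finset.sum_range_succ']
      simp
    simp only [hZ, zero_smul, h1, mul_one, logOp_expRep]
  have hcoord : G.mul x y = G.coordOfRep (Z 1) := by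
    have h2 : G.mul x y = x + ∫ t in (0 : ℝ)..1,
        G.coordOfRep (G.rep (bchIntegrand (k := k) z w t)) := by
      simp only [coordOfRep_rep]
      rfl
    rw [h2, ContinuousLinearMap.intervalIntegral_comp_comm _ (hcont.intervalIntegrable 0 1), hint,
      map_sub, hZ0, coordOfRep_rep, hz, equivFun_toLie]
    abel
  have hZ1 : Z 1 = logOp k (G.expRep z * G.expRep w) := by simp only [hZ, one_smul]
  rw [← hZ1]
  refine ⟨hcoord, ?_⟩
  rw [hcoord]
  -- `P` is a continuous projection onto the image of `rep`. It fixes the integrand, hence the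
  -- integral, so the logarithm of the product stays in that image.
  set P : (((Fin m → ℝ) × ℝ) →L[ℝ] ((Fin m → ℝ) × ℝ)) →L[ℝ]
      (((Fin m → ℝ) × ℝ) →L[ℝ] ((Fin m → ℝ) × ℝ)) :=
    (LinearMap.toContinuousLinearMap (G.rep ∘ₗ G.basis.equivFun.symm.toLinearMap)) ∘L
      G.coordOfRep with hP
  have hPrep : ∀ v, P (G.rep v) = G.rep v := fun v => by
    change G.rep (G.toLie (G.coordOfRep (G.rep v))) = _
    rw [coordOfRep_rep, toLie_equivFun]
  have h3 : P (Z 1 - Z 0) = Z 1 - Z 0 := by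
    rw [← hint, ← ContinuousLinearMap.intervalIntegral_comp_comm _
      (hcont.intervalIntegrable 0 1)]
    simp only [hPrep]
  rw [map_sub, hZ0, hPrep, sub_left_inj] at h3
  exact h3

theorem expRep_mul (x y : Fin m → ℝ) :
    G.expRep (G.toLie (G.mul x y)) = G.expRep (G.toLie x) * G.expRep (G.toLie y) := by
  have hmem : ∀ z, G.expRep z - 1 ∈ G.repRaising := fun z => exp_sub_one_mem (G.rep_mem z) _
  rw [expRep, (G.mul_eq_and_rep x y).2, logOp,
    exp_log (G.repRaising_pow (mul_sub_one_mem (hmem (G.toLie x)) (hmem (G.toLie y)))) (by omega)]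
  abel

theorem mul_eq_of_expRep {x y z : Fin m → ℝ}
    (h : G.expRep (G.toLie x) * G.expRep (G.toLie y) = G.expRep (G.toLie z)) : G.mul x y = z := by
  rw [← expRep_mul] at h
  exact G.basis.equivFun.symm.injective (G.expRep_injective h)

theorem mul_assoc' (x y z : Fin m → ℝ) : G.mul (G.mul x y) z = G.mul x (G.mul y z) :=
  G.mul_eq_of_expRep (by simp only [expRep_mul, mul_assoc])

/-- On a line all brackets vanish and the integrand is the constant `t • x`. The identity element
and the inverses are special cases. -/
theorem smul_mul_smul (s t : ℝ) (x : Fin m → ℝ) : G.mul (s • x) (t • x) = (s + t) • x := by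
  have had : ∀ r : ℝ, ∀ v : 𝔤, (r • LieAlgebra.ad ℝ 𝔤 v) v = 0 := fun r v => by simp
  have hexp : ∀ r : ℝ, expAd k (r • G.toLie x) (G.toLie x) = G.toLie x := fun r => by
    rw [expAd, Finset.sum_range_succ']
    simp [pow_succ]
  have hint : ∀ r : ℝ, bchSeries k (expAd k (G.toLie (s • x)) * expAd k (r • G.toLie (t • x)))
      (G.toLie (t • x)) = t • G.toLie x := fun r => by
    have h1 : ∀ c : ℝ, G.toLie (c • x) = c • G.toLie x := fun c => map_smul _ _ _
    have h2 : (expAd k (s • G.toLie x) * expAd k (r • t • G.toLie x) - 1) (G.toLie x) = 0 := by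
      rw [LinearMap.sub_apply, Module.End.mul_apply, smul_smul, hexp, hexp]
      simp
    rw [h1, h1, map_smul]
    congr 1
    rw [bchSeries, LinearMap.add_apply, LinearMap.sum_apply, Finset.sum_eq_zero]
    · simp
    · intro n hn
      obtain ⟨n, rfl⟩ : ∃ j, n = j + 1 := ⟨n - 1, by simp only [Finset.mem_Icc] at hn; omega⟩
      rw [LinearMap.smul_apply, pow_succ (_ - _), Module.End.mul_apply, h2, map_zero, smul_zero]
  rw [mul]
  simp only [hint, map_smul, equivFun_toLie, intervalIntegral.integral_const, sub_zero, one_smul]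
  rw [add_smul]

theorem mul_zero' (x : Fin m → ℝ) : G.mul x 0 = x := by
  simpa using G.smul_mul_smul 1 0 x

theorem zero_mul' (x : Fin m → ℝ) : G.mul 0 x = x := by
  simpa using G.smul_mul_smul 0 1 x

theorem mul_neg_self (x : Fin m → ℝ) : G.mul x (-x) = 0 := by
  simpa using G.smul_mul_smul 1 (-1) x

theorem neg_mul_self (x : Fin m → ℝ) : G.mul (-x) x = 0 := by
  simpa using G.smul_mul_smul (-1) 1 x

theorem neg_mul_cancel_left (x y : Fin m → ℝ) : G.mul (-x) (G.mul x y) = y := by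
  rw [← mul_assoc', neg_mul_self, zero_mul']

theorem mul_neg_cancel_left (x y : Fin m → ℝ) : G.mul x (G.mul (-x) y) = y := by
  rw [← mul_assoc', mul_neg_self, zero_mul']

theorem neg_mul_rev (x y : Fin m → ℝ) : -G.mul x y = G.mul (-y) (-x) := by
  have h : G.mul (G.mul x y) (G.mul (-y) (-x)) = 0 := by
    rw [mul_assoc', mul_neg_cancel_left, mul_neg_self]
  rw [← G.neg_mul_cancel_left (G.mul x y) (G.mul (-y) (-x)), h, mul_zero']

/-- In operator form the product is built from linear maps, polynomials and multiplication of
operators. -/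
theorem contDiff_mul (n : WithTop ℕ∞) :
    ContDiff ℝ n fun p : (Fin m → ℝ) × (Fin m → ℝ) => G.mul p.1 p.2 := by
  have h : (fun p : (Fin m → ℝ) × (Fin m → ℝ) => G.mul p.1 p.2) = fun p =>
      G.coordOfRep (logOp k (G.expRep (G.toLie p.1) * G.expRep (G.toLie p.2))) :=
    funext fun p => (G.mul_eq_and_rep p.1 p.2).1
  have hrep : ContDiff ℝ n fun x => G.rep (G.toLie x) :=
    (LinearMap.toContinuousLinearMap (G.rep ∘ₗ G.basis.equivFun.symm.toLinearMap)).contDiff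
  rw [h]
  refine G.coordOfRep.contDiff.comp (contDiff_aeval (ContDiff.sub ?_ contDiff_const) _)
  exact (contDiff_aeval (hrep.comp contDiff_fst) _).mul
    (contDiff_aeval (hrep.comp contDiff_snd) _)

/-- The dilations of the group. -/
def dil (t : ℝ) (x : Fin m → ℝ) : Fin m → ℝ := fun i => t ^ G.σ i * x i

theorem toLie_dil (t : ℝ) (x : Fin m → ℝ) : G.toLie (G.dil t x) = G.dilLie t (G.toLie x) := by
  refine G.basis.equivFun.injective (funext fun i => ?_)
  rw [equivFun_toLie, dilLie, equivFun_diag, equivFun_toLie]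
  rfl

theorem dilLie_euler (t : ℝ) (z : 𝔤) : G.dilLie t (G.euler z) = G.euler (G.dilLie t z) := by
  refine G.basis.equivFun.injective (funext fun i => ?_)
  rw [dilLie, euler, equivFun_diag, equivFun_diag, equivFun_diag, equivFun_diag]
  ring

/-- The extension of the dilation to the space of the representation. -/
def dilRep (t : ℝ) : ((Fin m → ℝ) × ℝ) →L[ℝ] ((Fin m → ℝ) × ℝ) :=
  (ContinuousLinearMap.pi fun i => (t ^ G.σ i) • ContinuousLinearMap.proj i).prodMap
    (ContinuousLinearMap.id ℝ ℝ)

theorem dilRep_apply (t : ℝ) (v : (Fin m → ℝ) × ℝ) : G.dilRep t v = (G.dil t v.1, v.2) := rfl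

theorem dil_dil_inv {t : ℝ} (ht : t ≠ 0) (x : Fin m → ℝ) : G.dil t (G.dil t⁻¹ x) = x := by
  ext i
  simp [dil, ht]

theorem rep_mul_dilRep (t : ℝ) (z : 𝔤) :
    G.rep (G.dilLie t z) * G.dilRep t = G.dilRep t * G.rep z := by
  refine ContinuousLinearMap.ext fun v => ?_
  change G.rep (G.dilLie t z) (G.dilRep t v) = G.dilRep t (G.rep z v)
  rw [rep_apply, dilRep_apply, rep_apply, dilRep_apply]
  refine Prod.ext (G.basis.equivFun.symm.injective ?_) rfl
  change G.toLie _ = G.toLie (G.dil t _)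
  rw [toLie_dil, toLie_equivFun, toLie_dil, toLie_equivFun, map_sub, dilLie_lie, map_smul,
    dilLie_euler]

theorem expRep_mul_dilRep (t : ℝ) (z : 𝔤) :
    G.expRep (G.dilLie t z) * G.dilRep t = G.dilRep t * G.expRep z := by
  have hpow : ∀ n, G.rep (G.dilLie t z) ^ n * G.dilRep t = G.dilRep t * G.rep z ^ n := by
    intro n
    induction n with
    | zero => simp
    | succ n ih => rw [pow_succ, mul_assoc, rep_mul_dilRep, ← mul_assoc, ih, mul_assoc, ← pow_succ]
  rw [expRep, expRep, aeval_expPoly, aeval_expPoly, Finset.sum_mul, Finset.mul_sum]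
  refine Finset.sum_congr rfl fun n _ => ?_
  rw [smul_mul_assoc, hpow, mul_smul_comm]

/-- Dilations are automorphisms of the group. -/
theorem dil_mul {t : ℝ} (ht : t ≠ 0) (x y : Fin m → ℝ) :
    G.dil t (G.mul x y) = G.mul (G.dil t x) (G.dil t y) := by
  symm
  refine G.mul_eq_of_expRep ?_
  have hinv : G.dilRep t * G.dilRep t⁻¹ = 1 :=
    ContinuousLinearMap.ext fun v => Prod.ext (G.dil_dil_inv ht v.1) rfl
  have h : G.expRep (G.toLie (G.dil t x)) * G.expRep (G.toLie (G.dil t y)) * G.dilRep t =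
      G.expRep (G.toLie (G.dil t (G.mul x y))) * G.dilRep t := by
    rw [toLie_dil, toLie_dil, toLie_dil, mul_assoc, expRep_mul_dilRep, ← mul_assoc,
      expRep_mul_dilRep, expRep_mul_dilRep, expRep_mul, mul_assoc]
  have h2 := congrArg (· * G.dilRep t⁻¹) h
  simpa only [mul_assoc, hinv, mul_one] using h2

end CarnotGroup

end

/-! ### Invariance of Lebesgue measure and pseudoballs -/

noncomputable section

namespace CarnotGroup

variable {𝔤 : Type*} [LieRing 𝔤] [LieAlgebra ℝ 𝔤] {m k : ℕ} (G : CarnotGroup 𝔤 m k)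

theorem contDiff_mul_left (n : WithTop ℕ∞) (x : Fin m → ℝ) : ContDiff ℝ n (G.mul x) :=
  (G.contDiff_mul n).comp (contDiff_const.prodMk contDiff_id)

theorem differentiable_mul_left (x : Fin m → ℝ) : Differentiable ℝ (G.mul x) :=
  (G.contDiff_mul_left 1 x).differentiable one_ne_zero

/-- The dilations as continuous linear maps. -/
def dilCLM (t : ℝ) : (Fin m → ℝ) →L[ℝ] (Fin m → ℝ) :=
  ContinuousLinearMap.pi fun i => (t ^ G.σ i) • ContinuousLinearMap.proj i

theorem continuous_dil (x : Fin m → ℝ) : Continuous fun t => G.dil t x :=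
  continuous_pi fun _ => (continuous_pow _).mul continuous_const

theorem zero_dil (x : Fin m → ℝ) : G.dil 0 x = 0 := by
  ext i
  have := G.one_le_σ i
  simp [dil, show G.σ i ≠ 0 by omega]

theorem det_dilCLM_ne_zero {t : ℝ} (ht : t ≠ 0) : (G.dilCLM t).det ≠ 0 := by
  have h : G.dilCLM t * G.dilCLM t⁻¹ = 1 := ContinuousLinearMap.ext (G.dil_dil_inv ht)
  have h2 : (G.dilCLM t).det * (G.dilCLM t⁻¹).det = 1 := by
    rw [ContinuousLinearMap.det, ContinuousLinearMap.det, ← LinearMap.det_comp]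
    have : (G.dilCLM t).toLinearMap ∘ₗ (G.dilCLM t⁻¹).toLinearMap = LinearMap.id :=
      congrArg ContinuousLinearMap.toLinearMap h
    rw [this, LinearMap.det_id]
  exact left_ne_zero_of_mul_eq_one h2

/-- Dilation conjugates translation by `x` into translation by the dilated point, and conjugation
preserves determinants. -/
theorem det_fderiv_mul_dil {t : ℝ} (ht : t ≠ 0) (x z : Fin m → ℝ) :
    (fderiv ℝ (G.mul (G.dil t x)) (G.dil t z)).det = (fderiv ℝ (G.mul x) z).det := by
  have h : G.mul (G.dil t x) ∘ G.dilCLM t = G.dilCLM t ∘ G.mul x :=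
    funext fun y => (G.dil_mul ht x y).symm
  have h1 := ((G.differentiable_mul_left (G.dil t x) (G.dilCLM t z)).hasFDerivAt.comp z
    (G.dilCLM t).hasFDerivAt)
  have h2 := (G.dilCLM t).hasFDerivAt.comp z (G.differentiable_mul_left x z).hasFDerivAt
  rw [h] at h1
  have h3 := congrArg (fun f => LinearMap.det (ContinuousLinearMap.toLinearMap f)) (h1.unique h2)
  simp only [ContinuousLinearMap.toLinearMap_comp, LinearMap.det_comp] at h3
  rw [mul_comm] at h3
  exact mul_left_cancel₀ (G.det_dilCLM_ne_zero ht) h3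

/-- Left translations have Jacobian determinant one. -/
theorem det_fderiv_mul (x z : Fin m → ℝ) : (fderiv ℝ (G.mul x) z).det = 1 := by
  have hc : Continuous fun p : (Fin m → ℝ) × (Fin m → ℝ) => (fderiv ℝ (G.mul p.1) p.2).det := by
    have h1 : ContDiff ℝ 0 fun p : (Fin m → ℝ) × (Fin m → ℝ) => fderiv ℝ (G.mul p.1) p.2 := by
      refine ContDiff.fderiv (m := 1) (n := 0) ?_ contDiff_snd (by norm_num)
      exact (G.contDiff_mul 1).comp
        ((contDiff_fst.comp contDiff_fst).prodMk contDiff_snd)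
    exact ContinuousLinearMap.continuous_det.comp h1.continuous
  -- The determinant is constant along `t ≠ 0`, and at `t = 0` the translation is the identity;
  -- continuity identifies the two values.
  have hc2 : Continuous fun t : ℝ => (fderiv ℝ (G.mul (G.dil t x)) (G.dil t z)).det :=
    hc.comp ((G.continuous_dil x).prodMk (G.continuous_dil z))
  have h0 : (fderiv ℝ (G.mul (G.dil 0 x)) (G.dil 0 z)).det = 1 := by
    have : G.mul 0 = id := funext G.zero_mul'
    rw [zero_dil, zero_dil, this, fderiv_id]
    exact LinearMap.det_id
  have h1 : Tendsto (fun t : ℝ => (fderiv ℝ (G.mul (G.dil t x)) (G.dil t z)).det) (𝓝[≠] 0) (𝓝 1) := by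
    have := hc2.tendsto 0
    rw [h0] at this
    exact this.mono_left nhdsWithin_le_nhds
  have h2 : Tendsto (fun t : ℝ => (fderiv ℝ (G.mul (G.dil t x)) (G.dil t z)).det) (𝓝[≠] 0)
      (𝓝 (fderiv ℝ (G.mul x) z).det) := by
    refine tendsto_const_nhds.congr' ?_
    filter_upwards [self_mem_nhdsWithin] with t ht
    exact (G.det_fderiv_mul_dil ht x z).symm
  exact tendsto_nhds_unique h2 h1

/-- Left translations as homeomorphisms. -/
def mulLeftHomeo (x : Fin m → ℝ) : (Fin m → ℝ) ≃ₜ (Fin m → ℝ) where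
  toFun := G.mul x
  invFun := G.mul (-x)
  left_inv := G.neg_mul_cancel_left x
  right_inv := G.mul_neg_cancel_left x
  continuous_toFun := (G.differentiable_mul_left x).continuous
  continuous_invFun := (G.differentiable_mul_left (-x)).continuous

/-- Lebesgue measure is invariant under left translations. -/
theorem measurePreserving_mul (x : Fin m → ℝ) : MeasurePreserving (G.mul x) := by
  refine ⟨(G.mulLeftHomeo x).continuous.measurable, Measure.ext fun s hs => ?_⟩
  rw [Measure.map_apply (G.differentiable_mul_left x).continuous.measurable hs]
  have h1 : G.mul x ⁻¹' s = G.mul (-x) '' s :=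
    ((G.mulLeftHomeo x).symm.image_eq_preimage_symm s).symm
  rw [h1, ← lintegral_abs_det_fderiv_eq_addHaar_image volume hs
    (fun z _ => (G.differentiable_mul_left (-x) z).hasFDerivAt.hasFDerivWithinAt)
    (G.mulLeftHomeo (-x)).injective.injOn]
  simp [det_fderiv_mul]

/-- The power `2 k!` of the pseudonorm. -/
def gauge (x : Fin m → ℝ) : ℝ := ∑ j ∈ Finset.Icc 1 k, G.layerNorm x j ^ (2 * k.factorial / j)

theorem layerNorm_nonneg (x : Fin m → ℝ) (j : ℕ) : 0 ≤ G.layerNorm x j := Real.sqrt_nonneg _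

theorem gauge_nonneg (x : Fin m → ℝ) : 0 ≤ G.gauge x :=
  Finset.sum_nonneg fun j _ => pow_nonneg (G.layerNorm_nonneg x j) _

theorem pnorm_le_iff {x : Fin m → ℝ} {r : ℝ} (hr : 0 ≤ r) :
    G.pnorm x ≤ r ↔ G.gauge x ≤ r ^ (2 * k.factorial) := by
  have hk : 0 < (2 * (k.factorial : ℝ)) := by positivity
  change G.gauge x ^ (1 / (2 * (k.factorial : ℝ))) ≤ r ↔ _
  rw [one_div, Real.rpow_inv_le_iff_of_pos (G.gauge_nonneg x) hr hk]
  rw [← Real.rpow_natCast]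
  push_cast
  rfl

theorem continuous_gauge : Continuous G.gauge := by
  refine continuous_finsetSum _ fun j _ => Continuous.pow (Real.continuous_sqrt.comp ?_) _
  exact continuous_finsetSum _ fun i _ => (continuous_apply i).pow 2

theorem layerNorm_dil {t : ℝ} (ht : 0 ≤ t) (x : Fin m → ℝ) (j : ℕ) :
    G.layerNorm (G.dil t x) j = t ^ j * G.layerNorm x j := by
  have h : ∑ i with G.σ i = j, G.dil t x i ^ 2 = (t ^ j) ^ 2 * ∑ i with G.σ i = j, x i ^ 2 := by
    rw [Finset.mul_sum]
    refine Finset.sum_congr rfl fun i hi => ?_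
    rw [dil, (Finset.mem_filter.1 hi).2, mul_pow]
  rw [layerNorm, h, Real.sqrt_mul (sq_nonneg _), Real.sqrt_sq (pow_nonneg ht j), layerNorm]

theorem gauge_dil {t : ℝ} (ht : 0 ≤ t) (x : Fin m → ℝ) :
    G.gauge (G.dil t x) = t ^ (2 * k.factorial) * G.gauge x := by
  rw [gauge, gauge, Finset.mul_sum]
  refine Finset.sum_congr rfl fun j hj => ?_
  have hdvd : j ∣ 2 * k.factorial :=
    (Nat.dvd_factorial (by simp at hj; omega) (by simp at hj; omega)).mul_left 2
  rw [layerNorm_dil G ht, mul_pow, ← pow_mul, Nat.mul_div_cancel' hdvd]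

theorem layerNorm_le_of_gauge_le_one {x : Fin m → ℝ} (hx : G.gauge x ≤ 1) {j : ℕ} (hj : 1 ≤ j)
    (hjk : j ≤ k) : G.layerNorm x j ≤ 1 := by
  have h1 : G.layerNorm x j ^ (2 * k.factorial / j) ≤ 1 :=
    (Finset.single_le_sum (f := fun j => G.layerNorm x j ^ (2 * k.factorial / j))
      (fun j _ => pow_nonneg (G.layerNorm_nonneg x j) _) (Finset.mem_Icc.2 ⟨hj, hjk⟩)).trans hx
  have hne : 2 * k.factorial / j ≠ 0 := by
    have : j ≤ k.factorial := hjk.trans (Nat.self_le_factorial k)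
    exact (Nat.div_pos (by omega) (by omega)).ne'
  exact (pow_le_one_iff_of_nonneg (G.layerNorm_nonneg x j) hne).1 h1

/-- The closed unit pseudoball centred at the origin. -/
def unitBall : Set (Fin m → ℝ) := {x | G.gauge x ≤ 1}

theorem abs_le_one_of_mem_unitBall {x : Fin m → ℝ} (hx : x ∈ G.unitBall) (i : Fin m) :
    |x i| ≤ 1 := by
  refine le_trans ?_ (G.layerNorm_le_of_gauge_le_one hx (G.one_le_σ i) (G.σ_le i))
  rw [layerNorm, ← Real.sqrt_sq_eq_abs]
  exact Real.sqrt_le_sqrt (Finset.single_le_sum (f := fun l => x l ^ 2) (fun l _ => sq_nonneg _)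
    (Finset.mem_filter.2 ⟨Finset.mem_univ i, rfl⟩))

theorem isCompact_unitBall : IsCompact G.unitBall := by
  refine Metric.isCompact_of_isClosed_isBounded
    (isClosed_le G.continuous_gauge continuous_const) ?_
  refine (Metric.isBounded_closedBall (x := (0 : Fin m → ℝ)) (r := 1)).subset fun x hx => ?_
  rw [mem_closedBall_zero_iff, pi_norm_le_iff_of_nonneg zero_le_one]
  exact G.abs_le_one_of_mem_unitBall hx

theorem gauge_zero : G.gauge 0 = 0 := by
  have := G.gauge_dil le_rfl (0 : Fin m → ℝ)
  rwa [zero_dil, zero_pow (by positivity), zero_mul] at this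

theorem unitBall_mem_nhds : G.unitBall ∈ 𝓝 (0 : Fin m → ℝ) := by
  have : Tendsto G.gauge (𝓝 0) (𝓝 0) := by
    have := G.continuous_gauge.tendsto 0
    rwa [gauge_zero] at this
  exact (this.eventually (gt_mem_nhds zero_lt_one)).mono fun x hx => le_of_lt hx

theorem volume_unitBall_pos : 0 < volume G.unitBall :=
  Measure.measure_pos_of_mem_nhds volume G.unitBall_mem_nhds

theorem volume_unitBall_lt_top : volume G.unitBall < ∞ := G.isCompact_unitBall.measure_lt_top

theorem gauge_neg (x : Fin m → ℝ) : G.gauge (-x) = G.gauge x := by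
  simp [gauge, layerNorm]

/-- `(x · z)⁻¹ · x = z⁻¹ = -z`, and the gauge is even. -/
theorem mul_mem_closedPBall_iff {x z : Fin m → ℝ} {r : ℝ} (hr : 0 ≤ r) :
    G.mul x z ∈ G.closedPBall x r ↔ G.gauge z ≤ r ^ (2 * k.factorial) := by
  rw [closedPBall, Set.mem_ofPred_eq, inv, neg_mul_rev, mul_assoc', neg_mul_self, mul_zero',
    pnorm_le_iff G hr, gauge_neg]

/-- The closed pseudoball centred at the origin. -/
def originBall (r : ℝ) : Set (Fin m → ℝ) := {z | G.gauge z ≤ r ^ (2 * k.factorial)}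

theorem preimage_closedPBall (x : Fin m → ℝ) {r : ℝ} (hr : 0 ≤ r) :
    G.mul x ⁻¹' G.closedPBall x r = G.originBall r :=
  Set.ext fun z => by
    rw [Set.mem_preimage, G.mul_mem_closedPBall_iff hr, originBall, Set.mem_ofPred_eq]

theorem dil_mem_originBall_iff {r : ℝ} (hr : 0 < r) {w : Fin m → ℝ} :
    G.dil r w ∈ G.originBall r ↔ w ∈ G.unitBall := by
  have h : 0 < r ^ (2 * k.factorial) := by positivity
  rw [originBall, Set.mem_ofPred_eq, gauge_dil G hr.le, unitBall, Set.mem_ofPred_eq]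
  exact mul_le_iff_le_one_right h

theorem eLpNorm_closedPBall (f : (Fin m → ℝ) → ℝ) (p : ℝ≥0∞) (x : Fin m → ℝ) {r : ℝ} (hr : 0 ≤ r) :
    eLpNorm f p (volume.restrict (G.closedPBall x r)) =
      eLpNorm (fun z => f (G.mul x z)) p (volume.restrict (G.originBall r)) := by
  have hemb : MeasurableEmbedding (G.mul x) := (G.mulLeftHomeo x).measurableEmbedding
  have h := (G.measurePreserving_mul x).restrict_preimage_emb hemb (G.closedPBall x r)
  rw [← G.preimage_closedPBall x hr, ← h.map_eq, hemb.eLpNorm_map_measure]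
  rfl

end CarnotGroup

end

/-! ### Homogeneous Taylor expansion of second order -/

noncomputable section

/-- Second order Taylor expansion at a point. -/
theorem taylor_two_isLittleO {E : Type*} [NormedAddCommGroup E] [NormedSpace ℝ E] {f : E → ℝ}
    (hf : ContDiffAt ℝ 2 f 0) :
    (fun z => f z - f 0 - fderiv ℝ f 0 z - fderiv ℝ (fderiv ℝ f) 0 z z / 2)
      =o[𝓝 0] fun z => ‖z‖ ^ 2 := by
  set B := fderiv ℝ (fderiv ℝ f) 0 with hB
  have hsymm : ∀ v w, B v w = B w v := (hf.isSymmSndFDerivAt (by simp)).eq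
  have hD : DifferentiableAt ℝ (fderiv ℝ f) 0 :=
    (hf.fderiv_right (m := 1) (by norm_num)).differentiableAt one_ne_zero
  have hlo := hD.hasFDerivAt.isLittleO
  rw [isLittleO_iff] at hlo ⊢
  intro c hc
  have hev : ∀ᶠ z in 𝓝 (0 : E), DifferentiableAt ℝ f z :=
    (hf.eventually (by simp)).mono fun z hz => hz.differentiableAt two_ne_zero
  obtain ⟨r, hr, hball⟩ := Metric.eventually_nhds_iff_ball.1 ((hlo hc).and hev)
  filter_upwards [Metric.ball_mem_nhds (0 : E) hr] with z hz
  -- The derivative of the remainder `g` at `y` is `o(‖y‖)`, since `fderiv ℝ f` is differentiable at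
  -- `0`; the mean value inequality on the ball of radius `‖z‖` gives `o(‖z‖²)`.
  set g : E → ℝ := fun z => f z - f 0 - fderiv ℝ f 0 z - B z z / 2 with hg
  have hg' : ∀ y ∈ Metric.ball (0 : E) r,
      HasFDerivAt g (fderiv ℝ f y - fderiv ℝ f 0 - B y) y := by
    intro y hy
    have h1 : HasFDerivAt (fun y => B y y) ((B y).comp (ContinuousLinearMap.id ℝ E) +
        (B.flip y)) y := by
      have := B.hasFDerivAt (x := y) |>.clm_apply (hasFDerivAt_id y)
      simpa using this
    have h2 := (((hball y hy).2.hasFDerivAt.sub_const (f 0)).sub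
      (fderiv ℝ f 0).hasFDerivAt).sub (h1.const_mul (1 / 2))
    convert! h2 using 1
    · ext y
      simp only [hg, Pi.sub_apply]
      ring
    · ext v
      simp only [_root_.sub_apply, _root_.smul_apply,
        _root_.add_apply, ContinuousLinearMap.comp_apply,
        ContinuousLinearMap.flip_apply, ContinuousLinearMap.id_apply, smul_eq_mul]
      rw [hsymm v y]
      ring
  have hsub : Metric.closedBall (0 : E) ‖z‖ ⊆ Metric.ball 0 r :=
    Metric.closedBall_subset_ball (by simpa using hz)
  have hbound : ∀ y ∈ Metric.closedBall (0 : E) ‖z‖,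
      ‖fderiv ℝ f y - fderiv ℝ f 0 - B y‖ ≤ c * ‖z‖ := by
    intro y hy
    have := (hball y (hsub hy)).1
    rw [sub_zero] at this
    exact this.trans (mul_le_mul_of_nonneg_left (by simpa using hy) hc.le)
  have := (convex_closedBall (0 : E) ‖z‖).norm_image_sub_le_of_norm_hasFDerivWithin_le
    (fun y hy => (hg' y (hsub hy)).hasFDerivWithinAt) hbound
    (Metric.mem_closedBall_self (norm_nonneg z)) (by simp : z ∈ Metric.closedBall (0 : E) ‖z‖)
  have hg0 : g 0 = 0 := by simp [hg]
  rw [hg0, sub_zero, sub_zero] at this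
  rw [norm_pow, norm_norm]
  calc ‖g z‖ ≤ c * ‖z‖ * ‖z‖ := this
    _ = c * ‖z‖ ^ 2 := by ring

namespace CarnotGroup

variable {𝔤 : Type*} [LieRing 𝔤] [LieAlgebra ℝ 𝔤] {m k : ℕ} (G : CarnotGroup 𝔤 m k)

theorem contDiff_field (n : ℕ) (i : Fin m) : ContDiff ℝ n (G.field i) := by
  refine ContDiff.clm_apply ?_ contDiff_const
  refine ContDiff.fderiv (m := (n + 1 : ℕ)) (n := n) (G.contDiff_mul _) contDiff_const ?_
  norm_cast

theorem contDiffAt_X {n : ℕ} {φ : (Fin m → ℝ) → ℝ} {x : Fin m → ℝ}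
    (hφ : ContDiffAt ℝ (n + 1 : ℕ) φ x) (i : Fin m) : ContDiffAt ℝ n (G.X i φ) x :=
  (hφ.fderiv_right (by norm_cast)).clm_apply (G.contDiff_field n i).contDiffAt

theorem contDiffAt_comp_mul {n : WithTop ℕ∞} {φ : (Fin m → ℝ) → ℝ} {x : Fin m → ℝ}
    (hφ : ContDiffAt ℝ n φ x) : ContDiffAt ℝ n (fun z => φ (G.mul x z)) 0 := by
  refine ContDiffAt.comp (0 : Fin m → ℝ) ?_ (G.contDiff_mul_left n x).contDiffAt
  rwa [mul_zero']

theorem sum_smul_field (y v : Fin m → ℝ) : fderiv ℝ (G.mul y) 0 v = ∑ i, v i • G.field i y := by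
  have hv : v = ∑ i, v i • Pi.single i (1 : ℝ) := by
    ext j
    simp [Pi.single_apply]
  conv_lhs => rw [hv]
  rw [map_sum]
  simp only [map_smul, field]

theorem fderiv_comp_mul_zero {φ : (Fin m → ℝ) → ℝ} {y : Fin m → ℝ} (hφ : DifferentiableAt ℝ φ y)
    (v : Fin m → ℝ) : fderiv ℝ (fun z => φ (G.mul y z)) 0 v = ∑ i, v i * G.X i φ y := by
  have h0 : G.mul y 0 = y := G.mul_zero' y
  have h1 : HasFDerivAt φ (fderiv ℝ φ y) (G.mul y 0) := by
    rw [h0]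
    exact hφ.hasFDerivAt
  have h2 := (h1.comp 0 (G.differentiable_mul_left y 0).hasFDerivAt).fderiv
  have h3 : fderiv ℝ (fun z => φ (G.mul y z)) 0 = (fderiv ℝ φ y) ∘L (fderiv ℝ (G.mul y) 0) := h2
  rw [h3, ContinuousLinearMap.comp_apply, sum_smul_field, map_sum]
  simp only [map_smul, smul_eq_mul, X]

/-- The derivative along a one-parameter subgroup is given by the left invariant fields. -/
theorem fderiv_comp_mul_smul {φ : (Fin m → ℝ) → ℝ} {x v : Fin m → ℝ} {t : ℝ}
    (hφ : DifferentiableAt ℝ φ (G.mul x (t • v))) :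
    fderiv ℝ (fun z => φ (G.mul x z)) (t • v) v = ∑ i, v i * G.X i φ (G.mul x (t • v)) := by
  rw [← G.fderiv_comp_mul_zero hφ]
  have hd1 : DifferentiableAt ℝ (fun z => φ (G.mul x z)) (t • v) :=
    hφ.comp _ (G.differentiable_mul_left x _)
  have hd2 : DifferentiableAt ℝ (fun z => φ (G.mul (G.mul x (t • v)) z)) 0 := by
    refine DifferentiableAt.comp (0 : Fin m → ℝ) ?_ (G.differentiable_mul_left _ _)
    rwa [mul_zero']
  -- The curves in `h1` and `h2` coincide, because `x · (t + s) v = (x · t v) · s v`.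
  have h1 : HasDerivAt (fun s : ℝ => φ (G.mul x ((t + s) • v)))
      (fderiv ℝ (fun z => φ (G.mul x z)) (t • v) v) 0 := by
    have hl : HasDerivAt (fun s : ℝ => (t + s) • v) v 0 := by
      simpa using ((hasDerivAt_id (0 : ℝ)).const_add t).smul_const v
    refine HasFDerivAt.comp_hasDerivAt (f := fun s : ℝ => (t + s) • v)
      (l := fun z => φ (G.mul x z)) (0 : ℝ) ?_ hl
    rw [add_zero]
    exact hd1.hasFDerivAt
  have h2 : HasDerivAt (fun s : ℝ => φ (G.mul (G.mul x (t • v)) (s • v)))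
      (fderiv ℝ (fun z => φ (G.mul (G.mul x (t • v)) z)) 0 v) 0 := by
    have hl : HasDerivAt (fun s : ℝ => s • v) v 0 := by
      simpa using (hasDerivAt_id (0 : ℝ)).smul_const v
    refine HasFDerivAt.comp_hasDerivAt (f := fun s : ℝ => s • v)
      (l := fun z => φ (G.mul (G.mul x (t • v)) z)) (0 : ℝ) ?_ hl
    rw [zero_smul]
    exact hd2.hasFDerivAt
  refine h1.unique (h2.congr_of_eventuallyEq (.of_forall fun s => ?_))
  simp only
  rw [mul_assoc', smul_mul_smul]

/-- The curve `t ↦ x · t v` is an integral curve of `∑ v_i X_i`, so the second derivative along it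
is the square of this field applied to `φ`. Being a quadratic form in `v`, it sees only the
symmetrized second derivatives. -/
theorem fderiv_fderiv_comp_mul {φ : (Fin m → ℝ) → ℝ} {x : Fin m → ℝ} (hφ : ContDiffAt ℝ 2 φ x)
    (v : Fin m → ℝ) : fderiv ℝ (fderiv ℝ (fun z => φ (G.mul x z))) 0 v v =
      ∑ i, ∑ j, v i * v j * G.X i (G.X j φ) x := by
  set f := fun z => φ (G.mul x z) with hf
  have hline : Tendsto (fun t : ℝ => G.mul x (t • v)) (𝓝 0) (𝓝 x) := by
    have : Continuous fun t : ℝ => G.mul x (t • v) :=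
      (G.differentiable_mul_left x).continuous.comp (continuous_id.smul continuous_const)
    have h := this.tendsto 0
    rwa [zero_smul, mul_zero'] at h
  have hev : ∀ᶠ t in 𝓝 (0 : ℝ),
      fderiv ℝ f (t • v) v = ∑ j, v j * G.X j φ (G.mul x (t • v)) := by
    filter_upwards [hline.eventually (hφ.eventually (by simp))] with t ht
    exact G.fderiv_comp_mul_smul (ht.differentiableAt two_ne_zero)
  have hl : HasDerivAt (fun s : ℝ => s • v) v 0 := by
    simpa using (hasDerivAt_id (0 : ℝ)).smul_const v
  have hDf : DifferentiableAt ℝ (fderiv ℝ f) 0 :=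
    ((G.contDiffAt_comp_mul hφ).fderiv_right (m := 1) (by norm_num)).differentiableAt one_ne_zero
  have h1 : HasDerivAt (fun t : ℝ => fderiv ℝ f (t • v) v) (fderiv ℝ (fderiv ℝ f) 0 v v) 0 := by
    have h : HasDerivAt (fun t : ℝ => fderiv ℝ f (t • v)) (fderiv ℝ (fderiv ℝ f) 0 v) 0 := by
      refine HasFDerivAt.comp_hasDerivAt (f := fun s : ℝ => s • v) (l := fderiv ℝ f) (0 : ℝ) ?_ hl
      rw [zero_smul]
      exact hDf.hasFDerivAt
    simpa using h.clm_apply (hasDerivAt_const (0 : ℝ) v)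
  have h2 : HasDerivAt (fun t : ℝ => ∑ j, v j * G.X j φ (G.mul x (t • v)))
      (∑ j, v j * ∑ i, v i * G.X i (G.X j φ) x) 0 := by
    refine HasDerivAt.fun_sum fun j _ => HasDerivAt.const_mul _ ?_
    have hX : DifferentiableAt ℝ (G.X j φ) x :=
      (G.contDiffAt_X (n := 1) hφ j).differentiableAt one_ne_zero
    have hd : DifferentiableAt ℝ (fun z => G.X j φ (G.mul x z)) 0 := by
      refine DifferentiableAt.comp (g := G.X j φ) (0 : Fin m → ℝ) ?_ (G.differentiable_mul_left _ _)
      rwa [mul_zero']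
    rw [← G.fderiv_comp_mul_zero hX]
    refine HasFDerivAt.comp_hasDerivAt (f := fun s : ℝ => s • v)
      (l := fun z => G.X j φ (G.mul x z)) (0 : ℝ) ?_ hl
    rw [zero_smul]
    exact hd.hasFDerivAt
  rw [h1.unique (h2.congr_of_eventuallyEq hev), Finset.sum_comm]
  refine Finset.sum_congr rfl fun j _ => ?_
  rw [Finset.mul_sum]
  exact Finset.sum_congr rfl fun i _ => by ring

/-- The first order part of the expansion of `φ` at `x`. -/
def linPart (φ : (Fin m → ℝ) → ℝ) (x w : Fin m → ℝ) : ℝ := ∑ i ∈ G.horizontal, G.X i φ x * w i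

/-- The second order part of the expansion of `φ` at `x`. -/
def quadPart (φ : (Fin m → ℝ) → ℝ) (x w : Fin m → ℝ) : ℝ :=
  ∑ i with G.σ i = 2, G.X i φ x * w i +
    (∑ i ∈ G.horizontal, ∑ j ∈ G.horizontal, G.symHess φ x i j * w i * w j) / 2

theorem mem_horizontal {i : Fin m} : i ∈ G.horizontal ↔ G.σ i = 1 := by simp [horizontal]

/-- The second order expansion at `x`, in the homogeneous sense. -/
theorem expansion {φ : (Fin m → ℝ) → ℝ} {x : Fin m → ℝ} (hφ : ContDiffAt ℝ 2 φ x) {δ : ℝ}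
    (hδ : 0 < δ) : ∀ᶠ ε in 𝓝[>] (0 : ℝ), ∀ w ∈ G.unitBall,
      |φ (G.mul x (G.dil ε w)) - φ x - ε * G.linPart φ x w - ε ^ 2 * G.quadPart φ x w|
        ≤ δ * ε ^ 2 := by
  set f := fun z => φ (G.mul x z) with hf
  set D := fderiv ℝ f 0 with hD
  set B := fderiv ℝ (fderiv ℝ f) 0 with hB
  have hf0 : f 0 = φ x := by rw [hf]; simp only; rw [mul_zero']
  have hDv : ∀ v, D v = ∑ i, v i * G.X i φ x :=
    G.fderiv_comp_mul_zero (hφ.differentiableAt two_ne_zero)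
  have htay := taylor_two_isLittleO (G.contDiffAt_comp_mul hφ)
  rw [isLittleO_iff] at htay
  obtain ⟨r, hr, hball⟩ := Metric.eventually_nhds_iff_ball.1 (htay (half_pos hδ))
  -- `C ε³` will bound two errors: the first derivatives in strata of index at least `3`, and the
  -- Hessian terms involving the nonhorizontal part `ρ = O(ε²)` of `z`.
  set C := ∑ i, |G.X i φ x| + 2 * ‖B‖ with hC
  have hC0 : 0 ≤ C := by positivity
  have hev : ∀ᶠ ε in 𝓝[>] (0 : ℝ), 0 < ε ∧ ε < r ∧ ε < 1 ∧ ε < δ / (2 * (C + 1)) := by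
    filter_upwards [Ioo_mem_nhdsGT hr, Ioo_mem_nhdsGT one_pos,
      Ioo_mem_nhdsGT (show 0 < δ / (2 * (C + 1)) by positivity)] with ε h1 h2 h3
    exact ⟨h1.1, h1.2, h2.2, h3.2⟩
  filter_upwards [hev] with ε hε w hw
  obtain ⟨hε0, hεr, hε1, hεδ⟩ := hε
  have hw1 := fun i => G.abs_le_one_of_mem_unitBall hw i
  set z := G.dil ε w with hz
  set h : Fin m → ℝ := fun i => if G.σ i = 1 then w i else 0 with hh
  have hzi : ∀ i, |z i| ≤ ε := fun i => by
    simp only [hz, dil]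
    rw [abs_mul, abs_of_nonneg (by positivity)]
    have := G.one_le_σ i
    calc ε ^ G.σ i * |w i| ≤ ε ^ 1 * 1 := by
          gcongr ?_ * ?_
          · exact pow_le_pow_of_le_one hε0.le hε1.le this
          · exact hw1 i
      _ = ε := by ring
  have hznorm : ‖z‖ ≤ ε := (pi_norm_le_iff_of_nonneg hε0.le).2 hzi
  have hhnorm : ‖h‖ ≤ 1 := by
    refine (pi_norm_le_iff_of_nonneg zero_le_one).2 fun i => ?_
    simp only [hh]
    split_ifs
    · exact hw1 i
    · simp
  set ρ := z - ε • h with hρ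
  have hρnorm : ‖ρ‖ ≤ ε ^ 2 := by
    refine (pi_norm_le_iff_of_nonneg (by positivity)).2 fun i => ?_
    simp only [hρ, hz, hh, dil, Pi.sub_apply, Pi.smul_apply, smul_eq_mul]
    split_ifs with hi
    · rw [hi]
      simp only [pow_one, sub_self, norm_zero]
      positivity
    · have := G.one_le_σ i
      rw [mul_zero, sub_zero, Real.norm_eq_abs, abs_mul, abs_of_nonneg (by positivity)]
      calc ε ^ G.σ i * |w i| ≤ ε ^ 2 * 1 := by
            gcongr ?_ * ?_
            · exact pow_le_pow_of_le_one hε0.le hε1.le (by omega)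
            · exact hw1 i
        _ = ε ^ 2 := by ring
  have hT : |f z - f 0 - D z - B z z / 2| ≤ δ / 2 * ε ^ 2 := by
    have h1 := hball z (by rw [mem_ball_zero_iff]; exact hznorm.trans_lt hεr)
    rw [norm_pow, norm_norm, Real.norm_eq_abs] at h1
    exact h1.trans (by gcongr)
  have hBh : B h h = ∑ i ∈ G.horizontal, ∑ j ∈ G.horizontal, G.symHess φ x i j * w i * w j := by
    rw [hB, G.fderiv_fderiv_comp_mul hφ]
    have e1 : ∑ i, ∑ j, h i * h j * G.X i (G.X j φ) x =
        ∑ i ∈ G.horizontal, ∑ j ∈ G.horizontal, w i * w j * G.X i (G.X j φ) x := by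
      rw [horizontal, Finset.sum_filter]
      refine Finset.sum_congr rfl fun i _ => ?_
      simp only [hh]
      split_ifs with hi
      · rw [Finset.sum_filter]
        refine Finset.sum_congr rfl fun j _ => ?_
        split_ifs <;> simp
      · simp
    have e2 : ∑ i ∈ G.horizontal, ∑ j ∈ G.horizontal, w i * w j * G.X j (G.X i φ) x =
        ∑ i ∈ G.horizontal, ∑ j ∈ G.horizontal, w i * w j * G.X i (G.X j φ) x := by
      rw [Finset.sum_comm]
      exact Finset.sum_congr rfl fun i _ => Finset.sum_congr rfl fun j _ => by ring
    have e3 : ∑ i ∈ G.horizontal, ∑ j ∈ G.horizontal, G.symHess φ x i j * w i * w j =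
        (∑ i ∈ G.horizontal, ∑ j ∈ G.horizontal, w i * w j * G.X i (G.X j φ) x +
          ∑ i ∈ G.horizontal, ∑ j ∈ G.horizontal, w i * w j * G.X j (G.X i φ) x) / 2 := by
      rw [← Finset.sum_add_distrib, Finset.sum_div]
      refine Finset.sum_congr rfl fun i _ => ?_
      rw [← Finset.sum_add_distrib, Finset.sum_div]
      refine Finset.sum_congr rfl fun j _ => ?_
      rw [symHess]
      ring
    rw [e1, e3, e2]
    ring
  -- The argument yields `2 ‖B‖ ε³`; half of the looser bound is the second summand of `C`.
  have hBdiff : |B z z - ε ^ 2 * B h h| ≤ 2 * (2 * ‖B‖) * ε ^ 3 := by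
    have hzz : z = ε • h + ρ := by rw [hρ]; abel
    have e1 : B z z - ε ^ 2 * B h h = B ρ z + ε * B h ρ := by
      nth_rewrite 1 [hzz]
      rw [map_add, _root_.add_apply, map_smul, _root_.smul_apply,
        smul_eq_mul]
      nth_rewrite 1 [hzz]
      rw [map_add, map_smul, smul_eq_mul]
      ring
    have e2 : |B ρ z| ≤ ‖B‖ * ε ^ 2 * ε := (B.le_opNorm₂ ρ z).trans (by gcongr)
    have e3 : |B h ρ| ≤ ‖B‖ * 1 * ε ^ 2 := (B.le_opNorm₂ h ρ).trans (by gcongr)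
    rw [e1]
    calc |B ρ z + ε * B h ρ| ≤ |B ρ z| + |ε * B h ρ| := abs_add_le _ _
      _ ≤ ‖B‖ * ε ^ 2 * ε + ε * (‖B‖ * 1 * ε ^ 2) := by
          rw [abs_mul, abs_of_pos hε0]
          gcongr
      _ ≤ 2 * (2 * ‖B‖) * ε ^ 3 := by
          have : 0 ≤ ‖B‖ * ε ^ 3 := by positivity
          linarith
  have hDdiff : |D z - ε * G.linPart φ x w - ε ^ 2 * ∑ i with G.σ i = 2, G.X i φ x * w i| ≤
      (∑ i, |G.X i φ x|) * ε ^ 3 := by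
    rw [hDv, linPart, horizontal, Finset.sum_filter, Finset.sum_filter, Finset.mul_sum,
      Finset.mul_sum, ← Finset.sum_sub_distrib, ← Finset.sum_sub_distrib, Finset.sum_mul]
    refine (Finset.abs_sum_le_sum_abs _ _).trans (Finset.sum_le_sum fun i _ => ?_)
    have := G.one_le_σ i
    simp only [hz, dil]
    by_cases h1 : G.σ i = 1
    · simp only [h1, if_true]
      norm_num
      have : ε * w i * G.X i φ x - ε * (G.X i φ x * w i) = 0 := by ring
      rw [this, abs_zero]
      positivity
    · by_cases h2 : G.σ i = 2
      · simp only [h2, if_true]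
        norm_num
        have : ε ^ 2 * w i * G.X i φ x - ε ^ 2 * (G.X i φ x * w i) = 0 := by ring
        rw [this, abs_zero]
        positivity
      · simp only [h1, h2, if_false, mul_zero, sub_zero]
        rw [abs_mul, abs_mul, abs_of_nonneg (by positivity : 0 ≤ ε ^ G.σ i)]
        calc ε ^ G.σ i * |w i| * |G.X i φ x| ≤ ε ^ 3 * 1 * |G.X i φ x| := by
              gcongr ?_ * ?_ * _
              · exact pow_le_pow_of_le_one hε0.le hε1.le (by omega)
              · exact hw1 i
          _ = |G.X i φ x| * ε ^ 3 := by ring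
  have hCε : C * ε ^ 3 ≤ δ / 2 * ε ^ 2 := by
    have h1 : (C + 1) * ε ≤ δ / 2 := by
      rw [lt_div_iff₀ (by positivity)] at hεδ
      linarith
    have h2 : C * ε ≤ δ / 2 := by nlinarith
    calc C * ε ^ 3 = C * ε * ε ^ 2 := by ring
      _ ≤ δ / 2 * ε ^ 2 := by gcongr
  have hsplit : φ (G.mul x z) - φ x - ε * G.linPart φ x w - ε ^ 2 * G.quadPart φ x w =
      (f z - f 0 - D z - B z z / 2) +
      (D z - ε * G.linPart φ x w - ε ^ 2 * ∑ i with G.σ i = 2, G.X i φ x * w i) +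
      (B z z - ε ^ 2 * B h h) / 2 := by
    rw [hf0, hBh, quadPart]
    ring
  rw [hsplit]
  calc _ ≤ |f z - f 0 - D z - B z z / 2| +
      |D z - ε * G.linPart φ x w - ε ^ 2 * ∑ i with G.σ i = 2, G.X i φ x * w i| +
      |(B z z - ε ^ 2 * B h h) / 2| := abs_add_three _ _ _
    _ ≤ δ / 2 * ε ^ 2 + (∑ i, |G.X i φ x|) * ε ^ 3 + 2 * (2 * ‖B‖) * ε ^ 3 / 2 := by
        rw [abs_div, abs_of_pos (two_pos (α := ℝ))]
        gcongr
    _ = δ / 2 * ε ^ 2 + C * ε ^ 3 := by rw [hC]; ring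
    _ ≤ δ * ε ^ 2 := by linarith

end CarnotGroup

end

/-! ### The derivative of `|t|^q / q`, perturbation of its integrals, and `L^p` minimizers -/

noncomputable section

/-- The function `t ↦ |t|^(q-2) t`, which is the derivative of `|t|^q / q`. -/
def signedPow (q t : ℝ) : ℝ := |t| ^ (q - 2) * t

section SignedPow

variable {q : ℝ}

theorem signedPow_neg (t : ℝ) : signedPow q (-t) = -signedPow q t := by
  simp [signedPow]

theorem signedPow_of_pos {t : ℝ} (ht : 0 < t) : signedPow q t = t ^ (q - 1) := by
  rw [signedPow, abs_of_pos ht]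
  nth_rewrite 2 [← Real.rpow_one t]
  rw [← Real.rpow_add ht]
  ring_nf

theorem signedPow_mul_self (hq : q ≠ 0) (t : ℝ) : signedPow q t * t = |t| ^ q := by
  rcases eq_or_ne t 0 with rfl | ht
  · simp [signedPow, hq]
  · have h := abs_pos.2 ht
    have h2 : t * t = |t| ^ (2 : ℝ) := by
      rw [Real.rpow_two, sq_abs, sq]
    rw [signedPow, mul_assoc, h2, ← Real.rpow_add h]
    ring_nf

theorem abs_signedPow (hq : 1 < q) (t : ℝ) : |signedPow q t| = |t| ^ (q - 1) := by
  rcases eq_or_ne t 0 with rfl | ht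
  · have : q - 1 ≠ 0 := by linarith
    simp [signedPow, this]
  · rw [signedPow, abs_mul, abs_of_nonneg (Real.rpow_nonneg (abs_nonneg t) _)]
    nth_rewrite 2 [← Real.rpow_one |t|]
    rw [← Real.rpow_add (abs_pos.2 ht)]
    ring_nf

theorem signedPow_mul_of_pos {c : ℝ} (hc : 0 < c) (t : ℝ) :
    signedPow q (c * t) = c ^ (q - 1) * signedPow q t := by
  rw [signedPow, signedPow, abs_mul, abs_of_pos hc,
    Real.mul_rpow hc.le (abs_nonneg t)]
  have : c ^ (q - 1) = c ^ (q - 2) * c := by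
    nth_rewrite 3 [← Real.rpow_one c]
    rw [← Real.rpow_add hc]
    ring_nf
  rw [this]
  ring

theorem hasDerivAt_abs_rpow_signedPow (hq : 1 < q) (t : ℝ) :
    HasDerivAt (fun s : ℝ => |s| ^ q) (q * signedPow q t) t := by
  have := hasDerivAt_abs_rpow t hq
  rwa [mul_assoc] at this

theorem continuous_signedPow (hq : 1 < q) : Continuous (signedPow q) := by
  have h : deriv (fun s : ℝ => |s| ^ q) = fun t => q * signedPow q t :=
    funext fun t => (hasDerivAt_abs_rpow_signedPow hq t).deriv
  have h2 : Continuous fun t => q * signedPow q t := by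
    rw [← h]
    have : ContDiff ℝ 1 fun s : ℝ => |s| ^ q := by
      simpa [Real.norm_eq_abs] using contDiff_norm_rpow (E := ℝ) hq
    exact this.continuous_deriv_one
  have h3 : signedPow q = fun t => q⁻¹ * (q * signedPow q t) := by
    funext t
    rw [inv_mul_cancel_left₀ (by linarith)]
  rw [h3]
  exact continuous_const.mul h2

theorem strictMono_signedPow (hq : 1 < q) : StrictMono (signedPow q) := by
  refine strictMono_of_odd_strictMonoOn_nonneg signedPow_neg ?_
  intro s hs t _ hst
  rcases eq_or_lt_of_le (show 0 ≤ s from hs) with rfl | hs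
  · rw [signedPow_of_pos hst]
    simpa [signedPow] using Real.rpow_pos_of_pos hst (q - 1)
  · rw [signedPow_of_pos hs, signedPow_of_pos (hs.trans hst)]
    exact Real.rpow_lt_rpow hs.le hst (by linarith)

/-- Strict convexity of `|t|^q`, as a tangent line inequality. -/
theorem abs_rpow_add_lt (hq : 1 < q) (a : ℝ) {h : ℝ} (hh : h ≠ 0) :
    |a| ^ q + q * signedPow q a * h < |a + h| ^ q := by
  have hder := fun t => hasDerivAt_abs_rpow_signedPow hq t
  have hcont : Continuous fun s : ℝ => |s| ^ q :=
    continuous_iff_continuousAt.2 fun t => (hder t).continuousAt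
  have hq0 : 0 < q := by linarith
  rcases lt_or_gt_of_ne hh with hneg | hpos
  · obtain ⟨c, hc, hc2⟩ := exists_hasDerivAt_eq_slope (fun s : ℝ => |s| ^ q) _
      (by linarith : a + h < a) hcont.continuousOn fun t _ => hder t
    have h1 := strictMono_signedPow hq hc.2
    rw [eq_div_iff (by linarith)] at hc2
    nlinarith [mul_pos (mul_pos hq0 (sub_pos.2 h1)) (neg_pos.2 hneg)]
  · obtain ⟨c, hc, hc2⟩ := exists_hasDerivAt_eq_slope (fun s : ℝ => |s| ^ q) _
      (by linarith : a < a + h) hcont.continuousOn fun t _ => hder t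
    have h1 := strictMono_signedPow hq hc.1
    rw [eq_div_iff (by linarith)] at hc2
    nlinarith [mul_pos (mul_pos hq0 (sub_pos.2 h1)) hpos]

theorem hasDerivAt_signedPow {s : ℝ} (hs : s ≠ 0 ∨ 2 ≤ q) :
    HasDerivAt (signedPow q) ((q - 1) * |s| ^ (q - 2)) s := by
  rcases eq_or_ne s 0 with rfl | hs0
  · have hq : 2 ≤ q := hs.resolve_left (by simp)
    rw [hasDerivAt_iff_tendsto_slope]
    have h1 : Tendsto (fun t : ℝ => |t| ^ (q - 2)) (𝓝 0) (𝓝 (|0| ^ (q - 2))) :=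
      (continuous_abs.continuousAt.rpow_const (Or.inr (by linarith)))
    -- For `q = 2` the power is `0 ^ 0 = 1` and the factor is `1`; for `q > 2` both sides vanish.
    have h2 : (q - 1) * |(0 : ℝ)| ^ (q - 2) = |0| ^ (q - 2) := by
      rcases eq_or_lt_of_le hq with rfl | hq
      · norm_num
      · rw [abs_zero, Real.zero_rpow (by linarith), mul_zero]
    rw [h2]
    refine (h1.mono_left nhdsWithin_le_nhds).congr' ?_
    filter_upwards [self_mem_nhdsWithin] with t ht
    have : t ≠ 0 := ht
    simp [slope_def_field, signedPow, this]
  · have h1 : HasDerivAt (fun t : ℝ => |t| ^ (q - 2)) (SignType.sign s * (q - 2) * |s| ^ (q - 2 - 1)) s :=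
      (hasDerivAt_abs hs0).rpow_const (Or.inl (abs_ne_zero.2 hs0))
    have h2 := h1.mul (hasDerivAt_id s)
    convert! h2 using 1
    have h3 : (SignType.sign s : ℝ) * s = |s| := sign_mul_self s
    have h4 : |s| ^ (q - 2 - 1) * |s| = |s| ^ (q - 2) := by
      nth_rewrite 2 [← Real.rpow_one |s|]
      rw [← Real.rpow_add (abs_pos.2 hs0)]
      ring_nf
    simp only [id, mul_one]
    linear_combination (-(q - 2) * |s| ^ (q - 2 - 1)) * h3 - (q - 2) * h4

/-- Bound of the increments of `signedPow q` for `1 < q ≤ 2`. -/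
theorem abs_signedPow_sub_le_of_le_two (hq : 1 < q) (hq2 : q ≤ 2) {s : ℝ} (hs : s ≠ 0) (h : ℝ) :
    |signedPow q (s + h) - signedPow q s| ≤ 6 * (|s| / 2) ^ (q - 2) * |h| := by
  have hs0 := abs_pos.2 hs
  -- For small `h` the segment stays at distance `|s| / 2` from `0` and the mean value inequality
  -- applies. For large `h` both values are at most `3 |h|^(q-1)`, and `|h|^(q-2) ≤ (|s|/2)^(q-2)`
  -- because `q ≤ 2`; the sum of the two gives the `6`.
  rcases le_or_gt |h| (|s| / 2) with hh | hh
  · have hne : ∀ t ∈ Metric.closedBall s (|s| / 2), |s| / 2 ≤ |t| := fun t ht => by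
      rw [Metric.mem_closedBall, Real.dist_eq] at ht
      have := abs_sub_abs_le_abs_sub s t
      rw [abs_sub_comm] at this
      linarith
    have := (convex_closedBall s (|s| / 2)).norm_image_sub_le_of_norm_hasDerivWithin_le
      (f := signedPow q) (f' := fun t => (q - 1) * |t| ^ (q - 2)) (x := s) (y := s + h)
      (C := 6 * (|s| / 2) ^ (q - 2))
      (fun t ht => (hasDerivAt_signedPow (Or.inl (abs_pos.1
        ((half_pos hs0).trans_le (hne t ht))))).hasDerivWithinAt)
      (fun t ht => ?_) (Metric.mem_closedBall_self (by positivity))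
      (by rw [Metric.mem_closedBall, Real.dist_eq]; simpa using hh)
    · simpa [Real.norm_eq_abs] using this
    · rw [Real.norm_eq_abs, abs_of_nonneg (mul_nonneg (by linarith) (Real.rpow_nonneg
        (abs_nonneg t) _))]
      refine mul_le_mul (by linarith) ?_ (Real.rpow_nonneg (abs_nonneg t) _) (by norm_num)
      exact Real.rpow_le_rpow_of_nonpos (half_pos hs0) (hne t ht) (by linarith)
  · have hh0 : 0 < |h| := (half_pos hs0).trans hh
    have hbd : ∀ t, |t| ≤ 3 * |h| → |signedPow q t| ≤ 3 * |h| ^ (q - 1) := fun t ht => by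
      rw [abs_signedPow hq]
      calc |t| ^ (q - 1) ≤ (3 * |h|) ^ (q - 1) :=
            Real.rpow_le_rpow (abs_nonneg t) ht (by linarith)
        _ = 3 ^ (q - 1) * |h| ^ (q - 1) := Real.mul_rpow (by norm_num) hh0.le
        _ ≤ 3 ^ (1 : ℝ) * |h| ^ (q - 1) := by
            gcongr
            · norm_num
            · linarith
        _ = 3 * |h| ^ (q - 1) := by rw [Real.rpow_one]
    have h1 := hbd (s + h) ((abs_add_le s h).trans (by linarith))
    have h2 := hbd s (by linarith)
    have h3 : |h| ^ (q - 1) = |h| ^ (q - 2) * |h| := by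
      nth_rewrite 3 [← Real.rpow_one |h|]
      rw [← Real.rpow_add hh0]
      ring_nf
    have h4 : |h| ^ (q - 2) ≤ (|s| / 2) ^ (q - 2) :=
      Real.rpow_le_rpow_of_nonpos (half_pos hs0) hh.le (by linarith)
    calc |signedPow q (s + h) - signedPow q s| ≤ |signedPow q (s + h)| + |signedPow q s| :=
          abs_sub _ _
      _ ≤ 6 * (|h| ^ (q - 2) * |h|) := by rw [← h3]; linarith
      _ ≤ 6 * ((|s| / 2) ^ (q - 2) * |h|) := by gcongr
      _ = 6 * (|s| / 2) ^ (q - 2) * |h| := by ring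

/-- Bound of the increments of `signedPow q` for `2 ≤ q`. -/
theorem abs_signedPow_sub_le_of_two_le (hq2 : 2 ≤ q) {s h C : ℝ} (hs : |s| + |h| ≤ C) :
    |signedPow q (s + h) - signedPow q s| ≤ (q - 1) * C ^ (q - 2) * |h| := by
  have := (convex_closedBall s |h|).norm_image_sub_le_of_norm_hasDerivWithin_le
    (f := signedPow q) (f' := fun t => (q - 1) * |t| ^ (q - 2)) (x := s) (y := s + h)
    (C := (q - 1) * C ^ (q - 2))
    (fun t ht => (hasDerivAt_signedPow (Or.inr hq2)).hasDerivWithinAt)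
    (fun t ht => ?_) (Metric.mem_closedBall_self (by positivity))
    (by rw [Metric.mem_closedBall, Real.dist_eq]; simp)
  · simpa [Real.norm_eq_abs] using this
  · rw [Metric.mem_closedBall, Real.dist_eq] at ht
    have h1 := abs_sub_abs_le_abs_sub t s
    rw [Real.norm_eq_abs, abs_of_nonneg (mul_nonneg (by linarith) (Real.rpow_nonneg
      (abs_nonneg t) _))]
    refine mul_le_mul_of_nonneg_left ?_ (by linarith)
    exact Real.rpow_le_rpow (abs_nonneg t) (by linarith) (by linarith)

end SignedPow

section Perturbation

variable {α : Type*} [MeasurableSpace α] {μ : Measure α} [IsFiniteMeasure μ] {q : ℝ}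

theorem integrable_abs_rpow_of_bounded {L : α → ℝ} (hLm : AEStronglyMeasurable L μ) {C : ℝ}
    (hLC : ∀ᵐ w ∂μ, |L w| ≤ C) {s : ℝ} (hs : 0 ≤ s) : Integrable (fun w => |L w| ^ s) μ := by
  refine Integrable.of_bound ?_ (C ^ s) ?_
  · exact ((continuous_abs.rpow_const fun _ => Or.inr hs).comp_aestronglyMeasurable hLm)
  · filter_upwards [hLC] with w hw
    rw [Real.norm_eq_abs, abs_of_nonneg (Real.rpow_nonneg (abs_nonneg _) _)]
    exact Real.rpow_le_rpow (abs_nonneg _) hw hs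

/-- Differentiation of `t ↦ ∫ g ψ(L + t R_t)` at `0`, for `ψ(s) = |s|^(q-2) s`. -/
theorem tendsto_integral_signedPow_sub (hq : 1 < q) {L g R : α → ℝ} {Rt : ℝ → α → ℝ} {C : ℝ}
    (hLm : AEStronglyMeasurable L μ) (hLC : ∀ᵐ w ∂μ, |L w| ≤ C) (hL0 : ∀ᵐ w ∂μ, L w ≠ 0)
    (hLint : Integrable (fun w => |L w| ^ (q - 2)) μ)
    (hgm : AEStronglyMeasurable g μ) (hgC : ∀ᵐ w ∂μ, |g w| ≤ C)
    (hRm : ∀ᶠ t in 𝓝[>] (0 : ℝ), AEStronglyMeasurable (Rt t) μ)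
    (hRC : ∀ᶠ t in 𝓝[>] (0 : ℝ), ∀ᵐ w ∂μ, |Rt t w| ≤ C)
    (hR : ∀ᵐ w ∂μ, Tendsto (fun t => Rt t w) (𝓝[>] 0) (𝓝 (R w))) :
    Tendsto (fun t => ∫ w, g w * ((signedPow q (L w + t * Rt t w) - signedPow q (L w)) / t) ∂μ)
      (𝓝[>] 0) (𝓝 (∫ w, g w * ((q - 1) * |L w| ^ (q - 2) * R w) ∂μ)) := by
  have hψ := continuous_signedPow hq
  -- For `q ≤ 2` the derivative may blow up on the zero set of `L`, and the majorant is a multiple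
  -- of the integrable `|L|^(q-2)`; for `q > 2` a constant suffices.
  set bound : α → ℝ := fun w => if q ≤ 2 then C * (6 * (|L w| / 2) ^ (q - 2) * C)
    else C * ((q - 1) * (C + C) ^ (q - 2) * C) with hbound
  refine tendsto_integral_filter_of_dominated_convergence bound ?_ ?_ ?_ ?_
  · filter_upwards [hRm] with t ht
    simp only [div_eq_mul_inv]
    refine hgm.mul (AEStronglyMeasurable.mul_const ?_ t⁻¹)
    exact (hψ.comp_aestronglyMeasurable (hLm.add (ht.const_mul t))).sub
      (hψ.comp_aestronglyMeasurable hLm)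
  · filter_upwards [hRC, Ioo_mem_nhdsGT (zero_lt_one' ℝ)] with t ht ht01
    have ht0 : 0 < t := ht01.1
    filter_upwards [ht, hLC, hL0, hgC] with w hRw hLw hLw0 hgw
    have hC0 : 0 ≤ C := (abs_nonneg _).trans hgw
    have habs : |t * Rt t w| = t * |Rt t w| := by rw [abs_mul, abs_of_pos ht0]
    have key : ∀ D : ℝ, 0 ≤ D → |signedPow q (L w + t * Rt t w) - signedPow q (L w)| ≤
        D * |t * Rt t w| → ‖g w * ((signedPow q (L w + t * Rt t w) - signedPow q (L w)) / t)‖ ≤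
          C * (D * C) := fun D hD h => by
      rw [norm_mul, norm_div, Real.norm_eq_abs, Real.norm_eq_abs, Real.norm_eq_abs,
        abs_of_pos ht0]
      refine mul_le_mul hgw ?_ (by positivity) hC0
      rw [div_le_iff₀ ht0]
      rw [habs] at h
      calc _ ≤ D * (t * |Rt t w|) := h
        _ ≤ D * (t * C) := by gcongr
        _ = D * C * t := by ring
    simp only [hbound]
    split_ifs with hq2
    · exact key _ (by positivity) (abs_signedPow_sub_le_of_le_two hq hq2 hLw0 _)
    · refine key _ (mul_nonneg (by linarith) (Real.rpow_nonneg (by linarith) _))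
        (abs_signedPow_sub_le_of_two_le (by linarith) ?_)
      rw [habs]
      have : t * |Rt t w| ≤ 1 * C := mul_le_mul ht01.2.le hRw (abs_nonneg _) zero_le_one
      linarith
  · by_cases hq2 : q ≤ 2
    · have : bound = fun w => (C * 6 * C * (2 : ℝ)⁻¹ ^ (q - 2)) * |L w| ^ (q - 2) := by
        funext w
        simp only [hbound, hq2, if_true]
        rw [div_eq_mul_inv, Real.mul_rpow (abs_nonneg _) (by norm_num)]
        ring
      rw [this]
      exact hLint.const_mul _
    · have : bound = fun _ => C * ((q - 1) * (C + C) ^ (q - 2) * C) := by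
        funext w
        simp only [hbound, hq2, if_false]
      rw [this]
      exact integrable_const _
  · filter_upwards [hR, hL0] with w hRw hLw0
    refine Tendsto.const_mul _ ?_
    have hder := hasDerivAt_signedPow (q := q) (Or.inl hLw0)
    have h1 : HasDerivWithinAt (fun t => L w + t * Rt t w) (R w) (Set.Ioi 0) 0 := by
      rw [hasDerivWithinAt_iff_tendsto_slope' (by simp)]
      refine hRw.congr' ?_
      filter_upwards [self_mem_nhdsWithin] with t ht
      have : t ≠ 0 := (show 0 < t from ht).ne'
      simp [slope_def_field, this]
    have h2 : HasDerivWithinAt (fun t => signedPow q (L w + t * Rt t w))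
        ((q - 1) * |L w| ^ (q - 2) * R w) (Set.Ioi 0) 0 := by
      refine HasDerivAt.comp_hasDerivWithinAt (h₂ := signedPow q) (0 : ℝ) ?_ h1
      simpa using hder
    rw [hasDerivWithinAt_iff_tendsto_slope' (by simp)] at h2
    refine h2.congr fun t => ?_
    simp [slope_def_field]

end Perturbation

section Minimizer

theorem integral_lt_integral_of_forall_lt {α : Type*} [MeasurableSpace α]
    {μ : Measure α} (hμ : μ ≠ 0) {f g : α → ℝ} (hf : Integrable f μ)
    (hg : Integrable g μ) (h : ∀ w, f w < g w) : ∫ w, f w ∂μ < ∫ w, g w ∂μ := by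
  have h0 : 0 < ∫ w, (g w - f w) ∂μ := by
    rw [integral_pos_iff_support_of_nonneg (fun w => (sub_pos.2 (h w)).le) (hg.sub hf)]
    have : (Function.support fun w => g w - f w) = Set.univ := by
      ext w
      simpa using (sub_pos.2 (h w)).ne'
    rw [this]
    simpa [pos_iff_ne_zero] using hμ
  rw [integral_sub hg hf] at h0
  linarith

variable {α : Type*} [MeasurableSpace α] {μ : Measure α} [IsFiniteMeasure μ] {q : ℝ}

theorem integrable_signedPow_sub (hq : 1 < q) {g : α → ℝ} (hgm : AEStronglyMeasurable g μ) {C : ℝ}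
    (hgC : ∀ᵐ w ∂μ, |g w| ≤ C) (c : ℝ) : Integrable (fun w => signedPow q (g w - c)) μ := by
  refine Integrable.of_bound ((continuous_signedPow hq).comp_aestronglyMeasurable
    (hgm.sub aestronglyMeasurable_const)) ((C + |c|) ^ (q - 1)) ?_
  filter_upwards [hgC] with w hw
  rw [Real.norm_eq_abs, abs_signedPow hq]
  exact Real.rpow_le_rpow (abs_nonneg _) ((abs_sub _ _).trans (by linarith)) (by linarith)

theorem integral_signedPow_strictAnti (hq : 1 < q) (hμ : μ ≠ 0) {g : α → ℝ}
    (hgm : AEStronglyMeasurable g μ) {C : ℝ} (hgC : ∀ᵐ w ∂μ, |g w| ≤ C) :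
    StrictAnti fun c => ∫ w, signedPow q (g w - c) ∂μ := fun _ _ hc =>
  integral_lt_integral_of_forall_lt hμ (integrable_signedPow_sub hq hgm hgC _)
    (integrable_signedPow_sub hq hgm hgC _)
    fun _ => strictMono_signedPow hq (sub_lt_sub_left hc _)

theorem exists_integral_signedPow_eq_zero (hq : 1 < q) {g : α → ℝ}
    (hgm : AEStronglyMeasurable g μ) {C : ℝ} (hgC : ∀ᵐ w ∂μ, |g w| ≤ C) :
    ∃ c, ∫ w, signedPow q (g w - c) ∂μ = 0 := by
  have hcont : Continuous fun c => ∫ w, signedPow q (g w - c) ∂μ := by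
    refine continuous_iff_continuousAt.2 fun c₀ => ?_
    refine continuousAt_of_dominated (bound := fun _ => (C + (|c₀| + 1)) ^ (q - 1)) ?_ ?_
      (integrable_const _) ?_
    · exact .of_forall fun c => (integrable_signedPow_sub hq hgm hgC c).aestronglyMeasurable
    · filter_upwards [Metric.ball_mem_nhds c₀ one_pos] with c hc
      filter_upwards [hgC] with w hw
      rw [Metric.mem_ball, Real.dist_eq] at hc
      rw [Real.norm_eq_abs, abs_signedPow hq]
      refine Real.rpow_le_rpow (abs_nonneg _) ((abs_sub _ _).trans ?_) (by linarith)
      have := abs_sub_abs_le_abs_sub c c₀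
      linarith
    · exact .of_forall fun w => ((continuous_signedPow hq).comp
        (continuous_const.sub continuous_id)).continuousAt
  have hle : ∫ w, signedPow q (g w - C) ∂μ ≤ 0 := by
    refine integral_nonpos_of_ae ?_
    filter_upwards [hgC] with w hw
    have : g w - C ≤ 0 := by linarith [le_abs_self (g w)]
    exact mul_nonpos_of_nonneg_of_nonpos (Real.rpow_nonneg (abs_nonneg _) _) this
  have hge : 0 ≤ ∫ w, signedPow q (g w - -C) ∂μ := by
    refine integral_nonneg_of_ae ?_
    filter_upwards [hgC] with w hw
    have : 0 ≤ g w - -C := by linarith [neg_abs_le (g w)]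
    exact mul_nonneg (Real.rpow_nonneg (abs_nonneg _) _) this
  obtain ⟨c, -, hc⟩ := isPreconnected_univ.intermediate_value (Set.mem_univ C) (Set.mem_univ (-C))
    hcont.continuousOn ⟨hle, hge⟩
  exact ⟨c, hc⟩

/-- A zero of `c ↦ ∫ ψ(g - c)` is the strict minimizer of `c ↦ ‖g - c‖` in `L^p`. -/
theorem eLpNorm_lt_of_integral_signedPow_eq_zero {p : ℝ≥0∞} (hp : 1 < p) (hp' : p ≠ ∞) (hμ : μ ≠ 0)
    {g : α → ℝ} (hgm : AEStronglyMeasurable g μ) {C : ℝ} (hgC : ∀ᵐ w ∂μ, |g w| ≤ C) {c c' : ℝ}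
    (hc : ∫ w, signedPow p.toReal (g w - c) ∂μ = 0) (hcc : c' ≠ c) :
    eLpNorm (fun w => g w - c) p μ < eLpNorm (fun w => g w - c') p μ := by
  have hq : 1 < p.toReal := by
    rw [← ENNReal.toReal_one]
    exact (ENNReal.toReal_lt_toReal ENNReal.one_ne_top hp').2 hp
  set q := p.toReal with hqdef
  have hp0 : p ≠ 0 := (zero_lt_one.trans hp).ne'
  have hm : ∀ d, AEStronglyMeasurable (fun w => g w - d) μ := fun d =>
    hgm.sub aestronglyMeasurable_const
  have hbd : ∀ d, ∀ᵐ w ∂μ, |g w - d| ≤ C + |d| := fun d => by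
    filter_upwards [hgC] with w hw
    exact (abs_sub _ _).trans (by linarith)
  have hint : ∀ d, Integrable (fun w => |g w - d| ^ q) μ := fun d =>
    integrable_abs_rpow_of_bounded (hm d) (hbd d) (by linarith)
  have hLp : ∀ d, MemLp (fun w => g w - d) p μ := fun d =>
    MemLp.of_bound (hm d) (C + |d|) (hbd d)
  -- Integrate the strict tangent inequality at `g - c` with increment `c - c'`; the linear term has
  -- integral zero by `hc`.
  have hlt : ∫ w, |g w - c| ^ q ∂μ < ∫ w, |g w - c'| ^ q ∂μ := by
    have h1 := integral_lt_integral_of_forall_lt hμ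
      ((hint c).add (((integrable_signedPow_sub hq hgm hgC c).const_mul q).mul_const (c - c')))
      (hint c') fun w => by
        have := abs_rpow_add_lt hq (g w - c) (sub_ne_zero.2 hcc.symm)
        simpa using this
    simp only [Pi.add_apply] at h1
    rw [integral_add (hint c)
      (((integrable_signedPow_sub hq hgm hgC c).const_mul q).mul_const (c - c')),
      integral_mul_const, integral_const_mul, hc] at h1
    simpa using h1
  rw [(hLp c).eLpNorm_eq_integral_rpow_norm hp0 hp', (hLp c').eLpNorm_eq_integral_rpow_norm hp0 hp']
  simp only [Real.norm_eq_abs]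
  have hnn : 0 ≤ ∫ w, |g w - c| ^ q ∂μ :=
    integral_nonneg fun w => Real.rpow_nonneg (abs_nonneg _) _
  refine (ENNReal.ofReal_lt_ofReal_iff (Real.rpow_pos_of_pos (hnn.trans_lt hlt) _)).2 ?_
  exact Real.rpow_lt_rpow hnn hlt (inv_pos.2 (by linarith))

end Minimizer

end

/-! ### Powers of linear forms, reflections and moments of the unit pseudoball -/

noncomputable section

theorem integrableOn_abs_rpow {s : ℝ} (hs : -1 < s) (M : ℝ) :
    IntegrableOn (fun y : ℝ => |y| ^ s) (Set.Icc (-M) M) := by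
  rcases lt_or_ge M 0 with hM | hM
  · rw [Set.Icc_eq_empty (by linarith)]
    exact integrableOn_empty
  have h1 : IntegrableOn (fun y : ℝ => |y| ^ s) (Set.Ioc 0 M) := by
    have := (intervalIntegrable_iff_integrableOn_Ioc_of_le hM).1
      (intervalIntegral.intervalIntegrable_rpow' (a := 0) (b := M) hs)
    refine this.congr_fun (fun y hy => ?_) measurableSet_Ioc
    simp only
    rw [abs_of_pos hy.1]
  have h2 : IntegrableOn (fun y : ℝ => |y| ^ s) (Set.Ico (-M) 0) := by
    have := ((Measure.measurePreserving_neg (volume : Measure ℝ)).integrableOn_comp_preimage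
      (Homeomorph.neg ℝ).measurableEmbedding).2 h1
    have h3 : (Neg.neg ⁻¹' Set.Ioc 0 M : Set ℝ) = Set.Ico (-M) 0 := by simp
    rw [h3] at this
    refine this.congr_fun (fun y _ => ?_) measurableSet_Ico
    simp
  have h4 : Set.Icc (-M) M ⊆ (Set.Ico (-M) 0 ∪ {0}) ∪ Set.Ioc 0 M := by
    intro y hy
    rcases lt_trichotomy y 0 with h | h | h
    · exact Or.inl (Or.inl ⟨hy.1, h⟩)
    · exact Or.inl (Or.inr h)
    · exact Or.inr ⟨h, hy.2⟩
  refine IntegrableOn.mono_set (IntegrableOn.union (IntegrableOn.union h2 ?_) h1) h4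
  exact integrableOn_singleton (hx := by rw [Real.volume_singleton]; exact ENNReal.zero_lt_top)

section LinearForm

variable {m : ℕ}

theorem continuous_dotProduct_left (a : Fin m → ℝ) : Continuous fun w => a ⬝ᵥ w :=
  continuous_finsetSum _ fun i _ => continuous_const.mul (continuous_apply i)

theorem volume_dotProduct_eq_zero {a : Fin m → ℝ} (ha : a ≠ 0) :
    volume {w | a ⬝ᵥ w = 0} = 0 := by
  set ℓ : (Fin m → ℝ) →ₗ[ℝ] ℝ := dotProductBilin ℝ ℝ a with hℓ
  have h1 : {w | a ⬝ᵥ w = 0} = (LinearMap.ker ℓ : Set (Fin m → ℝ)) := by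
    ext w
    simp [hℓ]
  rw [h1]
  refine Measure.addHaar_submodule _ _ fun h => ha ?_
  have h2 : ℓ a = 0 := by
    rw [← LinearMap.mem_ker, h]
    trivial
  exact dotProduct_self_eq_zero.1 h2

/-- A power larger than `-1` of a linear form is locally integrable. -/
theorem integrableOn_abs_dotProduct_rpow {a : Fin m → ℝ} (ha : a ≠ 0) {s : ℝ} (hs : -1 < s)
    {K : Set (Fin m → ℝ)} (hK : IsCompact K) :
    IntegrableOn (fun w => |a ⬝ᵥ w| ^ s) K := by
  obtain ⟨i₀, hi₀⟩ := Function.ne_iff.1 ha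
  -- Replace a coordinate with nonzero coefficient by the form itself. This change of variables is
  -- invertible and reduces the integral to a one-variable power on a cube.
  set T : (Fin m → ℝ) →ₗ[ℝ] (Fin m → ℝ) := LinearMap.pi fun i =>
    if i = i₀ then dotProductBilin ℝ ℝ a else LinearMap.proj i with hT
  have hTi₀ : ∀ w, T w i₀ = a ⬝ᵥ w := fun w => by simp [hT]
  have hTi : ∀ w i, i ≠ i₀ → T w i = w i := fun w i hi => by simp [hT, hi]
  have hinj : Function.Injective T := by
    refine (injective_iff_map_eq_zero T).2 fun w hw => ?_
    have h1 : ∀ i, i ≠ i₀ → w i = 0 := fun i hi => by rw [← hTi w i hi, hw]; rfl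
    have h2 : a i₀ * w i₀ = 0 := by
      have := hTi₀ w
      rw [hw, dotProduct, Finset.sum_eq_single i₀] at this
      · simpa using this.symm
      · intro i _ hi
        rw [h1 i hi, mul_zero]
      · simp
    ext i
    by_cases hi : i = i₀
    · rw [hi]
      exact (mul_eq_zero.1 h2).resolve_left hi₀
    · exact h1 i hi
  have hdet : LinearMap.det T ≠ 0 :=
    (LinearEquiv.isUnit_det' (LinearEquiv.ofInjectiveEndo T hinj)).ne_zero
  have hcont : Continuous T := T.continuous_of_finiteDimensional
  have hemb : MeasurableEmbedding T := by
    exact ((LinearEquiv.ofInjectiveEndo T hinj).toContinuousLinearEquiv.toHomeomorph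
      |>.measurableEmbedding)
  obtain ⟨M, hM⟩ := (hK.image hcont).isBounded.subset_closedBall 0
  set cube : Set (Fin m → ℝ) := Set.univ.pi fun _ => Set.Icc (-M) M with hcube
  have hsub : K ⊆ T ⁻¹' cube := by
    intro w hw i _
    have h1 := hM (Set.mem_image_of_mem T hw)
    rw [mem_closedBall_zero_iff] at h1
    exact abs_le.1 ((norm_le_pi_norm (T w) i).trans h1)
  have hcubeint : IntegrableOn (fun y : Fin m → ℝ => |y i₀| ^ s) cube := by
    have h1 : (volume : Measure (Fin m → ℝ)).restrict cube =
        Measure.pi fun _ => (volume : Measure ℝ).restrict (Set.Icc (-M) M) := by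
      rw [volume_pi, hcube]
      exact Measure.restrict_pi_pi (fun _ : Fin m => (volume : Measure ℝ)) fun _ => Set.Icc (-M) M
    rw [IntegrableOn, h1]
    have h2 : (fun y : Fin m → ℝ => |y i₀| ^ s) =
        fun y => ∏ i, (fun (i : Fin m) (t : ℝ) => if i = i₀ then |t| ^ s else 1) i (y i) := by
      funext y
      rw [Finset.prod_eq_single i₀]
      · simp
      · intro i _ hi
        simp [hi]
      · simp
    rw [h2]
    refine Integrable.fintype_prod (μ := fun _ : Fin m => (volume : Measure ℝ).restrict (Set.Icc (-M) M))
      (f := fun (i : Fin m) (t : ℝ) => if i = i₀ then |t| ^ s else 1) fun i => ?_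
    by_cases hi : i = i₀
    · simp only [hi, if_true]
      exact integrableOn_abs_rpow hs M
    · simp only [hi, if_false]
      exact integrable_const _
  refine IntegrableOn.mono_set ?_ hsub
  have h3 : (fun w => |a ⬝ᵥ w| ^ s) = (fun y : Fin m → ℝ => |y i₀| ^ s) ∘ T :=
    funext fun w => by rw [Function.comp_apply, hTi₀]
  rw [h3, ← hemb.integrableOn_map_iff, Measure.map_linearMap_addHaar_eq_smul_addHaar _ hdet]
  rw [IntegrableOn, Measure.restrict_smul]
  exact hcubeint.smul_measure ENNReal.ofReal_ne_top

/-- The orthogonal reflection in the hyperplane orthogonal to `v`. -/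
def reflect (v : Fin m → ℝ) : (Fin m → ℝ) →ₗ[ℝ] (Fin m → ℝ) :=
  LinearMap.id - (dotProductBilin ℝ ℝ v).smulRight ((2 / (v ⬝ᵥ v)) • v)

theorem reflect_apply (v w : Fin m → ℝ) : reflect v w = w - (2 * (v ⬝ᵥ w) / (v ⬝ᵥ v)) • v := by
  change w - (v ⬝ᵥ w) • (2 / (v ⬝ᵥ v)) • v = _
  rw [smul_smul]
  congr 2
  ring

/-- It holds for `v = 0` as well, where division by zero makes the reflection the identity, so the
facts about reflections need no hypothesis on `v`. -/
theorem reflect_coeff_mul (v w : Fin m → ℝ) :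
    2 * (v ⬝ᵥ w) / (v ⬝ᵥ v) * (v ⬝ᵥ v) = 2 * (v ⬝ᵥ w) := by
  rcases eq_or_ne v 0 with rfl | hv
  · simp
  · exact div_mul_cancel₀ _ fun h => hv (dotProduct_self_eq_zero.1 h)

theorem dotProduct_reflect_self (v w : Fin m → ℝ) : v ⬝ᵥ reflect v w = -(v ⬝ᵥ w) := by
  rw [reflect_apply, dotProduct_sub, dotProduct_smul, smul_eq_mul, reflect_coeff_mul]
  ring

theorem dotProduct_reflect_of_orthogonal {u v : Fin m → ℝ} (h : u ⬝ᵥ v = 0) (w : Fin m → ℝ) :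
    u ⬝ᵥ reflect v w = u ⬝ᵥ w := by
  rw [reflect_apply, dotProduct_sub, dotProduct_smul, h, smul_zero, sub_zero]

theorem reflect_reflect (v w : Fin m → ℝ) : reflect v (reflect v w) = w := by
  rw [reflect_apply v (reflect v w), dotProduct_reflect_self, reflect_apply]
  module

theorem measurePreserving_reflect (v : Fin m → ℝ) : MeasurePreserving (reflect v) := by
  have h1 : LinearMap.det (reflect v) * LinearMap.det (reflect v) = 1 := by
    rw [← LinearMap.det_comp]
    have : reflect v ∘ₗ reflect v = LinearMap.id := LinearMap.ext (reflect_reflect v)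
    rw [this, LinearMap.det_id]
  have h2 : LinearMap.det (reflect v) ≠ 0 := left_ne_zero_of_mul_eq_one h1
  refine ⟨(reflect v).continuous_of_finiteDimensional.measurable, ?_⟩
  rw [Measure.map_linearMap_addHaar_eq_smul_addHaar _ h2]
  rcases mul_self_eq_one_iff.1 h1 with h | h <;> simp [h]

end LinearForm

namespace CarnotGroup

variable {𝔤 : Type*} [LieRing 𝔤] [LieAlgebra ℝ 𝔤] {m k : ℕ} (G : CarnotGroup 𝔤 m k)

/-- A reflection along a vector of a single stratum is orthogonal on that stratum and trivial on the
others, so it preserves every layer norm. -/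
theorem gauge_reflect {v : Fin m → ℝ} {j : ℕ} (hv : ∀ i, G.σ i ≠ j → v i = 0) (w : Fin m → ℝ) :
    G.gauge (reflect v w) = G.gauge w := by
  have h : ∀ l, G.layerNorm (reflect v w) l = G.layerNorm w l := by
    intro l
    rw [layerNorm, layerNorm]
    congr 1
    set c := 2 * (v ⬝ᵥ w) / (v ⬝ᵥ v) with hc
    have hi : ∀ i, reflect v w i = w i - c * v i := fun i => by rw [reflect_apply]; rfl
    by_cases hl : l = j
    · have h1 : ∀ u : Fin m → ℝ, ∑ i with G.σ i = l, v i * u i = v ⬝ᵥ u := fun u => by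
        rw [Finset.sum_filter, dotProduct]
        refine Finset.sum_congr rfl fun i _ => ?_
        split_ifs with h2
        · rfl
        · rw [hv i (by rwa [← hl]), zero_mul]
      have h2 : ∑ i with G.σ i = l, reflect v w i ^ 2 =
          ∑ i with G.σ i = l, w i ^ 2 - 2 * c * ∑ i with G.σ i = l, v i * w i +
            c * (c * ∑ i with G.σ i = l, v i * v i) := by
        rw [Finset.mul_sum, Finset.mul_sum, Finset.mul_sum, ← Finset.sum_sub_distrib,
          ← Finset.sum_add_distrib]
        refine Finset.sum_congr rfl fun i _ => ?_
        rw [hi]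
        ring
      rw [h2, h1, h1, hc, reflect_coeff_mul]
      ring
    · refine Finset.sum_congr rfl fun i h2 => ?_
      rw [hi, hv i (by rw [(Finset.mem_filter.1 h2).2]; exact hl), mul_zero, sub_zero]
  rw [gauge, gauge]
  simp only [h]

theorem setIntegral_reflect_eq_zero {v : Fin m → ℝ} {j : ℕ} (hv : ∀ i, G.σ i ≠ j → v i = 0)
    {g : (Fin m → ℝ) → ℝ} (hg : ∀ w, g (reflect v w) = -g w) : ∫ w in G.unitBall, g w = 0 := by
  have hpre : reflect v ⁻¹' G.unitBall = G.unitBall := by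
    ext w
    rw [Set.mem_preimage, unitBall, Set.mem_ofPred_eq, Set.mem_ofPred_eq, G.gauge_reflect hv]
  have hemb : MeasurableEmbedding (reflect v) :=
    (LinearEquiv.ofInvolutive (reflect v) (reflect_reflect v)).toContinuousLinearEquiv
      |>.toHomeomorph.measurableEmbedding
  have h := (measurePreserving_reflect v).setIntegral_preimage_emb hemb g G.unitBall
  rw [hpre] at h
  simp only [hg] at h
  rw [integral_neg] at h
  linarith

theorem setIntegral_odd_eq_zero {g : (Fin m → ℝ) → ℝ} (hg : ∀ w, g (-w) = -g w) :
    ∫ w in G.unitBall, g w = 0 := by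
  have hpre : Neg.neg ⁻¹' G.unitBall = G.unitBall := by
    ext w
    rw [Set.mem_preimage, unitBall, Set.mem_ofPred_eq, Set.mem_ofPred_eq, gauge_neg]
  have h := (Measure.measurePreserving_neg (volume : Measure (Fin m → ℝ))).setIntegral_preimage_emb
    (Homeomorph.neg (Fin m → ℝ)).measurableEmbedding g G.unitBall
  rw [hpre] at h
  simp only [hg] at h
  rw [integral_neg] at h
  linarith

section Moments

variable {G} {a : Fin m → ℝ} {q : ℝ}

theorem integrable_abs_rpow_mul (ha : a ≠ 0) (hq : 1 < q) {h : (Fin m → ℝ) → ℝ}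
    (hh : Continuous h) : IntegrableOn (fun w => |a ⬝ᵥ w| ^ (q - 2) * h w) G.unitBall :=
  (integrableOn_abs_dotProduct_rpow ha (by linarith) G.isCompact_unitBall).mul_continuousOn
    hh.continuousOn G.isCompact_unitBall

theorem integrable_signedPow_mul (hq : 1 < q) {f h : (Fin m → ℝ) → ℝ} (hf : Continuous f)
    (hh : Continuous h) : IntegrableOn (fun w => signedPow q (f w) * h w) G.unitBall :=
  ((continuous_signedPow hq).comp hf |>.mul hh).continuousOn.integrableOn_compact
    G.isCompact_unitBall

theorem ae_dotProduct_ne_zero (ha : a ≠ 0) :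
    ∀ᵐ w ∂volume.restrict G.unitBall, a ⬝ᵥ w ≠ 0 := by
  refine ae_restrict_of_ae ?_
  rw [ae_iff]
  simpa using volume_dotProduct_eq_zero ha

theorem isFiniteMeasure_unitBall : IsFiniteMeasure (volume.restrict G.unitBall) :=
  ⟨by rw [Measure.restrict_apply_univ]; exact G.volume_unitBall_lt_top⟩

theorem ae_bounded_unitBall {f : (Fin m → ℝ) → ℝ} (hf : Continuous f) :
    ∃ C, 0 ≤ C ∧ ∀ᵐ w ∂volume.restrict G.unitBall, |f w| ≤ C := by
  obtain ⟨C, hC⟩ := G.isCompact_unitBall.exists_bound_of_continuousOn hf.continuousOn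
  refine ⟨max C 0, le_max_right _ _, ?_⟩
  filter_upwards [ae_restrict_mem G.isCompact_unitBall.measurableSet] with w hw
  exact (hC w hw).trans (le_max_left _ _)

/-- The reflection along `v` fixes `b ⬝ᵥ w` and changes the sign of `v ⬝ᵥ w`. -/
theorem integral_signedPow_mul_of_orthogonal {b v : Fin m → ℝ} {j : ℕ}
    (hv : ∀ i, G.σ i ≠ j → v i = 0) (hbv : b ⬝ᵥ v = 0) :
    ∫ w in G.unitBall, signedPow q (b ⬝ᵥ w) * (v ⬝ᵥ w) = 0 :=
  G.setIntegral_reflect_eq_zero hv fun w => by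
    rw [dotProduct_reflect_of_orthogonal hbv, dotProduct_reflect_self, mul_neg]

/-- The weighted second moments in directions orthogonal to `a`. -/
theorem integral_moment_orthogonal (ha : a ≠ 0) (hq : 1 < q) {v v' : Fin m → ℝ}
    (haG : ∀ i, G.σ i ≠ 1 → a i = 0) (hv' : ∀ i, G.σ i ≠ 1 → v' i = 0)
    (hav : a ⬝ᵥ v = 0) (hav' : a ⬝ᵥ v' = 0) :
    (q - 1) * ∫ w in G.unitBall, |a ⬝ᵥ w| ^ (q - 2) * ((v ⬝ᵥ w) * (v' ⬝ᵥ w)) =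
      (v ⬝ᵥ v') / (a ⬝ᵥ a) * ∫ w in G.unitBall, |a ⬝ᵥ w| ^ q := by
  have : IsFiniteMeasure (volume.restrict G.unitBall) := isFiniteMeasure_unitBall
  have hN : a ⬝ᵥ a ≠ 0 := fun h => ha (dotProduct_self_eq_zero.1 h)
  set c := (v ⬝ᵥ v') / (a ⬝ᵥ a) with hc
  have hcont := fun u : Fin m → ℝ => continuous_dotProduct_left u
  obtain ⟨C₁, hC₁0, hC₁⟩ := ae_bounded_unitBall (G := G) (hcont a)
  obtain ⟨C₂, hC₂0, hC₂⟩ := ae_bounded_unitBall (G := G) (hcont v)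
  obtain ⟨C₃, hC₃0, hC₃⟩ := ae_bounded_unitBall (G := G) (hcont v')
  set C := C₁ + C₂ + C₃ with hC
  -- The moment is obtained by differentiating `t ↦ ∫ ψ((a + t v) ⬝ᵥ w) (v' ⬝ᵥ w)` at `0`, with `ψ =
  -- signedPow q`; symmetry then evaluates the difference quotient without polar coordinates.
  have hlim : ∀ u : Fin m → ℝ, (∀ᵐ w ∂volume.restrict G.unitBall, |u ⬝ᵥ w| ≤ C) →
      Tendsto (fun t => ∫ w in G.unitBall, (u ⬝ᵥ w) *
        ((signedPow q (a ⬝ᵥ w + t * (v ⬝ᵥ w)) - signedPow q (a ⬝ᵥ w)) / t)) (𝓝[>] 0)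
        (𝓝 (∫ w in G.unitBall, (u ⬝ᵥ w) * ((q - 1) * |a ⬝ᵥ w| ^ (q - 2) * (v ⬝ᵥ w)))) := by
    intro u hu
    refine tendsto_integral_signedPow_sub (C := C) hq (hcont a).aestronglyMeasurable
      (hC₁.mono fun w hw => by linarith) (ae_dotProduct_ne_zero ha) ?_
      (hcont u).aestronglyMeasurable hu (.of_forall fun t => (hcont v).aestronglyMeasurable)
      (.of_forall fun t => hC₂.mono fun w hw => by linarith)
      (.of_forall fun w => tendsto_const_nhds)
    exact integrableOn_abs_dotProduct_rpow ha (by linarith) G.isCompact_unitBall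
  have hsplit : ∀ u : Fin m → ℝ, ∀ t : ℝ, ∫ w in G.unitBall, (u ⬝ᵥ w) *
        ((signedPow q (a ⬝ᵥ w + t * (v ⬝ᵥ w)) - signedPow q (a ⬝ᵥ w)) / t) =
      ((∫ w in G.unitBall, signedPow q ((a + t • v) ⬝ᵥ w) * (u ⬝ᵥ w)) -
        ∫ w in G.unitBall, signedPow q (a ⬝ᵥ w) * (u ⬝ᵥ w)) / t := by
    intro u t
    rw [← integral_sub (integrable_signedPow_mul hq (hcont _) (hcont _))
      (integrable_signedPow_mul hq (hcont _) (hcont _)), ← integral_div]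
    refine integral_congr_ae (.of_forall fun w => ?_)
    simp only [add_dotProduct, smul_dotProduct, smul_eq_mul]
    ring
  have hK : ∫ w in G.unitBall, signedPow q (a ⬝ᵥ w) * (a ⬝ᵥ w) =
      ∫ w in G.unitBall, |a ⬝ᵥ w| ^ q :=
    integral_congr_ae (.of_forall fun w => signedPow_mul_self (by linarith) _)
  have hLa : Tendsto (fun t : ℝ => ∫ w in G.unitBall, signedPow q ((a + t • v) ⬝ᵥ w) * (a ⬝ᵥ w))
      (𝓝[>] 0) (𝓝 (∫ w in G.unitBall, |a ⬝ᵥ w| ^ q)) := by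
    have h1 := hlim a (hC₁.mono fun w hw => by linarith)
    have h0 : Tendsto (fun t : ℝ => t) (𝓝[>] 0) (𝓝 0) := nhdsWithin_le_nhds
    have h2 := (h0.mul h1).add_const (∫ w in G.unitBall, |a ⬝ᵥ w| ^ q)
    rw [zero_mul, zero_add] at h2
    refine h2.congr' ?_
    filter_upwards [self_mem_nhdsWithin] with t ht
    have ht0 : t ≠ 0 := (show 0 < t from ht).ne'
    rw [hsplit, hK, mul_div_cancel₀ _ ht0]
    ring
  have hlim' := hlim v' (hC₃.mono fun w hw => by linarith)
  -- The choice of `c` makes `v' - t c a` orthogonal to `a + t v`, so that `v'` may be replaced by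
  -- `t c a` in the integral.
  have heq : ∀ᶠ t in 𝓝[>] (0 : ℝ), c * ∫ w in G.unitBall, signedPow q ((a + t • v) ⬝ᵥ w) * (a ⬝ᵥ w) =
      ∫ w in G.unitBall, (v' ⬝ᵥ w) *
        ((signedPow q (a ⬝ᵥ w + t * (v ⬝ᵥ w)) - signedPow q (a ⬝ᵥ w)) / t) := by
    filter_upwards [self_mem_nhdsWithin] with t ht
    have ht0 : t ≠ 0 := (show 0 < t from ht).ne'
    have h1 : ∫ w in G.unitBall, signedPow q ((a + t • v) ⬝ᵥ w) * ((v' - (t * c) • a) ⬝ᵥ w) = 0 := by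
      refine integral_signedPow_mul_of_orthogonal (j := 1) (fun i hi => ?_) ?_
      · simp [haG i hi, hv' i hi]
      · rw [dotProduct_sub, dotProduct_smul, add_dotProduct, add_dotProduct, smul_dotProduct,
          smul_dotProduct, hav', dotProduct_comm v a, hav, hc]
        simp only [smul_eq_mul]
        field_simp
        ring
    have h2 : ∫ w in G.unitBall, signedPow q ((a + t • v) ⬝ᵥ w) * ((v' - (t * c) • a) ⬝ᵥ w) =
        (∫ w in G.unitBall, signedPow q ((a + t • v) ⬝ᵥ w) * (v' ⬝ᵥ w)) -
        t * c * ∫ w in G.unitBall, signedPow q ((a + t • v) ⬝ᵥ w) * (a ⬝ᵥ w) := by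
      rw [← integral_const_mul, ← integral_sub (integrable_signedPow_mul hq (hcont _) (hcont _))
        ((integrable_signedPow_mul hq (hcont _) (hcont _)).const_mul _)]
      refine integral_congr_ae (.of_forall fun w => ?_)
      simp only [sub_dotProduct, smul_dotProduct, smul_eq_mul]
      ring
    have h3 : ∫ w in G.unitBall, signedPow q (a ⬝ᵥ w) * (v' ⬝ᵥ w) = 0 :=
      integral_signedPow_mul_of_orthogonal hv' hav'
    rw [hsplit, h3, sub_zero, eq_div_iff ht0]
    linarith
  have h4 := tendsto_nhds_unique (hlim'.congr' (heq.mono fun t ht => ht.symm)) (hLa.const_mul c)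
  rw [← h4, ← integral_const_mul]
  refine integral_congr_ae (.of_forall fun w => ?_)
  simp only
  ring

theorem integral_abs_rpow_pos (ha : a ≠ 0) {s : ℝ} (hs : -1 < s) :
    0 < ∫ w in G.unitBall, |a ⬝ᵥ w| ^ s := by
  rw [integral_pos_iff_support_of_nonneg (fun w => Real.rpow_nonneg (abs_nonneg _) _)
    (integrableOn_abs_dotProduct_rpow ha hs G.isCompact_unitBall)]
  have h1 : {w | a ⬝ᵥ w ≠ 0} ⊆ Function.support fun w => |a ⬝ᵥ w| ^ s := fun w hw =>
    (Real.rpow_pos_of_pos (abs_pos.2 hw) s).ne'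
  refine lt_of_lt_of_le ?_ (measure_mono h1)
  have h2 : volume.restrict G.unitBall {w | a ⬝ᵥ w ≠ 0}ᶜ = 0 := ae_dotProduct_ne_zero ha
  rw [measure_of_measure_compl_eq_zero h2, Measure.restrict_apply_univ]
  exact G.volume_unitBall_pos

/-- The weighted second moments of the unit pseudoball in horizontal directions. -/
theorem integral_moment (ha : a ≠ 0) (hq : 1 < q) (haG : ∀ i, G.σ i ≠ 1 → a i = 0) {i j : Fin m}
    (hi : G.σ i = 1) (hj : G.σ j = 1) :
    ∫ w in G.unitBall, |a ⬝ᵥ w| ^ (q - 2) * (w i * w j) =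
      (∫ w in G.unitBall, |a ⬝ᵥ w| ^ q) / ((q - 1) * (a ⬝ᵥ a)) *
        ((if i = j then 1 else 0) + (q - 2) * (a i * a j) / (a ⬝ᵥ a)) := by
  have hN : a ⬝ᵥ a ≠ 0 := fun h => ha (dotProduct_self_eq_zero.1 h)
  have hq1 : q - 1 ≠ 0 := by linarith
  set N := a ⬝ᵥ a with hNdef
  set K := ∫ w in G.unitBall, |a ⬝ᵥ w| ^ q with hK
  -- Split each coordinate direction into its parts along and orthogonal to `a`; mixed moments
  -- vanish by reflection.
  set v : Fin m → Fin m → ℝ := fun i => Pi.single i 1 - (a i / N) • a with hv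
  have hvG : ∀ l, G.σ l = 1 → ∀ i, G.σ i ≠ 1 → v l i = 0 := fun l hl i hi => by
    have : i ≠ l := fun h => hi (h ▸ hl)
    simp [hv, haG i hi, this]
  have hav : ∀ l, a ⬝ᵥ v l = 0 := fun l => by
    simp only [hv]
    rw [dotProduct_sub, dotProduct_smul, dotProduct_single_one, smul_eq_mul,
      div_mul_cancel₀ _ hN, sub_self]
  have hw : ∀ l (w : Fin m → ℝ), w l = v l ⬝ᵥ w + a l / N * (a ⬝ᵥ w) := fun l w => by
    simp only [hv]
    rw [sub_dotProduct, smul_dotProduct, single_one_dotProduct, smul_eq_mul]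
    ring
  have hvv : v i ⬝ᵥ v j = (if i = j then 1 else 0) - a i * a j / N := by
    have : v i ⬝ᵥ v j = v j i - a i / N * (a ⬝ᵥ v j) := by
      nth_rewrite 1 [hv]
      simp only
      rw [sub_dotProduct, smul_dotProduct, single_one_dotProduct, smul_eq_mul]
    rw [this, hav, mul_zero, sub_zero]
    simp only [hv, Pi.sub_apply, Pi.smul_apply, smul_eq_mul, Pi.single_apply]
    ring
  have hcont := fun u : Fin m → ℝ => continuous_dotProduct_left u
  have h1 := integral_moment_orthogonal (G := G) ha hq haG (hvG j hj) (hav i) (hav j)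
  have h2 : ∀ l, G.σ l = 1 →
      ∫ w in G.unitBall, |a ⬝ᵥ w| ^ (q - 2) * ((a ⬝ᵥ w) * (v l ⬝ᵥ w)) = 0 := fun l hl => by
    rw [← integral_signedPow_mul_of_orthogonal (G := G) (q := q) (hvG l hl) (hav l)]
    refine integral_congr_ae (.of_forall fun w => ?_)
    simp only [signedPow]
    ring
  have h3 : ∫ w in G.unitBall, |a ⬝ᵥ w| ^ (q - 2) * ((a ⬝ᵥ w) * (a ⬝ᵥ w)) = K := by
    refine integral_congr_ae (.of_forall fun w => ?_)
    have := signedPow_mul_self (by linarith : q ≠ 0) (a ⬝ᵥ w)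
    simp only [signedPow] at this
    simp only
    rw [← this]
    ring
  have hint : ∀ u u' : Fin m → ℝ, Integrable
      (fun w => |a ⬝ᵥ w| ^ (q - 2) * ((u ⬝ᵥ w) * (u' ⬝ᵥ w))) (volume.restrict G.unitBall) :=
    fun u u' => integrable_abs_rpow_mul ha hq ((hcont u).mul (hcont u'))
  have h4 : ∫ w in G.unitBall, |a ⬝ᵥ w| ^ (q - 2) * (w i * w j) =
      (∫ w in G.unitBall, |a ⬝ᵥ w| ^ (q - 2) * ((v i ⬝ᵥ w) * (v j ⬝ᵥ w))) +
      a j / N * (∫ w in G.unitBall, |a ⬝ᵥ w| ^ (q - 2) * ((a ⬝ᵥ w) * (v i ⬝ᵥ w))) +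
      a i / N * (∫ w in G.unitBall, |a ⬝ᵥ w| ^ (q - 2) * ((a ⬝ᵥ w) * (v j ⬝ᵥ w))) +
      a i / N * (a j / N) * ∫ w in G.unitBall, |a ⬝ᵥ w| ^ (q - 2) * ((a ⬝ᵥ w) * (a ⬝ᵥ w)) := by
    have e1 := (hint (v i) (v j)).add ((hint a (v i)).const_mul (a j / N))
    have e2 := e1.add ((hint a (v j)).const_mul (a i / N))
    rw [← integral_const_mul, ← integral_const_mul, ← integral_const_mul,
      ← integral_add (hint _ _) ((hint _ _).const_mul _)]
    refine Eq.trans ?_ (congrArg (· + _) (integral_add e1 ((hint a (v j)).const_mul (a i / N))))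
    refine Eq.trans ?_ (integral_add e2 ((hint a a).const_mul (a i / N * (a j / N))))
    refine integral_congr_ae (.of_forall fun w => ?_)
    simp only
    rw [hw i w, hw j w]
    ring
  rw [h4, h2 i hi, h2 j hj, h3]
  have h5 : ∫ w in G.unitBall, |a ⬝ᵥ w| ^ (q - 2) * ((v i ⬝ᵥ w) * (v j ⬝ᵥ w)) =
      (v i ⬝ᵥ v j) / N * K / (q - 1) := by
    rw [eq_div_iff hq1, mul_comm]
    exact h1
  rw [h5, hvv]
  field_simp
  ring

theorem integral_moment_vertical {i : Fin m} (hi : G.σ i ≠ 1)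
    (haG : ∀ i, G.σ i ≠ 1 → a i = 0) :
    ∫ w in G.unitBall, |a ⬝ᵥ w| ^ (q - 2) * w i = 0 := by
  refine G.setIntegral_reflect_eq_zero (v := Pi.single i 1) (j := G.σ i) (fun l hl => ?_)
    fun w => ?_
  · have : l ≠ i := fun h => hl (by rw [h])
    simp [this]
  · have h1 : a ⬝ᵥ Pi.single i 1 = 0 := by rw [dotProduct_single_one, haG i hi]
    have h2 := dotProduct_reflect_self (Pi.single i 1) w
    rw [single_one_dotProduct, single_one_dotProduct] at h2
    rw [dotProduct_reflect_of_orthogonal h1, h2, mul_neg]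

end Moments

end CarnotGroup

end

/-! ### Second order asymptotics of the minimizer and rescaling to the unit pseudoball -/

noncomputable section

section Perturbation

variable {α : Type*} [MeasurableSpace α] {μ : Measure α} [IsFiniteMeasure μ] {q : ℝ}

/-- With the trial constant `f₀ + t² l` the integrand is `ψ(t (L + t R_t))`, where `ψ = signedPow q`
and `R_t → Q - l` uniformly on `S`. Homogeneity extracts `t^(q-1)`, the leading integral vanishes by
`hLodd`, and the next order is the linearization. -/
theorem tendsto_integral_signedPow_expansion (hq : 1 < q) {L Q : α → ℝ} {g : ℝ → α → ℝ} {S : Set α}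
    {C f₀ : ℝ} (hS : ∀ᵐ w ∂μ, w ∈ S) (hLm : AEStronglyMeasurable L μ) (hLC : ∀ w ∈ S, |L w| ≤ C)
    (hQC : ∀ w ∈ S, |Q w| ≤ C) (hL0 : ∀ᵐ w ∂μ, L w ≠ 0)
    (hLint : Integrable (fun w => |L w| ^ (q - 2)) μ) (hLodd : ∫ w, signedPow q (L w) ∂μ = 0)
    (hgm : ∀ᶠ t in 𝓝[>] (0 : ℝ), AEStronglyMeasurable (g t) μ)
    (hexp : ∀ δ > 0, ∀ᶠ t in 𝓝[>] (0 : ℝ), ∀ w ∈ S,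
      |g t w - f₀ - t * L w - t ^ 2 * Q w| ≤ δ * t ^ 2) (l : ℝ) :
    Tendsto (fun t => (∫ w, signedPow q (g t w - (f₀ + t ^ 2 * l)) ∂μ) / t ^ (q - 1) / t) (𝓝[>] 0)
      (𝓝 ((q - 1) * ∫ w, |L w| ^ (q - 2) * (Q w - l) ∂μ)) := by
  set Rt : ℝ → α → ℝ := fun t w => (g t w - f₀ - t * L w) / t ^ 2 - l with hRt
  have hbd : ∀ δ > 0, ∀ᶠ t in 𝓝[>] (0 : ℝ), ∀ w ∈ S, |Rt t w - (Q w - l)| ≤ δ := by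
    intro δ hδ
    filter_upwards [hexp δ hδ, self_mem_nhdsWithin] with t ht ht0 w hw
    have ht0' : 0 < t := ht0
    have ht2 : 0 < t ^ 2 := by positivity
    have h1 : Rt t w - (Q w - l) = (g t w - f₀ - t * L w - t ^ 2 * Q w) / t ^ 2 := by
      simp only [hRt]
      field_simp
      ring
    rw [h1, abs_div, abs_of_pos ht2, div_le_iff₀ ht2]
    exact ht w hw
  have hlim := tendsto_integral_signedPow_sub (μ := μ) (g := fun _ => 1) (R := fun w => Q w - l)
    (Rt := Rt) (C := C + |l| + 1 + |C|) hq hLm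
    (hS.mono fun w hw => (hLC w hw).trans (by linarith [abs_nonneg l, abs_nonneg C])) hL0 hLint
    aestronglyMeasurable_const
    (.of_forall fun w => by
      rw [abs_one]
      linarith [abs_nonneg l, neg_abs_le C])
    (hgm.mono fun t ht => by
      simp only [hRt, div_eq_mul_inv]
      exact (((ht.sub aestronglyMeasurable_const).sub (hLm.const_mul t)).mul_const _).sub
        aestronglyMeasurable_const)
    ((hbd 1 one_pos).mono fun t ht => hS.mono fun w hw => by
      have h1 := ht w hw
      have h2 := hQC w hw
      have h3 := abs_add_le (Rt t w - (Q w - l)) (Q w - l)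
      rw [sub_add_cancel] at h3
      have h4 := abs_sub (Q w) l
      linarith [abs_nonneg C])
    (hS.mono fun w hw => by
      rw [Metric.tendsto_nhds]
      intro δ hδ
      filter_upwards [hbd (δ / 2) (half_pos hδ)] with t ht
      rw [Real.dist_eq]
      exact (ht w hw).trans_lt (half_lt_self hδ))
  have h2 : ∫ w, 1 * ((q - 1) * |L w| ^ (q - 2) * (Q w - l)) ∂μ =
      (q - 1) * ∫ w, |L w| ^ (q - 2) * (Q w - l) ∂μ := by
    rw [← integral_const_mul]
    exact integral_congr_ae (.of_forall fun w => by simp only; ring)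
  rw [h2] at hlim
  refine hlim.congr' ?_
  have hCL : ∀ᵐ w ∂μ, |L w - 0| ≤ C := hS.mono fun w hw => by simpa using hLC w hw
  filter_upwards [hgm, hbd 1 one_pos, self_mem_nhdsWithin] with t htm htb ht0
  have ht0' : 0 < t := ht0
  have h3 : ∀ w, g t w - (f₀ + t ^ 2 * l) = t * (L w + t * Rt t w) := fun w => by
    simp only [hRt]
    field_simp
    ring
  have hm : AEStronglyMeasurable (fun w => L w + t * Rt t w) μ := by
    refine hLm.add (AEStronglyMeasurable.const_mul ?_ t)
    simp only [hRt, div_eq_mul_inv]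
    exact (((htm.sub aestronglyMeasurable_const).sub (hLm.const_mul t)).mul_const _).sub
      aestronglyMeasurable_const
  have hb : ∀ᵐ w ∂μ, |L w + t * Rt t w| ≤ C + t * (C + |l| + 1) := hS.mono fun w hw => by
    have h1 := htb w hw
    have h2 := hQC w hw
    have h3 := abs_add_le (Rt t w - (Q w - l)) (Q w - l)
    rw [sub_add_cancel] at h3
    have h4 := abs_sub (Q w) l
    refine (abs_add_le _ _).trans (add_le_add (hLC w hw) ?_)
    rw [abs_mul, abs_of_pos ht0']
    exact mul_le_mul_of_nonneg_left (by linarith) ht0'.le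
  have i1 := integrable_signedPow_sub hq hm hb 0
  have i2 := integrable_signedPow_sub hq hLm (C := C) (hS.mono hLC) 0
  simp only [sub_zero] at i1 i2
  have hpow : t ^ (q - 1) ≠ 0 := (Real.rpow_pos_of_pos ht0' _).ne'
  simp only [one_mul]
  rw [integral_div, integral_sub i1 i2, hLodd, sub_zero]
  simp only [h3, signedPow_mul_of_pos ht0']
  rw [integral_const_mul, mul_div_cancel_left₀ _ hpow]

/-- The limit at the trial value `l` is a positive multiple of `l₀ - l`. At `l₀ ± δ` the integral
thus has a definite sign for small `t`, and strict monotonicity in the constant traps the zero `M t`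
between the two trial constants. -/
theorem isLittleO_of_integral_signedPow_eq_zero (hq : 1 < q) {L Q : α → ℝ} {g : ℝ → α → ℝ}
    {S : Set α} {C f₀ : ℝ} {M : ℝ → ℝ} (hμ : μ ≠ 0) (hS : ∀ᵐ w ∂μ, w ∈ S)
    (hLm : AEStronglyMeasurable L μ)
    (hLC : ∀ w ∈ S, |L w| ≤ C) (hQC : ∀ w ∈ S, |Q w| ≤ C) (hL0 : ∀ᵐ w ∂μ, L w ≠ 0)
    (hLint : Integrable (fun w => |L w| ^ (q - 2)) μ) (hLpos : 0 < ∫ w, |L w| ^ (q - 2) ∂μ)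
    (hQint : Integrable (fun w => |L w| ^ (q - 2) * Q w) μ) (hLodd : ∫ w, signedPow q (L w) ∂μ = 0)
    (hgm : ∀ᶠ t in 𝓝[>] (0 : ℝ), AEStronglyMeasurable (g t) μ)
    (hexp : ∀ δ > 0, ∀ᶠ t in 𝓝[>] (0 : ℝ), ∀ w ∈ S,
      |g t w - f₀ - t * L w - t ^ 2 * Q w| ≤ δ * t ^ 2)
    (hM : ∀ᶠ t in 𝓝[>] (0 : ℝ), ∫ w, signedPow q (g t w - M t) ∂μ = 0) :
    (fun t => M t - f₀ - t ^ 2 * ((∫ w, |L w| ^ (q - 2) * Q w ∂μ) / ∫ w, |L w| ^ (q - 2) ∂μ))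
      =o[𝓝[>] 0] fun t => t ^ 2 := by
  set D := ∫ w, |L w| ^ (q - 2) ∂μ with hD
  set l₀ := (∫ w, |L w| ^ (q - 2) * Q w ∂μ) / D with hl₀
  have hval : ∀ l, (q - 1) * ∫ w, |L w| ^ (q - 2) * (Q w - l) ∂μ = (q - 1) * (D * (l₀ - l)) := by
    intro l
    simp only [mul_sub]
    rw [integral_sub hQint (hLint.mul_const l), integral_mul_const, hl₀, mul_div_cancel₀ _ hLpos.ne',
      ← hD]
    ring
  have hlim := fun l => hval l ▸
    tendsto_integral_signedPow_expansion hq hS hLm hLC hQC hL0 hLint hLodd hgm hexp l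
  have hanti : ∀ᶠ t in 𝓝[>] (0 : ℝ), StrictAnti fun c => ∫ w, signedPow q (g t w - c) ∂μ := by
    filter_upwards [hgm, hexp 1 one_pos] with t htm hte
    refine integral_signedPow_strictAnti hq hμ htm (C := 1 * t ^ 2 + |f₀| + |t| * C + t ^ 2 * C) ?_
    filter_upwards [hS] with w hw
    have h1 := hte w hw
    have h2 : g t w = (g t w - f₀ - t * L w - t ^ 2 * Q w) + f₀ + t * L w + t ^ 2 * Q w := by ring
    rw [h2]
    have h3 : |t * L w| ≤ |t| * C := by
      rw [abs_mul]
      exact mul_le_mul_of_nonneg_left (hLC w hw) (abs_nonneg t)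
    have h4 : |t ^ 2 * Q w| ≤ t ^ 2 * C := by
      rw [abs_mul, abs_of_nonneg (sq_nonneg t)]
      exact mul_le_mul_of_nonneg_left (hQC w hw) (sq_nonneg t)
    refine (abs_add_le _ _).trans (add_le_add ((abs_add_le _ _).trans (add_le_add
      ((abs_add_le _ _).trans (add_le_add h1 le_rfl)) h3)) h4)
  rw [isLittleO_iff]
  intro δ hδ
  have hup : ∀ᶠ t in 𝓝[>] (0 : ℝ), M t ≤ f₀ + t ^ 2 * (l₀ + δ) := by
    have hneg : (q - 1) * (D * (l₀ - (l₀ + δ))) < 0 := by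
      have : (q - 1) * (D * (l₀ - (l₀ + δ))) = -((q - 1) * (D * δ)) := by ring
      rw [this]
      exact neg_neg_of_pos (mul_pos (by linarith) (mul_pos hLpos hδ))
    filter_upwards [(hlim (l₀ + δ)).eventually (gt_mem_nhds hneg), hM, hanti, self_mem_nhdsWithin]
      with t ht htM hta ht0
    have ht0' : 0 < t := ht0
    by_contra hcon
    have h1 := hta (not_le.1 hcon)
    simp only [htM] at h1
    exact absurd ht (not_lt.2 (div_nonneg (div_nonneg h1.le (Real.rpow_nonneg ht0'.le _)) ht0'.le))
  have hlo : ∀ᶠ t in 𝓝[>] (0 : ℝ), f₀ + t ^ 2 * (l₀ - δ) ≤ M t := by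
    have hpos : 0 < (q - 1) * (D * (l₀ - (l₀ - δ))) := by
      have : (q - 1) * (D * (l₀ - (l₀ - δ))) = (q - 1) * (D * δ) := by ring
      rw [this]
      exact mul_pos (by linarith) (mul_pos hLpos hδ)
    filter_upwards [(hlim (l₀ - δ)).eventually (lt_mem_nhds hpos), hM, hanti, self_mem_nhdsWithin]
      with t ht htM hta ht0
    have ht0' : 0 < t := ht0
    by_contra hcon
    have h1 := hta (not_le.1 hcon)
    simp only [htM] at h1
    exact absurd ht (not_lt.2 (div_nonpos_of_nonpos_of_nonneg
      (div_nonpos_of_nonpos_of_nonneg h1.le (Real.rpow_nonneg ht0'.le _)) ht0'.le))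
  filter_upwards [hup, hlo] with t h1 h2
  rw [Real.norm_eq_abs, Real.norm_eq_abs, abs_of_nonneg (sq_nonneg t), abs_le]
  constructor <;> nlinarith

end Perturbation

namespace CarnotGroup

variable {𝔤 : Type*} [LieRing 𝔤] [LieAlgebra ℝ 𝔤] {m k : ℕ} (G : CarnotGroup 𝔤 m k)

theorem measurableEmbedding_dil {ε : ℝ} (hε : ε ≠ 0) : MeasurableEmbedding (G.dil ε) := by
  have hinj : Function.Injective (G.dil ε) := fun x y h => by
    have h1 := congrArg (G.dil ε⁻¹) h
    have h2 := fun z => G.dil_dil_inv (inv_ne_zero hε) z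
    rw [inv_inv] at h2
    rwa [h2, h2] at h1
  exact (G.dilCLM ε).continuous.measurableEmbedding hinj

theorem preimage_dil_originBall {ε : ℝ} (hε : 0 < ε) :
    G.dil ε ⁻¹' G.originBall ε = G.unitBall :=
  Set.ext fun _ => G.dil_mem_originBall_iff hε

/-- The number `μ_p(ε, φ)(x)`, in rescaled coordinates. -/
theorem isMu_iff (p : ℝ≥0∞) {ε : ℝ} (hε : 0 < ε) (φ : (Fin m → ℝ) → ℝ) (x : Fin m → ℝ) (c : ℝ) :
    G.IsMu p ε φ x c ↔ ∀ c', c' ≠ c →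
      eLpNorm (fun w => φ (G.mul x (G.dil ε w)) - c) p (volume.restrict G.unitBall) <
        eLpNorm (fun w => φ (G.mul x (G.dil ε w)) - c') p (volume.restrict G.unitBall) := by
  have hemb := G.measurableEmbedding_dil hε.ne'
  have hdet := G.det_dilCLM_ne_zero hε.ne'
  set κ := ENNReal.ofReal |((G.dilCLM ε).det)⁻¹| with hκ
  have hκ0 : κ ≠ 0 := by
    rw [hκ, Ne, ENNReal.ofReal_eq_zero, not_le, abs_pos]
    exact inv_ne_zero hdet
  have hmap : (volume : Measure (Fin m → ℝ)).map (G.dil ε) = κ • volume :=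
    Measure.map_linearMap_addHaar_eq_smul_addHaar (f := (G.dilCLM ε).toLinearMap) _ hdet
  have h1 : (volume.restrict G.unitBall).map (G.dil ε) = κ • volume.restrict (G.originBall ε) := by
    rw [← G.preimage_dil_originBall hε, ← hemb.restrict_map, hmap, Measure.restrict_smul]
  -- Rescaling multiplies all the norms by one positive finite factor, which is `1` for `p = ∞`, so
  -- strict comparisons are unaffected.
  have h2 : ∀ d, eLpNorm (fun w => φ (G.mul x (G.dil ε w)) - d) p (volume.restrict G.unitBall) =
      κ ^ (1 / p).toReal * eLpNorm (fun y => φ y - d) p (volume.restrict (G.closedPBall x ε)) := by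
    intro d
    rw [G.eLpNorm_closedPBall _ p x hε.le, ← smul_eq_mul, ← eLpNorm_smul_measure_of_ne_zero hκ0,
      ← h1, hemb.eLpNorm_map_measure]
    rfl
  have hpow0 : κ ^ (1 / p).toReal ≠ 0 :=
    (ENNReal.rpow_pos (pos_iff_ne_zero.2 hκ0) ENNReal.ofReal_ne_top).ne'
  have hpowt : κ ^ (1 / p).toReal ≠ ∞ :=
    ENNReal.rpow_ne_top_of_nonneg ENNReal.toReal_nonneg ENNReal.ofReal_ne_top
  simp only [h2]
  refine forall₂_congr fun c' _ => ?_
  exact (ENNReal.mul_lt_mul_iff_right hpow0 hpowt).symm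

end CarnotGroup

end

/-! ### The normalized Laplacian and the expansion for finite exponents -/

noncomputable section

namespace CarnotGroup

variable {𝔤 : Type*} [LieRing 𝔤] [LieAlgebra ℝ 𝔤] {m k : ℕ} (G : CarnotGroup 𝔤 m k)

/-- The horizontal gradient, extended by zero to all coordinates. -/
def grad (φ : (Fin m → ℝ) → ℝ) (x : Fin m → ℝ) : Fin m → ℝ :=
  fun i => if G.σ i = 1 then G.X i φ x else 0

variable {G} {φ : (Fin m → ℝ) → ℝ} {x : Fin m → ℝ}

theorem grad_of_eq_one {i : Fin m} (hi : G.σ i = 1) : G.grad φ x i = G.X i φ x := if_pos hi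

theorem grad_of_ne_one (i : Fin m) (hi : G.σ i ≠ 1) : G.grad φ x i = 0 := if_neg hi

theorem linPart_eq_dotProduct (w : Fin m → ℝ) : G.linPart φ x w = G.grad φ x ⬝ᵥ w := by
  rw [linPart, horizontal, Finset.sum_filter, dotProduct]
  refine Finset.sum_congr rfl fun i _ => ?_
  rw [grad]
  split_ifs <;> simp

theorem gradNorm_sq : G.gradNorm φ x ^ 2 = ∑ i ∈ G.horizontal, G.X i φ x ^ 2 :=
  Real.sq_sqrt (Finset.sum_nonneg fun _ _ => sq_nonneg _)

theorem grad_dotProduct_self : G.grad φ x ⬝ᵥ G.grad φ x = G.gradNorm φ x ^ 2 := by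
  rw [← linPart_eq_dotProduct, linPart, gradNorm_sq]
  refine Finset.sum_congr rfl fun i hi => ?_
  rw [grad_of_eq_one (G.mem_horizontal.1 hi), sq]

theorem grad_ne_zero (h : G.gradNorm φ x ≠ 0) : G.grad φ x ≠ 0 := fun h0 => by
  have := grad_dotProduct_self (G := G) (φ := φ) (x := x)
  rw [h0, zero_dotProduct] at this
  exact h (by simpa using this.symm)

variable (G) in
/-- The symmetrized horizontal Hessian as a quadratic form in the gradient. -/
def hessGrad (φ : (Fin m → ℝ) → ℝ) (x : Fin m → ℝ) : ℝ :=
  ∑ i ∈ G.horizontal, ∑ j ∈ G.horizontal, G.symHess φ x i j * (G.X i φ x * G.X j φ x)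

theorem normLaplacian_top (φ : (Fin m → ℝ) → ℝ) (x : Fin m → ℝ) :
    G.normLaplacian ∞ φ x = G.hessGrad φ x / G.gradNorm φ x ^ 2 := by
  rw [normLaplacian, if_pos rfl, hessGrad, Finset.sum_div]
  refine Finset.sum_congr rfl fun i _ => ?_
  rw [Finset.sum_div]
  refine Finset.sum_congr rfl fun j _ => ?_
  ring

theorem hessGrad_eq : G.hessGrad φ x =
    ∑ i ∈ G.horizontal, ∑ j ∈ G.horizontal, G.X i φ x * G.X j φ x * G.X i (G.X j φ) x := by
  have h : ∑ i ∈ G.horizontal, ∑ j ∈ G.horizontal, G.X i φ x * G.X j φ x * G.X j (G.X i φ) x =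
      ∑ i ∈ G.horizontal, ∑ j ∈ G.horizontal, G.X i φ x * G.X j φ x * G.X i (G.X j φ) x := by
    rw [Finset.sum_comm]
    exact Finset.sum_congr rfl fun i _ => Finset.sum_congr rfl fun j _ => by ring
  have h2 : G.hessGrad φ x =
      (∑ i ∈ G.horizontal, ∑ j ∈ G.horizontal, G.X i φ x * G.X j φ x * G.X i (G.X j φ) x +
        ∑ i ∈ G.horizontal, ∑ j ∈ G.horizontal, G.X i φ x * G.X j φ x * G.X j (G.X i φ) x) / 2 := by
    rw [hessGrad, ← Finset.sum_add_distrib, Finset.sum_div]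
    refine Finset.sum_congr rfl fun i _ => ?_
    rw [← Finset.sum_add_distrib, Finset.sum_div]
    refine Finset.sum_congr rfl fun j _ => ?_
    rw [symHess]
    ring
  rw [h2, h]
  ring

/-- Differentiating the power of the gradient length produces `X_i X_j φ` contracted twice with the
gradient. That contraction is symmetric, so the symmetrized Hessian may stand in its place. -/
theorem normLaplacian_of_ne_top {p : ℝ≥0∞} (hp : p ≠ ∞) (hφ : ContDiffAt ℝ 2 φ x)
    (h0 : G.gradNorm φ x ≠ 0) : G.normLaplacian p φ x =
      ∑ i ∈ G.horizontal, G.symHess φ x i i +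
        (p.toReal - 2) * G.hessGrad φ x / G.gradNorm φ x ^ 2 := by
  set r := p.toReal - 2 with hr
  set N := G.gradNorm φ x with hN
  have hN0 : 0 < N := lt_of_le_of_ne (Real.sqrt_nonneg _) (Ne.symm h0)
  have hS0 : ∑ i ∈ G.horizontal, G.X i φ x ^ 2 ≠ 0 := by
    rw [← gradNorm_sq]
    positivity
  have hX : ∀ i, HasFDerivAt (G.X i φ) (fderiv ℝ (G.X i φ) x) x := fun i =>
    ((G.contDiffAt_X (n := 1) hφ i).differentiableAt one_ne_zero).hasFDerivAt
  have hS : HasFDerivAt (fun y => ∑ i ∈ G.horizontal, G.X i φ y ^ 2)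
      (∑ i ∈ G.horizontal, (2 * G.X i φ x) • fderiv ℝ (G.X i φ) x) x := by
    refine HasFDerivAt.fun_sum fun i _ => ?_
    simpa using (hX i).pow 2
  have hg : HasFDerivAt (G.gradNorm φ) ((1 / (2 * N)) •
      ∑ i ∈ G.horizontal, (2 * G.X i φ x) • fderiv ℝ (G.X i φ) x) x := hS.sqrt hS0
  have hpow : HasFDerivAt (fun y => G.gradNorm φ y ^ r) ((r * N ^ (r - 1)) • (1 / (2 * N)) •
      ∑ i ∈ G.horizontal, (2 * G.X i φ x) • fderiv ℝ (G.X i φ) x) x :=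
    hg.rpow_const (Or.inl h0)
  have hN1 : N ^ (r - 1) = N ^ r / N := by rw [Real.rpow_sub_one h0]
  have hNr : N ^ r ≠ 0 := (Real.rpow_pos_of_pos hN0 r).ne'
  have hterm : ∀ i, G.X i (fun y => G.gradNorm φ y ^ r * G.X i φ y) x / N ^ r =
      G.X i (G.X i φ) x + r * (∑ j ∈ G.horizontal,
        G.X i φ x * G.X j φ x * G.X i (G.X j φ) x) / N ^ 2 := by
    intro i
    have h1 := (hpow.mul (hX i)).fderiv
    have h2 : G.X i (fun y => G.gradNorm φ y ^ r * G.X i φ y) x = _ :=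
      congrArg (fun T : (Fin m → ℝ) →L[ℝ] ℝ => T (G.field i x)) h1
    rw [h2]
    simp only [_root_.add_apply, _root_.smul_apply, _root_.sum_apply, smul_eq_mul]
    have h3 : ∑ j ∈ G.horizontal, 2 * G.X j φ x * (fderiv ℝ (G.X j φ) x) (G.field i x) =
        2 * ∑ j ∈ G.horizontal, G.X j φ x * G.X i (G.X j φ) x := by
      rw [Finset.mul_sum]
      exact Finset.sum_congr rfl fun j _ => mul_assoc _ _ _
    have h4 : ∑ j ∈ G.horizontal, G.X i φ x * G.X j φ x * G.X i (G.X j φ) x =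
        G.X i φ x * ∑ j ∈ G.horizontal, G.X j φ x * G.X i (G.X j φ) x := by
      rw [Finset.mul_sum]
      exact Finset.sum_congr rfl fun j _ => by ring
    rw [h3, h4, hN1, ← hN]
    change (N ^ r * G.X i (G.X i φ) x + _) / _ = _
    field_simp
  rw [normLaplacian, if_neg hp, ← hr, ← hN, Finset.sum_div]
  simp only [hterm]
  rw [Finset.sum_add_distrib, ← Finset.sum_div, ← Finset.mul_sum, hessGrad_eq]
  congr 1
  refine Finset.sum_congr rfl fun i _ => ?_
  rw [symHess]
  ring

theorem continuous_quadPart : Continuous (G.quadPart φ x) := by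
  unfold quadPart
  fun_prop

theorem continuous_linPart : Continuous (G.linPart φ x) := by
  unfold linPart
  fun_prop

theorem eventually_continuousOn_comp_dil (hφ : ∀ᶠ y in 𝓝 x, ContinuousAt φ y) :
    ∀ᶠ ε in 𝓝[>] (0 : ℝ), ContinuousOn (fun w => φ (G.mul x (G.dil ε w))) G.unitBall := by
  have h1 : ∀ᶠ z in 𝓝 (0 : Fin m → ℝ), ContinuousAt φ (G.mul x z) := by
    have := (G.differentiable_mul_left x).continuous.tendsto 0
    rw [mul_zero'] at this
    exact this.eventually hφ
  obtain ⟨r, hr, hball⟩ := Metric.eventually_nhds_iff_ball.1 h1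
  filter_upwards [Ioo_mem_nhdsGT hr, Ioo_mem_nhdsGT one_pos] with ε h2 h3 w hw
  have hz : G.dil ε w ∈ Metric.ball (0 : Fin m → ℝ) r := by
    rw [mem_ball_zero_iff]
    refine lt_of_le_of_lt ?_ h2.2
    refine (pi_norm_le_iff_of_nonneg h2.1.le).2 fun i => ?_
    rw [dil, Real.norm_eq_abs, abs_mul, abs_of_nonneg (pow_nonneg h2.1.le _)]
    calc ε ^ G.σ i * |w i| ≤ ε ^ 1 * 1 :=
          mul_le_mul (pow_le_pow_of_le_one h2.1.le h3.2.le (G.one_le_σ i))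
            (G.abs_le_one_of_mem_unitBall hw i) (abs_nonneg _) (pow_nonneg h2.1.le _)
      _ = ε := by ring
  have hc : Continuous fun w => G.mul x (G.dil ε w) :=
    (G.differentiable_mul_left x).continuous.comp (G.dilCLM ε).continuous
  exact (ContinuousAt.comp (f := fun w => G.mul x (G.dil ε w)) (hball _ hz)
    hc.continuousAt).continuousWithinAt

/-- The moments of the second stratum vanish, and those of the horizontal layer contract the Hessian
to its trace plus `q - 2` times its value in the gradient direction: the normalized Laplacian. -/
theorem integral_abs_rpow_mul_quadPart {q : ℝ} (hq : 1 < q) (h0 : G.gradNorm φ x ≠ 0) :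
    ∫ w in G.unitBall, |G.grad φ x ⬝ᵥ w| ^ (q - 2) * G.quadPart φ x w =
      (∫ w in G.unitBall, |G.grad φ x ⬝ᵥ w| ^ q) / (2 * (q - 1) * G.gradNorm φ x ^ 2) *
        (∑ i ∈ G.horizontal, G.symHess φ x i i +
          (q - 2) * G.hessGrad φ x / G.gradNorm φ x ^ 2) := by
  set a := G.grad φ x with ha
  have ha0 : a ≠ 0 := grad_ne_zero h0
  set K := ∫ w in G.unitBall, |a ⬝ᵥ w| ^ q with hK
  have hint : ∀ h : (Fin m → ℝ) → ℝ, Continuous h →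
      Integrable (fun w => |a ⬝ᵥ w| ^ (q - 2) * h w) (volume.restrict G.unitBall) :=
    fun h hh => integrable_abs_rpow_mul ha0 hq hh
  have h1 : (fun w => |a ⬝ᵥ w| ^ (q - 2) * G.quadPart φ x w) = fun w =>
      (∑ i with G.σ i = 2, G.X i φ x * (|a ⬝ᵥ w| ^ (q - 2) * w i)) +
        ∑ i ∈ G.horizontal, ∑ j ∈ G.horizontal,
          G.symHess φ x i j / 2 * (|a ⬝ᵥ w| ^ (q - 2) * (w i * w j)) := by
    funext w
    rw [quadPart, mul_add, Finset.mul_sum, Finset.sum_div, Finset.mul_sum]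
    refine congrArg₂ _ (Finset.sum_congr rfl fun i _ => by ring)
      (Finset.sum_congr rfl fun i _ => ?_)
    rw [Finset.sum_div, Finset.mul_sum]
    exact Finset.sum_congr rfl fun j _ => by ring
  have hi1 : ∀ i, Integrable (fun w : Fin m → ℝ => |a ⬝ᵥ w| ^ (q - 2) * w i)
      (volume.restrict G.unitBall) := fun i => hint _ (continuous_apply i)
  have hi2 : ∀ i j, Integrable (fun w : Fin m → ℝ => |a ⬝ᵥ w| ^ (q - 2) * (w i * w j))
      (volume.restrict G.unitBall) := fun i j =>
    hint _ ((continuous_apply i).mul (continuous_apply j))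
  rw [h1, integral_add (integrable_finsetSum _ fun i _ => (hi1 i).const_mul _)
      (integrable_finsetSum _ fun i _ => integrable_finsetSum _ fun j _ => (hi2 i j).const_mul _),
    integral_finsetSum _ fun i _ => (hi1 i).const_mul _,
    integral_finsetSum _ fun i _ => integrable_finsetSum _ fun j _ => (hi2 i j).const_mul _]
  have h2 : ∑ i with G.σ i = 2, ∫ w in G.unitBall, G.X i φ x * (|a ⬝ᵥ w| ^ (q - 2) * w i) = 0 := by
    refine Finset.sum_eq_zero fun i hi => ?_
    rw [integral_const_mul, integral_moment_vertical (by rw [(Finset.mem_filter.1 hi).2]; norm_num)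
      grad_of_ne_one, mul_zero]
  have h3 : ∀ i ∈ G.horizontal, ∫ w in G.unitBall, ∑ j ∈ G.horizontal,
        G.symHess φ x i j / 2 * (|a ⬝ᵥ w| ^ (q - 2) * (w i * w j)) =
      K / (2 * (q - 1) * G.gradNorm φ x ^ 2) * (G.symHess φ x i i + (q - 2) *
        (∑ j ∈ G.horizontal, G.symHess φ x i j * (G.X i φ x * G.X j φ x)) /
          G.gradNorm φ x ^ 2) := by
    intro i hi
    have hi' := G.mem_horizontal.1 hi
    have hii : G.symHess φ x i i = ∑ j ∈ G.horizontal, G.symHess φ x i j *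
        (if i = j then 1 else 0) := by simp [hi]
    rw [integral_finsetSum _ fun j _ => (hi2 i j).const_mul _, hii, mul_div_right_comm,
      Finset.mul_sum, ← Finset.sum_add_distrib, Finset.mul_sum]
    refine Finset.sum_congr rfl fun j hj => ?_
    have hj' := G.mem_horizontal.1 hj
    rw [integral_const_mul, integral_moment ha0 hq grad_of_ne_one hi' hj', grad_dotProduct_self,
      ← hK, ha, grad_of_eq_one hi', grad_of_eq_one hj']
    have : q - 1 ≠ 0 := by linarith
    field_simp
  rw [h2, zero_add, Finset.sum_congr rfl h3, ← Finset.mul_sum, Finset.sum_add_distrib,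
    ← Finset.sum_div, ← Finset.mul_sum, hessGrad]

/-- The expansion of `μ_p(ε, φ)(x)` for `p < ∞`. -/
theorem exists_isMu_expansion_of_ne_top {p : ℝ≥0∞} (hp : 1 < p) (hp' : p ≠ ∞)
    (hφ : ContDiffAt ℝ 2 φ x) (h0 : G.gradNorm φ x ≠ 0) :
    ∃ c > 0, ∃ M : ℝ → ℝ, (∀ᶠ ε in 𝓝[>] 0, G.IsMu p ε φ x (M ε)) ∧
      (fun ε => M ε - φ x - ε ^ 2 * (c * G.normLaplacian p φ x)) =o[𝓝[>] 0] fun ε => ε ^ 2 := by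
  have hq : 1 < p.toReal := by
    rw [← ENNReal.toReal_one]
    exact (ENNReal.toReal_lt_toReal ENNReal.one_ne_top hp').2 hp
  have : IsFiniteMeasure (volume.restrict G.unitBall) := isFiniteMeasure_unitBall
  set q := p.toReal with hqdef
  set a := G.grad φ x with ha
  have ha0 : a ≠ 0 := grad_ne_zero h0
  have hμ : volume.restrict G.unitBall ≠ 0 := by
    rw [Ne, Measure.restrict_eq_zero]
    exact G.volume_unitBall_pos.ne'
  have hmem := ae_restrict_mem (μ := volume) G.isCompact_unitBall.measurableSet
  have hcont := eventually_continuousOn_comp_dil (G := G) (φ := φ) (x := x)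
    ((hφ.eventually (by simp)).mono fun y hy => hy.continuousAt)
  have hgm : ∀ᶠ ε in 𝓝[>] (0 : ℝ), AEStronglyMeasurable (fun w => φ (G.mul x (G.dil ε w)))
      (volume.restrict G.unitBall) := hcont.mono fun ε hε =>
    hε.aestronglyMeasurable G.isCompact_unitBall.measurableSet
  have hbdd : ∀ᶠ ε in 𝓝[>] (0 : ℝ), ∃ C, ∀ᵐ w ∂volume.restrict G.unitBall,
      |φ (G.mul x (G.dil ε w))| ≤ C := hcont.mono fun ε hε => by
    obtain ⟨C, hC⟩ := G.isCompact_unitBall.exists_bound_of_continuousOn hε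
    exact ⟨C, hmem.mono hC⟩
  have hex : ∀ᶠ ε in 𝓝[>] (0 : ℝ), ∃ c, ∫ w in G.unitBall,
      signedPow q (φ (G.mul x (G.dil ε w)) - c) = 0 := by
    filter_upwards [hgm, hbdd] with ε h1 ⟨C, h2⟩
    exact exists_integral_signedPow_eq_zero hq h1 h2
  -- A zero of the Euler equation whenever one exists, which holds for all small `ε`; otherwise an
  -- arbitrary value.
  set M : ℝ → ℝ := fun ε => Classical.epsilon fun c => ∫ w in G.unitBall,
      signedPow q (φ (G.mul x (G.dil ε w)) - c) = 0 with hMdef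
  have hM : ∀ᶠ ε in 𝓝[>] (0 : ℝ), ∫ w in G.unitBall,
      signedPow q (φ (G.mul x (G.dil ε w)) - M ε) = 0 :=
    hex.mono fun ε hε => Classical.epsilon_spec hε
  have hD : 0 < ∫ w in G.unitBall, |a ⬝ᵥ w| ^ (q - 2) :=
    integral_abs_rpow_pos ha0 (by linarith)
  have hK : 0 < ∫ w in G.unitBall, |a ⬝ᵥ w| ^ q := integral_abs_rpow_pos ha0 (by linarith)
  obtain ⟨C₁, hC₁⟩ := G.isCompact_unitBall.exists_bound_of_continuousOn
    (continuous_dotProduct_left a).continuousOn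
  obtain ⟨C₂, hC₂⟩ := G.isCompact_unitBall.exists_bound_of_continuousOn
    (continuous_quadPart (G := G) (φ := φ) (x := x)).continuousOn
  have hlo := isLittleO_of_integral_signedPow_eq_zero (μ := volume.restrict G.unitBall)
    (L := fun w => a ⬝ᵥ w) (Q := G.quadPart φ x) (g := fun ε w => φ (G.mul x (G.dil ε w)))
    (S := G.unitBall) (C := max C₁ C₂) (f₀ := φ x) (M := M) hq hμ hmem
    (continuous_dotProduct_left a).aestronglyMeasurable
    (fun w hw => (hC₁ w hw).trans (le_max_left _ _))
    (fun w hw => (hC₂ w hw).trans (le_max_right _ _)) (ae_dotProduct_ne_zero ha0)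
    (integrableOn_abs_dotProduct_rpow ha0 (by linarith) G.isCompact_unitBall) hD
    (integrable_abs_rpow_mul ha0 hq continuous_quadPart)
    (G.setIntegral_odd_eq_zero fun w => by rw [dotProduct_neg, signedPow_neg]) hgm
    (fun δ hδ => by
      simpa only [linPart_eq_dotProduct] using G.expansion hφ hδ) hM
  refine ⟨(∫ w in G.unitBall, |a ⬝ᵥ w| ^ q) / (2 * (q - 1) * G.gradNorm φ x ^ 2) /
    ∫ w in G.unitBall, |a ⬝ᵥ w| ^ (q - 2), ?_, M, ?_, ?_⟩
  · have : 0 < q - 1 := by linarith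
    positivity
  · filter_upwards [hgm, hbdd, hM, self_mem_nhdsWithin] with ε h1 ⟨C, h2⟩ h3 hε
    rw [isMu_iff _ _ hε]
    exact fun c' hc' => eLpNorm_lt_of_integral_signedPow_eq_zero hp hp' hμ h1 h2 h3 hc'
  · rw [integral_abs_rpow_mul_quadPart hq h0, ← normLaplacian_of_ne_top hp' hφ h0,
      mul_div_right_comm] at hlo
    exact hlo

end CarnotGroup

end

/-! ### The mid-range and the expansion for the infinite exponent -/

noncomputable section

/-- If `L` has a unique maximum point `w₀` on a compact set, then the maximum of `ε L + ε² Q` is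
`ε L(w₀) + ε² Q(w₀) + o(ε²)`. -/
theorem eventually_forall_add_sq_le {α : Type*} [TopologicalSpace α] {K : Set α} (hK : IsCompact K)
    {L Q : α → ℝ} (hL : Continuous L) (hQ : Continuous Q) {w₀ : α}
    (hmax : ∀ w ∈ K, w ≠ w₀ → L w < L w₀) (hle : ∀ w ∈ K, L w ≤ L w₀) {δ : ℝ} (hδ : 0 < δ) :
    ∀ᶠ ε in 𝓝[>] (0 : ℝ), ∀ w ∈ K, ε * L w + ε ^ 2 * Q w ≤ ε * L w₀ + ε ^ 2 * (Q w₀ + δ) := by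
  -- Only points of `T` can violate the bound. As `T` is compact and omits `w₀`, `L` stays below `L
  -- w₀` on it by a fixed gap, which at order `ε` outweighs the gain of order `ε²`.
  set T := K ∩ {w | Q w₀ + δ ≤ Q w} with hT
  have hTc : IsCompact T := hK.inter_right (isClosed_le continuous_const hQ)
  have hout : ∀ ε : ℝ, 0 < ε → ∀ w ∈ K, w ∉ T →
      ε * L w + ε ^ 2 * Q w ≤ ε * L w₀ + ε ^ 2 * (Q w₀ + δ) := fun ε hε w hw hwT => by
    have h1 : Q w ≤ Q w₀ + δ := le_of_lt (not_le.1 fun h => hwT ⟨hw, h⟩)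
    have h2 := hle w hw
    gcongr
  rcases T.eq_empty_or_nonempty with hemp | hne
  · filter_upwards [self_mem_nhdsWithin] with ε hε w hw
    exact hout ε hε w hw (by rw [hemp]; exact Set.notMem_empty w)
  obtain ⟨w₁, hw₁, hw₁max⟩ := hTc.exists_isMaxOn hne hL.continuousOn
  have hη : 0 < L w₀ - L w₁ := by
    refine sub_pos.2 (hmax w₁ hw₁.1 fun h => ?_)
    have := hw₁.2
    rw [h] at this
    exact absurd (show Q w₀ + δ ≤ Q w₀ from this) (by linarith)
  obtain ⟨C, hC⟩ := hTc.exists_bound_of_continuousOn hQ.continuousOn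
  have hlim : Tendsto (fun ε : ℝ => ε * (C - (Q w₀ + δ))) (𝓝[>] 0) (𝓝 0) := by
    have : Tendsto (fun ε : ℝ => ε * (C - (Q w₀ + δ))) (𝓝 0) (𝓝 (0 * (C - (Q w₀ + δ)))) :=
      tendsto_id.mul_const _
    rw [zero_mul] at this
    exact this.mono_left nhdsWithin_le_nhds
  filter_upwards [hlim.eventually (gt_mem_nhds hη), self_mem_nhdsWithin] with ε h1 hε w hw
  have hε' : 0 < ε := hε
  by_cases hwT : w ∈ T
  · have h2 : L w ≤ L w₁ := hw₁max hwT
    have h3 : Q w ≤ C := (le_abs_self _).trans (hC w hwT)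
    have h4 : ε * (ε * (C - (Q w₀ + δ))) ≤ ε * (L w₀ - L w₁) := by gcongr
    have h5 : ε * L w ≤ ε * L w₁ := by gcongr
    have h6 : ε ^ 2 * Q w ≤ ε ^ 2 * C := by gcongr
    linarith
  · exact hout ε hε' w hw hwT

section MidRange

variable {X : Type*} [TopologicalSpace X] [MeasurableSpace X]
  {μ : Measure X} [μ.IsOpenPosMeasure] {K : Set X}

/-- Nonempty relatively open pieces of `K` meet its interior and so have positive measure; an almost
everywhere bound on a continuous function therefore holds at every point of `K`. -/
theorem ofReal_abs_le_eLpNorm_top (hK : K ⊆ closure (interior K))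
    {f : X → ℝ} (hf : ContinuousOn f K) {w : X} (hw : w ∈ K) :
    ENNReal.ofReal |f w| ≤ eLpNorm f ∞ (μ.restrict K) := by
  rcases eq_or_ne (eLpNorm f ∞ (μ.restrict K)) ∞ with htop | htop
  · rw [htop]
    exact le_top
  set e := (eLpNorm f ∞ (μ.restrict K)).toReal with he
  have h1 : ∀ᵐ w ∂μ.restrict K, |f w| ≤ e := by
    filter_upwards [enorm_ae_le_eLpNormEssSup f (μ.restrict K)] with w hw
    rw [← eLpNorm_exponent_top] at hw
    rw [← Real.norm_eq_abs, ← toReal_enorm, he]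
    exact ENNReal.toReal_mono htop hw
  have h2 : (fun w => |f w|) =ᵐ[μ.restrict K] fun w => min |f w| e :=
    h1.mono fun w hw => (min_eq_left hw).symm
  have h3 := Measure.eqOn_of_ae_eq h2 hf.abs (hf.abs.inf continuousOn_const) hK hw
  have h4 : |f w| ≤ e := min_eq_left_iff.1 h3.symm
  exact (ENNReal.ofReal_le_ofReal h4).trans (ENNReal.ofReal_toReal htop).le

/-- The mid-range of a continuous function is its best constant approximation in `L^∞`. -/
theorem eLpNorm_top_midRange_lt (hK : K ⊆ closure (interior K)) (hKm : MeasurableSet K)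
    {g : X → ℝ} (hg : ContinuousOn g K) {w₁ w₂ : X} (hw₁ : w₁ ∈ K) (hw₂ : w₂ ∈ K)
    (hmax : ∀ w ∈ K, g w ≤ g w₁) (hmin : ∀ w ∈ K, g w₂ ≤ g w) {c : ℝ}
    (hc : c ≠ (g w₁ + g w₂) / 2) :
    eLpNorm (fun w => g w - (g w₁ + g w₂) / 2) ∞ (μ.restrict K) <
      eLpNorm (fun w => g w - c) ∞ (μ.restrict K) := by
  have hup : eLpNorm (fun w => g w - (g w₁ + g w₂) / 2) ∞ (μ.restrict K) ≤
      ENNReal.ofReal ((g w₁ - g w₂) / 2) := by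
    rw [eLpNorm_exponent_top]
    refine eLpNormEssSup_le_of_ae_bound ?_
    filter_upwards [ae_restrict_mem hKm] with w hw
    rw [Real.norm_eq_abs, abs_le]
    constructor <;> linarith [hmax w hw, hmin w hw]
  have hlo := fun w (hw : w ∈ K) => ofReal_abs_le_eLpNorm_top (μ := μ)
    (f := fun w => g w - c) hK (hg.sub continuousOn_const) hw
  have h0 : 0 ≤ (g w₁ - g w₂) / 2 := by linarith [hmax w₂ hw₂]
  refine hup.trans_lt ?_
  rcases lt_or_gt_of_ne hc with h | h
  · refine lt_of_lt_of_le ((ENNReal.ofReal_lt_ofReal_iff_of_nonneg h0).2 ?_) (hlo w₁ hw₁)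
    exact lt_of_lt_of_le (by linarith) (le_abs_self _)
  · refine lt_of_lt_of_le ((ENNReal.ofReal_lt_ofReal_iff_of_nonneg h0).2 ?_) (hlo w₂ hw₂)
    exact lt_of_lt_of_le (by linarith) (neg_le_abs _)

end MidRange

namespace CarnotGroup

variable {𝔤 : Type*} [LieRing 𝔤] [LieAlgebra ℝ 𝔤] {m k : ℕ} (G : CarnotGroup 𝔤 m k)

/-- Dilations by `t < 1` move the ball into the open set where the gauge is less than `1`. -/
theorem unitBall_subset_closure_interior : G.unitBall ⊆ closure (interior G.unitBall) := by
  intro w hw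
  have h1 : Tendsto (fun t : ℝ => G.dil t w) (𝓝[<] 1) (𝓝 w) := by
    have h := (G.continuous_dil w).tendsto 1
    have h2 : G.dil 1 w = w := by
      ext i
      simp [dil]
    rw [h2] at h
    exact h.mono_left nhdsWithin_le_nhds
  refine mem_closure_of_tendsto h1 ?_
  filter_upwards [Ioo_mem_nhdsLT zero_lt_one] with t ht
  have hsub : {z | G.gauge z < 1} ⊆ G.unitBall := fun z hz =>
    show G.gauge z ≤ 1 from le_of_lt hz
  refine interior_maximal hsub (isOpen_lt G.continuous_gauge continuous_const) ?_
  rw [Set.mem_ofPred_eq, G.gauge_dil ht.1.le]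
  have h2 : t ^ (2 * k.factorial) < 1 := pow_lt_one₀ ht.1.le ht.2 (by positivity)
  have h3 : G.gauge w ≤ 1 := hw
  calc t ^ (2 * k.factorial) * G.gauge w ≤ t ^ (2 * k.factorial) * 1 :=
        mul_le_mul_of_nonneg_left h3 (pow_nonneg ht.1.le _)
    _ < 1 := by rwa [mul_one]

variable {G} {φ : (Fin m → ℝ) → ℝ} {x : Fin m → ℝ}

theorem sq_layerNorm (w : Fin m → ℝ) (j : ℕ) :
    G.layerNorm w j ^ 2 = ∑ i with G.σ i = j, w i ^ 2 :=
  Real.sq_sqrt (Finset.sum_nonneg fun _ _ => sq_nonneg _)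

theorem one_le_step (h0 : G.gradNorm φ x ≠ 0) : 1 ≤ k := by
  obtain ⟨i, -⟩ := Function.ne_iff.1 (grad_ne_zero h0)
  exact (G.one_le_σ i).trans (G.σ_le i)

theorem exponent_ne_zero {j : ℕ} (hj : 1 ≤ j) (hjk : j ≤ k) : 2 * k.factorial / j ≠ 0 := by
  have : j ≤ k.factorial := hjk.trans (Nat.self_le_factorial k)
  exact (Nat.div_pos (by omega) (by omega)).ne'

theorem normalized_grad_mem_unitBall (h0 : G.gradNorm φ x ≠ 0) :
    (G.gradNorm φ x)⁻¹ • G.grad φ x ∈ G.unitBall := by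
  set N := G.gradNorm φ x with hN
  have hlayer : ∀ j, j ≠ 1 → G.layerNorm (N⁻¹ • G.grad φ x) j = 0 := fun j hj => by
    rw [← sq_eq_zero_iff, sq_layerNorm]
    refine Finset.sum_eq_zero fun i hi => ?_
    have : G.σ i ≠ 1 := by rw [(Finset.mem_filter.1 hi).2]; exact hj
    simp [grad_of_ne_one i this]
  have h1 : G.layerNorm (N⁻¹ • G.grad φ x) 1 ^ 2 = 1 := by
    rw [sq_layerNorm]
    have h2 : ∑ i with G.σ i = 1, (N⁻¹ • G.grad φ x) i ^ 2 =
        N⁻¹ ^ 2 * ∑ i ∈ G.horizontal, G.X i φ x ^ 2 := by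
      rw [Finset.mul_sum]
      refine Finset.sum_congr rfl fun i hi => ?_
      rw [Pi.smul_apply, smul_eq_mul, grad_of_eq_one (Finset.mem_filter.1 hi).2, mul_pow]
    rw [h2, ← gradNorm_sq, ← mul_pow, ← hN, inv_mul_cancel₀ h0, one_pow]
  have h1' : G.layerNorm (N⁻¹ • G.grad φ x) 1 = 1 :=
    (pow_eq_one_iff_of_nonneg (G.layerNorm_nonneg _ 1) two_ne_zero).1 h1
  change G.gauge _ ≤ 1
  rw [gauge, Finset.sum_eq_single 1]
  · rw [h1', one_pow]
  · intro j hj hj1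
    have := Finset.mem_Icc.1 hj
    rw [hlayer j hj1, zero_pow (exponent_ne_zero this.1 this.2)]
  · intro h
    exact absurd (Finset.mem_Icc.2 ⟨le_rfl, one_le_step h0⟩) h

/-- On the unit pseudoball a horizontal linear form has a unique maximum point. -/
theorem eq_of_gradNorm_le (h0 : G.gradNorm φ x ≠ 0) {w : Fin m → ℝ} (hw : w ∈ G.unitBall)
    (h : G.gradNorm φ x ≤ G.grad φ x ⬝ᵥ w) : w = (G.gradNorm φ x)⁻¹ • G.grad φ x := by
  set N := G.gradNorm φ x with hN
  have hN0 : 0 < N := lt_of_le_of_ne (Real.sqrt_nonneg _) (Ne.symm h0)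
  have hk := one_le_step h0
  have hle1 := G.layerNorm_le_of_gauge_le_one hw le_rfl hk
  -- Equality case of the Cauchy-Schwarz inequality: the hypotheses force this sum of squares to be
  -- nonpositive.
  have hsum : ∑ i ∈ G.horizontal, (w i - N⁻¹ * G.X i φ x) ^ 2 =
      G.layerNorm w 1 ^ 2 - 2 * N⁻¹ * (G.grad φ x ⬝ᵥ w) + 1 := by
    have h1 : N⁻¹ ^ 2 * ∑ i ∈ G.horizontal, G.X i φ x ^ 2 = 1 := by
      rw [← gradNorm_sq, ← mul_pow, ← hN, inv_mul_cancel₀ h0, one_pow]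
    rw [← linPart_eq_dotProduct, linPart, sq_layerNorm, ← h1, Finset.mul_sum, Finset.mul_sum]
    change _ = ∑ i ∈ G.horizontal, _ - _ + _
    rw [← Finset.sum_sub_distrib, ← Finset.sum_add_distrib]
    exact Finset.sum_congr rfl fun i _ => by ring
  have h2 : 1 ≤ N⁻¹ * (G.grad φ x ⬝ᵥ w) := by
    calc 1 = N⁻¹ * N := (inv_mul_cancel₀ h0).symm
      _ ≤ _ := by gcongr
  have h3 : G.layerNorm w 1 ^ 2 ≤ 1 := pow_le_one₀ (G.layerNorm_nonneg w 1) hle1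
  have h4 : 0 ≤ ∑ i ∈ G.horizontal, (w i - N⁻¹ * G.X i φ x) ^ 2 :=
    Finset.sum_nonneg fun _ _ => sq_nonneg _
  have h5 : ∑ i ∈ G.horizontal, (w i - N⁻¹ * G.X i φ x) ^ 2 = 0 := by linarith
  have h6 : G.layerNorm w 1 = 1 :=
    (pow_eq_one_iff_of_nonneg (G.layerNorm_nonneg w 1) two_ne_zero).1 (by linarith)
  ext i
  by_cases hi : G.σ i = 1
  · have := (Finset.sum_eq_zero_iff_of_nonneg fun _ _ => sq_nonneg _).1 h5 i
      (G.mem_horizontal.2 hi)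
    rw [Pi.smul_apply, smul_eq_mul, grad_of_eq_one hi]
    linarith [pow_eq_zero_iff two_ne_zero |>.1 this]
  · rw [Pi.smul_apply, grad_of_ne_one i hi, smul_zero]
    -- The horizontal layer already contributes `1` to the gauge, which leaves nothing for the other
    -- layers.
    have hpair : ∑ j ∈ {1, G.σ i}, G.layerNorm w j ^ (2 * k.factorial / j) ≤ 1 := by
      refine (Finset.sum_le_sum_of_subset_of_nonneg ?_ fun j _ _ =>
        pow_nonneg (G.layerNorm_nonneg w j) _).trans (show G.gauge w ≤ 1 from hw)
      intro j hj
      rw [Finset.mem_insert, Finset.mem_singleton] at hj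
      rcases hj with rfl | rfl
      · exact Finset.mem_Icc.2 ⟨le_rfl, hk⟩
      · exact Finset.mem_Icc.2 ⟨G.one_le_σ i, G.σ_le i⟩
    rw [Finset.sum_pair (Ne.symm hi), h6, one_pow] at hpair
    have h7 : G.layerNorm w (G.σ i) ^ (2 * k.factorial / G.σ i) = 0 :=
      le_antisymm (by linarith) (pow_nonneg (G.layerNorm_nonneg w _) _)
    have h8 := pow_eq_zero_iff (exponent_ne_zero (G.one_le_σ i) (G.σ_le i)) |>.1 h7
    have h9 := sq_layerNorm (G := G) w (G.σ i)
    rw [h8, zero_pow two_ne_zero] at h9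
    have h10 := (Finset.sum_eq_zero_iff_of_nonneg fun _ _ => sq_nonneg _).1 h9.symm i (by simp)
    exact pow_eq_zero_iff two_ne_zero |>.1 h10

theorem linPart_normalized_grad (h0 : G.gradNorm φ x ≠ 0) :
    G.linPart φ x ((G.gradNorm φ x)⁻¹ • G.grad φ x) = G.gradNorm φ x := by
  rw [linPart_eq_dotProduct, dotProduct_smul, grad_dotProduct_self, smul_eq_mul]
  field_simp

theorem quadPart_smul_grad (t : ℝ) :
    G.quadPart φ x (t • G.grad φ x) = t ^ 2 * G.hessGrad φ x / 2 := by
  have h1 : ∑ i with G.σ i = 2, G.X i φ x * (t • G.grad φ x) i = 0 := by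
    refine Finset.sum_eq_zero fun i hi => ?_
    have : G.σ i ≠ 1 := by rw [(Finset.mem_filter.1 hi).2]; norm_num
    simp [grad_of_ne_one i this]
  rw [quadPart, h1, zero_add, hessGrad, Finset.mul_sum]
  congr 1
  refine Finset.sum_congr rfl fun i hi => ?_
  rw [Finset.mul_sum]
  refine Finset.sum_congr rfl fun j hj => ?_
  rw [Pi.smul_apply, Pi.smul_apply, smul_eq_mul, smul_eq_mul,
    grad_of_eq_one (G.mem_horizontal.1 hi), grad_of_eq_one (G.mem_horizontal.1 hj)]
  ring

/-- The expansion of `μ_∞(ε, φ)(x)`. -/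
theorem exists_isMu_top_expansion (hφ : ContDiffAt ℝ 2 φ x) (h0 : G.gradNorm φ x ≠ 0) :
    ∃ M : ℝ → ℝ, (∀ᶠ ε in 𝓝[>] 0, G.IsMu ∞ ε φ x (M ε)) ∧
      (fun ε => M ε - φ x - ε ^ 2 * (1 / 2 * G.normLaplacian ∞ φ x)) =o[𝓝[>] 0]
        fun ε => ε ^ 2 := by
  set N := G.gradNorm φ x with hN
  set w₀ := N⁻¹ • G.grad φ x with hw₀
  have hw₀B : w₀ ∈ G.unitBall := normalized_grad_mem_unitBall h0
  have hnegB : ∀ w, w ∈ G.unitBall → -w ∈ G.unitBall := fun w hw => by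
    change G.gauge (-w) ≤ 1
    rw [gauge_neg]
    exact hw
  have hne : G.unitBall.Nonempty := ⟨w₀, hw₀B⟩
  set g : ℝ → (Fin m → ℝ) → ℝ := fun ε w => φ (G.mul x (G.dil ε w)) with hg
  have hcont : ∀ᶠ ε in 𝓝[>] (0 : ℝ), ContinuousOn (g ε) G.unitBall :=
    eventually_continuousOn_comp_dil ((hφ.eventually (by simp)).mono fun y hy => hy.continuousAt)
  have hex : ∀ ε, ∃ p : (Fin m → ℝ) × (Fin m → ℝ), ContinuousOn (g ε) G.unitBall →
      p.1 ∈ G.unitBall ∧ p.2 ∈ G.unitBall ∧ (∀ w ∈ G.unitBall, g ε w ≤ g ε p.1) ∧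
        ∀ w ∈ G.unitBall, g ε p.2 ≤ g ε w := fun ε => by
    by_cases h : ContinuousOn (g ε) G.unitBall
    · obtain ⟨w₁, h₁, h₁'⟩ := G.isCompact_unitBall.exists_isMaxOn hne h
      obtain ⟨w₂, h₂, h₂'⟩ := G.isCompact_unitBall.exists_isMinOn hne h
      exact ⟨(w₁, w₂), fun _ => ⟨h₁, h₂, fun w hw => h₁' hw, fun w hw => h₂' hw⟩⟩
    · exact ⟨(0, 0), fun h' => absurd h' h⟩
  choose P hP using hex
  refine ⟨fun ε => (g ε (P ε).1 + g ε (P ε).2) / 2, ?_, ?_⟩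
  · filter_upwards [hcont, self_mem_nhdsWithin] with ε hε hε0
    obtain ⟨h1, h2, h3, h4⟩ := hP ε hε
    rw [isMu_iff _ _ hε0]
    exact fun c hc => eLpNorm_top_midRange_lt G.unitBall_subset_closure_interior
      G.isCompact_unitBall.measurableSet hε h1 h2 h3 h4 hc
  · have hmax : ∀ w ∈ G.unitBall, w ≠ w₀ → G.linPart φ x w < G.linPart φ x w₀ :=
      fun w hw hww => by
        rw [linPart_normalized_grad h0, linPart_eq_dotProduct]
        exact not_le.1 fun h => hww (eq_of_gradNorm_le h0 hw h)
    have hle : ∀ w ∈ G.unitBall, G.linPart φ x w ≤ G.linPart φ x w₀ := fun w hw => by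
      rcases eq_or_ne w w₀ with h | h
      · rw [h]
      · exact (hmax w hw h).le
    have hLneg : ∀ w, G.linPart φ x (-w) = -G.linPart φ x w := fun w => by
      rw [linPart_eq_dotProduct, linPart_eq_dotProduct, dotProduct_neg]
    have hQ₀ : G.quadPart φ x w₀ = 1 / 2 * G.normLaplacian ∞ φ x := by
      rw [hw₀, quadPart_smul_grad, normLaplacian_top, inv_pow]
      ring
    have hQ₁ : G.quadPart φ x (-w₀) = 1 / 2 * G.normLaplacian ∞ φ x := by
      rw [hw₀, ← neg_smul, quadPart_smul_grad, normLaplacian_top, neg_sq, inv_pow]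
      ring
    set l := 1 / 2 * G.normLaplacian ∞ φ x with hl
    rw [isLittleO_iff]
    intro δ hδ
    have hup := eventually_forall_add_sq_le G.isCompact_unitBall
      (continuous_linPart (G := G) (φ := φ) (x := x)) (continuous_quadPart (G := G) (φ := φ) (x := x))
      hmax hle
      (half_pos hδ)
    -- The minimum is treated as a maximum by the substitution `w ↦ -w`: `L` is odd, so the relevant
    -- quadratic part is `-Q(-w)`.
    have hlo := eventually_forall_add_sq_le G.isCompact_unitBall
      (continuous_linPart (G := G) (φ := φ) (x := x))
      ((continuous_quadPart (G := G) (φ := φ) (x := x)).neg.comp continuous_neg) hmax hle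
      (half_pos hδ)
    filter_upwards [hup, hlo, G.expansion hφ (half_pos hδ), hcont] with ε hup hlo hexp hc
    obtain ⟨h1, h2, h3, h4⟩ := hP ε hc
    have e1 := abs_le.1 (hexp _ h1)
    have e2 := abs_le.1 (hexp _ h2)
    have e3 := abs_le.1 (hexp _ hw₀B)
    have e4 := abs_le.1 (hexp _ (hnegB _ hw₀B))
    have m1 := hup _ h1
    have m2 := hlo _ (hnegB _ h2)
    have m3 := h3 _ hw₀B
    have m4 := h4 _ (hnegB _ hw₀B)
    simp only [Function.comp_apply, Pi.neg_apply, neg_neg, hLneg, hQ₀, hQ₁] at m1 m2 e3 e4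
    simp only [hg] at m3 m4 ⊢
    rw [Real.norm_eq_abs, Real.norm_eq_abs, abs_of_nonneg (sq_nonneg ε), abs_le]
    constructor <;> linarith

/-- The expansion of `μ_p(ε, φ)(x)` at a point where the horizontal gradient does not vanish. -/
theorem exists_isMu_expansion {p : ℝ≥0∞} (hp : 1 < p) (hφ : ContDiffAt ℝ 2 φ x)
    (h0 : G.gradNorm φ x ≠ 0) :
    ∃ c > 0, ∃ M : ℝ → ℝ, (∀ᶠ ε in 𝓝[>] 0, G.IsMu p ε φ x (M ε)) ∧
      (fun ε => M ε - φ x - ε ^ 2 * (c * G.normLaplacian p φ x)) =o[𝓝[>] 0] fun ε => ε ^ 2 := by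
  rcases eq_or_ne p ∞ with rfl | hp'
  · exact ⟨1 / 2, by norm_num, exists_isMu_top_expansion hφ h0⟩
  · exact exists_isMu_expansion_of_ne_top hp hp' hφ h0

end CarnotGroup

end

/-! ### From the expansion to viscosity solutions -/

noncomputable section

/-- A function that is smooth on a neighbourhood of a point agrees near that point with a function
that is smooth everywhere. -/
theorem exists_contDiff_eventuallyEq {E : Type*} [NormedAddCommGroup E] [NormedSpace ℝ E]
    [FiniteDimensional ℝ E] {n : ℕ} {φ : E → ℝ} {U : Set E} {x : E} (hU : IsOpen U) (hx : x ∈ U)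
    (hφ : ContDiffOn ℝ n φ U) : ∃ ψ : E → ℝ, ContDiff ℝ n ψ ∧ ψ =ᶠ[𝓝 x] φ := by
  obtain ⟨r, hr, hball⟩ := Metric.isOpen_iff.1 hU x hx
  let f : ContDiffBump x := ⟨r / 4, r / 2, by linarith, by linarith⟩
  refine ⟨fun y => f y * φ y, contDiff_iff_contDiffAt.2 fun y => ?_, ?_⟩
  · by_cases hy : y ∈ U
    · exact f.contDiff.contDiffAt.mul (hφ.contDiffAt (hU.mem_nhds hy))
    · have h1 : y ∉ tsupport f := by
        rw [f.tsupport_eq]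
        exact fun h => hy (hball (Metric.closedBall_subset_ball
          (show r / 2 < r by linarith) h))
      have h2 : (fun y => f y * φ y) =ᶠ[𝓝 y] fun _ => 0 := by
        filter_upwards [notMem_tsupport_iff_eventuallyEq.1 h1] with z hz
        rw [hz, Pi.zero_apply, zero_mul]
      exact contDiffAt_const.congr_of_eventuallyEq h2
  · filter_upwards [f.eventuallyEq_one] with y hy
    rw [hy, Pi.one_apply, one_mul]

theorem nonpos_of_add_isLittleO_nonpos {l : ℝ} {e : ℝ → ℝ}
    (he : e =o[𝓝[>] 0] fun ε : ℝ => ε ^ 2) (h : ∀ᶠ ε in 𝓝[>] (0 : ℝ), ε ^ 2 * l + e ε ≤ 0) :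
    l ≤ 0 := by
  by_contra! hl
  rw [isLittleO_iff] at he
  obtain ⟨ε, h1, h2, h3⟩ := ((he (half_pos hl)).and (h.and self_mem_nhdsWithin)).exists
  have hε : 0 < ε ^ 2 := pow_pos h3 2
  rw [Real.norm_eq_abs, Real.norm_eq_abs, abs_of_pos hε] at h1
  nlinarith [neg_abs_le (e ε)]

namespace CarnotGroup

variable {𝔤 : Type*} [LieRing 𝔤] [LieAlgebra ℝ 𝔤] {m k : ℕ} {G : CarnotGroup 𝔤 m k}
  {p : ℝ≥0∞} {φ ψ u : (Fin m → ℝ) → ℝ} {x : Fin m → ℝ}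

theorem IsMu.unique {ε c c' : ℝ} (h : G.IsMu p ε φ x c) (h' : G.IsMu p ε φ x c') : c = c' := by
  by_contra hne
  exact lt_asymm (h c' (Ne.symm hne)) (h' c hne)

theorem X_eventuallyEq (h : φ =ᶠ[𝓝 x] ψ) (i : Fin m) : G.X i φ =ᶠ[𝓝 x] G.X i ψ :=
  h.fderiv.mono fun y hy => by rw [X, X, hy]

theorem gradNorm_eventuallyEq (h : φ =ᶠ[𝓝 x] ψ) : G.gradNorm φ =ᶠ[𝓝 x] G.gradNorm ψ := by
  filter_upwards [eventually_all.2 fun i => X_eventuallyEq (G := G) h i] with y hy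
  rw [gradNorm, gradNorm]
  simp only [hy]

theorem normLaplacian_congr (h : φ =ᶠ[𝓝 x] ψ) : G.normLaplacian p φ x = G.normLaplacian p ψ x := by
  have h1 := fun i => (X_eventuallyEq (G := G) h i).self_of_nhds
  have h2 := (gradNorm_eventuallyEq (G := G) h).self_of_nhds
  have h3 : ∀ i j, G.X i (G.X j φ) x = G.X i (G.X j ψ) x := fun i j =>
    (X_eventuallyEq (X_eventuallyEq h j) i).self_of_nhds
  have h4 : ∀ i, G.X i (fun y => G.gradNorm φ y ^ (p.toReal - 2) * G.X i φ y) x =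
      G.X i (fun y => G.gradNorm ψ y ^ (p.toReal - 2) * G.X i ψ y) x := fun i => by
    refine (X_eventuallyEq ?_ i).self_of_nhds
    filter_upwards [gradNorm_eventuallyEq (G := G) h, X_eventuallyEq (G := G) h i] with y h5 h6
    rw [h5, h6]
  rw [normLaplacian, normLaplacian]
  simp only [symHess, h1, h2, h3, h4]

theorem X_add_const (d : ℝ) (i : Fin m) : G.X i (fun y => φ y + d) = G.X i φ := by
  funext y
  rw [X, X, fderiv_add_const]

theorem gradNorm_add_const (d : ℝ) : G.gradNorm (fun y => φ y + d) = G.gradNorm φ := by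
  funext y
  simp only [gradNorm, X_add_const]

theorem normLaplacian_add_const (d : ℝ) :
    G.normLaplacian p (fun y => φ y + d) x = G.normLaplacian p φ x := by
  simp only [normLaplacian, symHess, X_add_const, gradNorm_add_const]

/-- Viscosity solutions are tested by functions smooth on all of `Ω`, the mean value property by
functions smooth near `x`. A cutoff `ψ` passes between them, because gradient, Laplacian and strict
extremum depend only on the germ at `x`. -/
theorem IsViscositySolution.asymptoticMeanValue (hp : 1 < p) {Ω : Set (Fin m → ℝ)}
    (hu : G.IsViscositySolution p Ω u) (hx : x ∈ Ω) : G.AsymptoticMeanValue p u x := by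
  obtain ⟨-, ⟨-, hsup⟩, -, hsub⟩ := hu
  refine ⟨fun U hU hxU φ hφ hmin hφu h0 => ?_, fun U hU hxU φ hφ hmax hφu h0 => ?_⟩
  · obtain ⟨c, hc, M, hM, hlo⟩ := exists_isMu_expansion hp (hφ.contDiffAt (hU.mem_nhds hxU)) h0
    obtain ⟨ψ, hψ, hψφ⟩ := exists_contDiff_eventuallyEq (n := 2) hU hxU hφ
    have hΔ : G.normLaplacian p φ x ≤ 0 := by
      rw [← normLaplacian_congr hψφ]
      refine hsup x hx ψ hψ.contDiffOn ?_ ?_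
      · rwa [(gradNorm_eventuallyEq hψφ).self_of_nhds]
      · filter_upwards [hmin, nhdsWithin_le_nhds hψφ] with y hy hy'
        rwa [hψφ.self_of_nhds, hy']
    -- The remainder is the negative of the error in the expansion, so that `M ε` plus it is exactly
    -- `φ x + ε² c Δ φ(x)`.
    refine ⟨M, _, hM, hlo.neg_left, .of_forall fun ε => ?_⟩
    have : ε ^ 2 * (c * G.normLaplacian p φ x) ≤ 0 :=
      mul_nonpos_of_nonneg_of_nonpos (sq_nonneg ε) (mul_nonpos_of_nonneg_of_nonpos hc.le hΔ)
    linarith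
  · obtain ⟨c, hc, M, hM, hlo⟩ := exists_isMu_expansion hp (hφ.contDiffAt (hU.mem_nhds hxU)) h0
    obtain ⟨ψ, hψ, hψφ⟩ := exists_contDiff_eventuallyEq (n := 2) hU hxU hφ
    have hΔ : 0 ≤ G.normLaplacian p φ x := by
      rw [← normLaplacian_congr hψφ]
      refine hsub x hx ψ hψ.contDiffOn ?_ ?_
      · rwa [(gradNorm_eventuallyEq hψφ).self_of_nhds]
      · filter_upwards [hmax, nhdsWithin_le_nhds hψφ] with y hy hy'
        rwa [hψφ.self_of_nhds, hy']
    refine ⟨M, _, hM, hlo.neg_left, .of_forall fun ε => ?_⟩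
    have : 0 ≤ ε ^ 2 * (c * G.normLaplacian p φ x) := by positivity
    linarith

theorem isViscositySupersolution_of_asymptoticMeanValue (hp : 1 < p) {Ω : Set (Fin m → ℝ)}
    (hΩ : IsOpen Ω) (hu : LowerSemicontinuousOn u Ω)
    (h : ∀ x ∈ Ω, G.AsymptoticMeanValue p u x) : G.IsViscositySupersolution p Ω u := by
  refine ⟨hu, fun x hx φ hφ h0 hmin => ?_⟩
  -- The mean value property requires contact at `x`; the added constant changes no derivative.
  set ψ : (Fin m → ℝ) → ℝ := fun y => φ y + (u x - φ x) with hψ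
  have hψΩ : ContDiffOn ℝ 2 ψ Ω := hφ.add contDiffOn_const
  have h0' : G.gradNorm ψ x ≠ 0 := by rwa [hψ, gradNorm_add_const]
  obtain ⟨M', r, hM', hr, hle⟩ := (h x hx).1 Ω hΩ hx ψ hψΩ
    (hmin.mono fun y hy => by simp only [hψ]; linarith) (by simp [hψ]) h0'
  obtain ⟨c, hc, M, hM, hlo⟩ := exists_isMu_expansion hp (hψΩ.contDiffAt (hΩ.mem_nhds hx)) h0'
  rw [hψ, normLaplacian_add_const, ← hψ] at hlo
  refine nonpos_of_mul_nonpos_right (nonpos_of_add_isLittleO_nonpos (hlo.add hr) ?_) hc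
  filter_upwards [hM, hM', hle] with ε h1 h2 h3
  -- The minimizer supplied by the hypothesis is the one in the expansion, by uniqueness.
  rw [h2.unique h1] at h3
  linarith

theorem isViscositySubsolution_of_asymptoticMeanValue (hp : 1 < p) {Ω : Set (Fin m → ℝ)}
    (hΩ : IsOpen Ω) (hu : UpperSemicontinuousOn u Ω)
    (h : ∀ x ∈ Ω, G.AsymptoticMeanValue p u x) : G.IsViscositySubsolution p Ω u := by
  refine ⟨hu, fun x hx φ hφ h0 hmax => ?_⟩
  set ψ : (Fin m → ℝ) → ℝ := fun y => φ y + (u x - φ x) with hψ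
  have hψΩ : ContDiffOn ℝ 2 ψ Ω := hφ.add contDiffOn_const
  have h0' : G.gradNorm ψ x ≠ 0 := by rwa [hψ, gradNorm_add_const]
  obtain ⟨M', r, hM', hr, hle⟩ := (h x hx).2 Ω hΩ hx ψ hψΩ
    (hmax.mono fun y hy => by simp only [hψ]; linarith) (by simp [hψ]) h0'
  obtain ⟨c, hc, M, hM, hlo⟩ := exists_isMu_expansion hp (hψΩ.contDiffAt (hΩ.mem_nhds hx)) h0'
  rw [hψ, normLaplacian_add_const, ← hψ] at hlo
  have : -(c * G.normLaplacian p φ x) ≤ 0 := by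
    refine nonpos_of_add_isLittleO_nonpos (hlo.add hr).neg_left ?_
    filter_upwards [hM, hM', hle] with ε h1 h2 h3
    rw [h2.unique h1] at h3
    linarith
  exact nonneg_of_mul_nonneg_right (neg_nonpos.1 this) hc

end CarnotGroup

/-- A continuous function on an open subset of a Carnot group is a viscosity solution of the
normalized subelliptic `p`-Laplace equation, `1 < p ≤ ∞`, if and only if it has the asymptotic mean
value property for `μ_p` in the viscosity sense at every point. -/
theorem theorem1p1 {𝔤 : Type*} [LieRing 𝔤] [LieAlgebra ℝ 𝔤] {m k : ℕ}
    (G : CarnotGroup 𝔤 m k) (p : ℝ≥0∞) (hp : 1 < p)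
    (Ω : Set (Fin m → ℝ)) (hΩ : IsOpen Ω)
    (u : (Fin m → ℝ) → ℝ) (hu : ContinuousOn u Ω) :
    G.IsViscositySolution p Ω u ↔ ∀ x ∈ Ω, G.AsymptoticMeanValue p u x :=
  ⟨fun h _ hx => h.asymptoticMeanValue hp hx, fun h =>
    ⟨hu, CarnotGroup.isViscositySupersolution_of_asymptoticMeanValue hp hΩ
      hu.lowerSemicontinuousOn h,
      CarnotGroup.isViscositySubsolution_of_asymptoticMeanValue hp hΩ
      hu.upperSemicontinuousOn h⟩⟩

end
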